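/- For integers $k,c\ge 0$, an instance of the $(k,c)$-Disjoint Shortest Paths problem consists of a finite non-empty simple digraph $G=(V,E)$ whose edges carry positive integer weights, and of $k$ pairs $(s_1,t_1),\dots,(s_k,t_k)\in V\times V$. A solution is a family of directed paths $P_1,\dots,P_k$ in $G$ such that each $P_i$ is a shortest path from $s_i$ to $t_i$ (with respect to the weights) and each vertex of $G$ lies on at most $c$ of the paths $P_1,\dots,P_k$ (end vertices of paths count as well). Theorem. There are a single algorithm (a program for the unit-cost random access machine with addition and truncated subtraction), a computable function $f:\mathbb N\to\mathbb N$ and a constant $C$ such that, for all $k$, $c$ and every instance of $(k,c)$-Disjoint Shortest Paths with $G$ acyclic and $|V|=n$, the algorithm halts after at most $$f(k)\cdot n^{C\cdot\max\{d,1\}},\qquad d=\max\{k-c,0\},$$ steps; it outputs a solution if there is one, and otherwise it reports that there is none. In particular, for $d\ge 1$ the problem is solved in time $f(k)\,n^{O(d)}$ on directed acyclic graphs. -/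

import Mathlib

namespace DSP

/-! ### Weighted digraphs and shortest paths -/

/-- A simple digraph whose edges carry positive integer weights. The value of `weight` at a pair
that is not an edge is fixed to be `0`, so that it carries no further data. -/
structure WeightedDigraph (V : Type) extends Digraph V where
  weight : V → V → ℕ
  weight_pos_iff : ∀ u v, 0 < weight u v ↔ Adj u v

namespace WeightedDigraph

variable {V : Type} (G : WeightedDigraph V)

/-- There is no directed cycle (a loop is a directed cycle). -/
def IsAcyclic : Prop := ∀ v, ¬ Relation.TransGen G.Adj v v

/-- `p` is the vertex sequence of a directed path from `s` to `t`. -/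
structure IsPath (s t : V) (p : List V) : Prop where
  chain : p.IsChain G.Adj
  nodup : p.Nodup
  head : p.head? = some s
  last : p.getLast? = some t

/-- The length of a path: the sum of the weights of its edges. -/
def length : List V → ℕ
  | [] => 0
  | [_] => 0
  | u :: v :: p => G.weight u v + length (v :: p)

/-- `p` is a shortest path from `s` to `t`. -/
def IsShortestPath (s t : V) (p : List V) : Prop :=
  G.IsPath s t p ∧ ∀ q, G.IsPath s t q → G.length p ≤ G.length q

end WeightedDigraph

/-! ### Disjoint shortest paths with congestion -/

/-- An instance with `n` vertices, `k` source-terminal pairs and congestion `c`. -/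
structure Instance (n k c : ℕ) where
  graph : WeightedDigraph (Fin n)
  source : Fin k → Fin n
  target : Fin k → Fin n

namespace Instance

variable {n k c : ℕ} (I : Instance n k c)

/-- `P` is a solution: the path `P i` is a shortest path from the `i`-th source to the `i`-th
terminal, and every vertex (be it a terminal or not) lies on at most `c` of the paths. -/
def IsSolution (P : Fin k → List (Fin n)) : Prop :=
  (∀ i, I.graph.IsShortestPath (I.source i) (I.target i) (P i)) ∧
    ∀ v, (Finset.univ.filter fun i => v ∈ P i).card ≤ c

/-- The input as a list of numbers: `n`, `k`, `c`, the `k` source-terminal pairs, and the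
`n × n` weight matrix row by row, in which `0` means that there is no edge. -/
def encode : List ℕ :=
  [n, k, c] ++
    (List.finRange k).flatMap (fun i => [(I.source i : ℕ), (I.target i : ℕ)]) ++
    (List.finRange n).flatMap (fun u => (List.finRange n).map fun v => I.graph.weight u v)

end Instance

/-- A family of paths as a list of numbers: for each path in turn, its number of vertices followed
by its vertices in order. -/
def encodePaths {n k : ℕ} (P : Fin k → List (Fin n)) : List ℕ :=
  (List.finRange k).flatMap fun i => (P i).length :: (P i).map fun v => (v : ℕ)

/-! ### Random access machine

The machine has registers and a memory, both indexed by the natural numbers, and a write-only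
output tape. The operations on numbers are addition and truncated subtraction. Each occurrence of a
constant, register access, memory access, arithmetic operation, write or test counts one step. -/

/-- A configuration of the machine. -/
structure Config where
  reg : ℕ → ℕ
  mem : ℕ → ℕ
  out : List ℕ

/-- Expressions: constants, registers, memory cells (the address is computed), sums and truncated
differences. -/
inductive Expr where
  | lit (a : ℕ)
  | reg (x : ℕ)
  | mem (e : Expr)
  | add (e₁ e₂ : Expr)
  | sub (e₁ e₂ : Expr)

namespace Expr

/-- The value of an expression. -/
def eval (σ : Config) : Expr → ℕ
  | lit a => a
  | reg x => σ.reg x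
  | mem e => σ.mem (e.eval σ)
  | add e₁ e₂ => e₁.eval σ + e₂.eval σ
  | sub e₁ e₂ => e₁.eval σ - e₂.eval σ

/-- The number of steps for the evaluation of an expression. -/
def cost : Expr → ℕ
  | lit _ => 1
  | reg _ => 1
  | mem e => e.cost + 1
  | add e₁ e₂ => e₁.cost + e₂.cost + 1
  | sub e₁ e₂ => e₁.cost + e₂.cost + 1

end Expr

/-- Programs. -/
inductive Program where
  /-- do nothing -/
  | skip
  /-- put the value of `e` into register `x` -/
  | set (x : ℕ) (e : Expr)
  /-- put the value of `e` into the memory cell whose address is the value of `a` -/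
  | store (a e : Expr)
  /-- append the value of `e` to the output -/
  | write (e : Expr)
  | seq (p q : Program)
  /-- run `p` if the value of `e` is not `0`, and `q` otherwise -/
  | ite (e : Expr) (p q : Program)
  /-- run `p` as long as the value of `e` is not `0` -/
  | loop (e : Expr) (p : Program)

/-- `Exec p σ t τ`: started in configuration `σ`, the program `p` halts after exactly `t` steps in
configuration `τ`. -/
inductive Exec : Program → Config → ℕ → Config → Prop where
  | skip (σ : Config) : Exec .skip σ 1 σ
  | set (x : ℕ) (e : Expr) (σ : Config) :
      Exec (.set x e) σ (e.cost + 1) { σ with reg := Function.update σ.reg x (e.eval σ) }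
  | store (a e : Expr) (σ : Config) :
      Exec (.store a e) σ (a.cost + e.cost + 1)
        { σ with mem := Function.update σ.mem (a.eval σ) (e.eval σ) }
  | write (e : Expr) (σ : Config) :
      Exec (.write e) σ (e.cost + 1) { σ with out := σ.out ++ [e.eval σ] }
  | seq {p q : Program} {σ τ ρ : Config} {t u : ℕ} :
      Exec p σ t τ → Exec q τ u ρ → Exec (.seq p q) σ (t + u) ρ
  | ite_true {e : Expr} {p q : Program} {σ τ : Config} {t : ℕ} :
      e.eval σ ≠ 0 → Exec p σ t τ → Exec (.ite e p q) σ (e.cost + 1 + t) τ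
  | ite_false {e : Expr} {p q : Program} {σ τ : Config} {t : ℕ} :
      e.eval σ = 0 → Exec q σ t τ → Exec (.ite e p q) σ (e.cost + 1 + t) τ
  | loop_true {e : Expr} {p : Program} {σ τ ρ : Config} {t u : ℕ} :
      e.eval σ ≠ 0 → Exec p σ t τ → Exec (.loop e p) τ u ρ →
        Exec (.loop e p) σ (e.cost + 1 + t + u) ρ
  | loop_false {e : Expr} {p : Program} {σ : Config} :
      e.eval σ = 0 → Exec (.loop e p) σ (e.cost + 1) σ

/-- The initial configuration: the input stands in the memory from cell `0` on, all other cells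
and all registers are `0`, and the output tape is empty. -/
def initial (input : List ℕ) : Config where
  reg := fun _ => 0
  mem := fun a => input.getD a 0
  out := []

/-- On the given input the program halts after exactly `t` steps, and it has written `output`. -/
def Computes (A : Program) (input : List ℕ) (t : ℕ) (output : List ℕ) : Prop :=
  ∃ τ, Exec A (initial input) t τ ∧ τ.out = output

end DSP

namespace DSP

/-! ### Polynomially bounded functions -/

/-! Write `d = k - c` with truncation. A family of `k` paths respects the capacity `c` exactly if
every vertex is avoided by at least `d` of the paths. The exponent depends on `d` alone because only
`m = min(k, 3d)` of the pairs have to be routed with care.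

Reduction to `3d` pairs. Take a family of more than `3d` shortest paths such that every vertex is
avoided by at least `d` of them, and call a vertex critical if it is avoided by exactly `d`. Any
three critical vertices lie on a common path, since at most `3d` paths miss one of them. Two
shortest paths through `u` and `w` may exchange their segments between `u` and `w`; both remain
shortest paths, and no vertex changes the number of paths that avoid it. Such exchanges collect more
and more critical vertices on one path, until it contains all of them (`exists_through`). This path
can be dropped: a critical vertex keeps its `d` avoiding paths, and any other vertex has one to
spare. Repetition leaves `m` pairs (`exists_small_family`). Conversely, a family for `m` pairs in
which every vertex is avoided by at least `d` paths extends by arbitrary shortest paths for the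
other pairs.

Routing `m` pairs. A pebble for each selected pair moves along edges of shortest paths to its
terminal. A pebble may leave its vertex only if no pebble on another vertex can still come there
along a shortest path. Then all pebbles that ever visit a vertex stand on it together at some
moment, so a bound on the visitors of a vertex is a condition on single states (`card_visitors_le`).
Conversely, a suitable family of paths gives a winning course, by always moving an unfinished pebble
that is first in a topological order (`pebble_induction`). There are about `n ^ m` states and at
most `k ^ m` selections, so a table of the states that lead to the end, computed for each selection,
decides the problem.

Machine. The algorithm is written as a function on stores in which every loop runs for the same
number `B = (n + k + 2) ^ (m + 2)` of rounds. The predicates `CompE`, `CompP` and `CompC` are closed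
under the constructions used, so a program with running time polynomial in `B` comes out by
composition. Finally `B + 1` is at most a function of `k` times `n ^ (5 * max d 1)`. -/

def PolyBdd (T : ℕ → ℕ) : Prop := ∃ a e, ∀ B, T B ≤ a * (B + 1) ^ e

namespace PolyBdd

theorem const (c : ℕ) : PolyBdd fun _ => c := ⟨c, 0, fun B => by simp⟩

theorem id : PolyBdd fun B => B := ⟨1, 1, fun B => by simp⟩

theorem add {T U : ℕ → ℕ} (hT : PolyBdd T) (hU : PolyBdd U) : PolyBdd fun B => T B + U B := by
  obtain ⟨a, e, h⟩ := hT
  obtain ⟨a', e', h'⟩ := hU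
  refine ⟨a + a', max e e', fun B => ?_⟩
  calc T B + U B ≤ a * (B + 1) ^ e + a' * (B + 1) ^ e' := add_le_add (h B) (h' B)
    _ ≤ a * (B + 1) ^ max e e' + a' * (B + 1) ^ max e e' := by
        gcongr <;> simp
    _ = _ := by ring

theorem mul {T U : ℕ → ℕ} (hT : PolyBdd T) (hU : PolyBdd U) : PolyBdd fun B => T B * U B := by
  obtain ⟨a, e, h⟩ := hT
  obtain ⟨a', e', h'⟩ := hU
  refine ⟨a * a', e + e', fun B => ?_⟩
  calc T B * U B ≤ (a * (B + 1) ^ e) * (a' * (B + 1) ^ e') := Nat.mul_le_mul (h B) (h' B)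
    _ = _ := by ring

end PolyBdd

/-! ### Contexts -/

/-- The data that stay fixed during a computation: the number of rounds of every loop, and the
input. -/
structure Base where
  bound : ℕ
  inp : ℕ → ℕ

/-- The data that change: three arrays and the output. -/
structure Store where
  arr : ℕ → ℕ → ℕ
  out : List ℕ

/-- A context holds the fixed data and the values of the variables in scope. -/
class Ctx (α : Type) where
  base : α → Base
  size : ℕ
  var : α → ℕ → ℕ

open Ctx

instance : Ctx Base := ⟨id, 0, fun _ _ => 0⟩

instance {α : Type} [Ctx α] : Ctx (α × ℕ) :=
  ⟨fun p => base p.1, size α + 1, fun p i => if i = size α then p.2 else var p.1 i⟩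

@[simp] theorem base_base (b : Base) : base b = b := rfl

/-- The configuration `σ` represents the store `s`. Cells of the three arrays, and of a fourth one
for auxiliary use, alternate in the memory. -/
structure Holds (b : Base) (s : Store) (σ : Config) : Prop where
  bound : σ.reg 0 = b.bound
  inp : ∀ i < b.bound, σ.mem i = b.inp i
  arr : ∀ a < 3, ∀ i, σ.mem (b.bound + 4 * i + a) = s.arr a i
  out : σ.out = s.out

theorem Holds.congr {b : Base} {s : Store} {σ τ : Config} (h : Holds b s σ)
    (h0 : τ.reg 0 = σ.reg 0) (hm : τ.mem = σ.mem) (ho : τ.out = σ.out) : Holds b s τ :=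
  ⟨h0.trans h.bound, hm ▸ h.inp, hm ▸ h.arr, ho.trans h.out⟩

variable {α : Type} [Ctx α]

/-- The variables of the context `x` stand in the registers given by `loc`. -/
def Located (loc : ℕ → ℕ) (x : α) (σ : Config) : Prop := ∀ i < size α, σ.reg (loc i) = var x i

/-- All registers in use are below `r`. -/
def Fits (α : Type) [Ctx α] (loc : ℕ → ℕ) (r : ℕ) : Prop := 0 < r ∧ ∀ i < size α, loc i < r

theorem Located.congr {loc : ℕ → ℕ} {r : ℕ} {x : α} {σ τ : Config} (hf : Fits α loc r)
    (h : Located loc x σ) (hr : ∀ i < r, τ.reg i = σ.reg i) : Located loc x τ :=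
  fun i hi => (hr _ (hf.2 i hi)).trans (h i hi)

theorem Fits.mono {loc : ℕ → ℕ} {r r' : ℕ} (h : Fits α loc r) (hr : r ≤ r') : Fits α loc r' :=
  ⟨h.1.trans_le hr, fun i hi => (h.2 i hi).trans_le hr⟩

theorem Fits.push {loc : ℕ → ℕ} {r r' q : ℕ} (h : Fits α loc r) (hr : r ≤ r') (hq : q < r') :
    Fits (α × ℕ) (Function.update loc (size α) q) r' := by
  refine ⟨h.1.trans_le hr, fun i hi => ?_⟩
  by_cases hi' : i = size α
  · simpa [hi'] using hq
  · rw [Function.update_of_ne hi']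
    exact (h.2 i (by change i < size α + 1 at hi; omega)).trans_le hr

theorem Located.push {loc : ℕ → ℕ} {q v : ℕ} {x : α} {σ : Config} (h : Located loc x σ)
    (hq : σ.reg q = v) : Located (Function.update loc (size α) q) (x, v) σ := by
  intro i hi
  by_cases hi' : i = size α
  · simp [hi', var, hq]
  · rw [Function.update_of_ne hi', h i (by change i < size α + 1 at hi; omega)]
    simp [var, hi']

/-! ### Functions computed in polynomial time -/

/-- The value of `f` is computed by a program in time polynomial in the bound, for any placement of
the variables; the program puts it into register `r` and changes no register below `r`. -/
def CompE (f : Store → α → ℕ) : Prop :=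
  ∃ (p : (ℕ → ℕ) → ℕ → Program) (T : ℕ → ℕ), PolyBdd T ∧ ∀ loc r, Fits α loc r →
    ∀ s (x : α) σ, Holds (base x) s σ → Located loc x σ →
      ∃ t τ, Exec (p loc r) σ t τ ∧ t ≤ T (base x).bound ∧ τ.reg r = f s x ∧
        (∀ i < r, τ.reg i = σ.reg i) ∧ τ.mem = σ.mem ∧ τ.out = σ.out

/-- The property `q` is decided in time polynomial in the bound. -/
def CompP (q : Store → α → Prop) : Prop :=
  ∃ f : Store → α → ℕ, CompE f ∧ ∀ s x, f s x ≠ 0 ↔ q s x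

/-- The change of the store given by `g` is carried out by a program in time polynomial in the
bound. -/
def CompC (g : Store → α → Store) : Prop :=
  ∃ (p : (ℕ → ℕ) → ℕ → Program) (T : ℕ → ℕ), PolyBdd T ∧ ∀ loc r, Fits α loc r →
    ∀ s (x : α) σ, Holds (base x) s σ → Located loc x σ →
      ∃ t τ, Exec (p loc r) σ t τ ∧ t ≤ T (base x).bound ∧ Holds (base x) (g s x) τ ∧
        (∀ i < r, τ.reg i = σ.reg i)

/-- Iteration with access to the index. -/
def iter {β : Type} (B : ℕ) (z : β) (f : ℕ → β → β) : β :=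
  Nat.rec z (fun i acc => f i acc) B

@[simp] theorem iter_zero {β : Type} (z : β) (f : ℕ → β → β) : iter 0 z f = z := rfl

@[simp] theorem iter_succ {β : Type} (B : ℕ) (z : β) (f : ℕ → β → β) :
    iter (B + 1) z f = f B (iter B z f) := rfl

/-- All loops count the register `y` up to the bound in register `0`. The number of rounds is thus
known in advance, and polynomial running times are preserved under looping. The summand 4 is the
cost of one test. -/
theorem exec_count {y B T : ℕ} {p : Program} (Inv : ℕ → Config → Prop)
    (hI : ∀ i σ, Inv i σ → σ.reg 0 = B ∧ σ.reg y = i)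
    (hp : ∀ i < B, ∀ σ, Inv i σ → ∃ t τ, Exec p σ t τ ∧ t ≤ T ∧ Inv (i + 1) τ)
    (σ : Config) (h0 : Inv 0 σ) :
    ∃ t τ, Exec (.loop (.sub (.reg 0) (.reg y)) p) σ t τ ∧ t ≤ B * (T + 4) + 4 ∧ Inv B τ := by
  suffices H : ∀ j i, i + j = B → ∀ σ, Inv i σ →
      ∃ t τ, Exec (.loop (.sub (.reg 0) (.reg y)) p) σ t τ ∧ t ≤ j * (T + 4) + 4 ∧ Inv B τ from
    H B 0 (by omega) σ h0
  intro j
  induction j with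
  | zero =>
    intro i hi σ h
    obtain ⟨h1, h2⟩ := hI i σ h
    refine ⟨_, σ, Exec.loop_false ?_, ?_, ?_⟩
    · simp [Expr.eval, h1, h2]; omega
    · simp [Expr.cost]
    · have : i = B := by omega
      exact this ▸ h
  | succ j ih =>
    intro i hi σ h
    obtain ⟨h1, h2⟩ := hI i σ h
    obtain ⟨t, τ, hE, ht, hτ⟩ := hp i (by omega) σ h
    obtain ⟨u, ρ, hE', hu, hρ⟩ := ih (i + 1) (by omega) τ hτ
    refine ⟨_, ρ, Exec.loop_true ?_ hE hE', ?_, hρ⟩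
    · simp [Expr.eval, h1, h2]; omega
    · simp only [Expr.cost]
      have : (j + 1) * (T + 4) = j * (T + 4) + (T + 4) := by ring
      omega

/-! ### Computable values -/

namespace CompE

theorem const (c : ℕ) : CompE fun _ (_ : α) => c := by
  refine ⟨fun _ r => .set r (.lit c), _, PolyBdd.const 2, fun loc r hf s x σ h hl =>
    ⟨_, _, Exec.set _ _ _, le_rfl, by simp [Expr.eval], fun i hi => ?_, rfl, rfl⟩⟩
  simp [Function.update_of_ne hi.ne]

theorem bound : CompE fun _ (x : α) => (base x).bound := by
  refine ⟨fun _ r => .set r (.reg 0), _, PolyBdd.const 2, fun loc r hf s x σ h hl =>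
    ⟨_, _, Exec.set _ _ _, le_rfl, by simp [Expr.eval, h.bound], fun i hi => ?_, rfl, rfl⟩⟩
  simp [Function.update_of_ne hi.ne]

theorem last : CompE fun _ (x : α × ℕ) => x.2 := by
  refine ⟨fun loc r => .set r (.reg (loc (size α))), _, PolyBdd.const 2,
    fun loc r hf s x σ h hl => ⟨_, _, Exec.set _ _ _, le_rfl, ?_, fun i hi => ?_, rfl, rfl⟩⟩
  · have := hl (size α) (Nat.lt_succ_self _)
    simpa [Expr.eval, var] using this
  · simp [Function.update_of_ne hi.ne]

/-- Further variables in the context do no harm. -/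
theorem weak {f : Store → α → ℕ} (hf : CompE f) : CompE fun s (x : α × ℕ) => f s x.1 := by
  obtain ⟨p, T, hT, h⟩ := hf
  refine ⟨p, T, hT, fun loc r hr s x σ hH hl => ?_⟩
  refine h loc r ⟨hr.1, fun i hi => hr.2 i (Nat.lt_succ_of_lt hi)⟩ s x.1 σ hH fun i hi => ?_
  have := hl i (Nat.lt_succ_of_lt hi)
  simpa [var, hi.ne] using this

/-- Computation of a function of one value by a single assignment. -/
theorem unop {f g : Store → α → ℕ} (e : ℕ → Expr) (c : ℕ) (hc : ∀ r, (e r).cost + 1 ≤ c)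
    (he : ∀ s (x : α) σ r, 0 < r → Holds (base x) s σ → σ.reg r = f s x → (e r).eval σ = g s x)
    (hf : CompE f) : CompE g := by
  obtain ⟨p, T, hT, h⟩ := hf
  refine ⟨fun loc r => .seq (p loc r) (.set r (e r)), _, hT.add (PolyBdd.const c),
    fun loc r hr s x σ hH hl => ?_⟩
  obtain ⟨t, τ, hE, ht, hv, hreg, hm, ho⟩ := h loc r hr s x σ hH hl
  refine ⟨_, _, hE.seq (Exec.set _ _ _), add_le_add ht (hc r), ?_, fun i hi => ?_, hm, ho⟩
  · simp [he s x τ r hr.1 (hH.congr (hreg 0 hr.1) hm ho) hv]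
  · simp [Function.update_of_ne hi.ne, hreg i hi]

/-- Computation of a function of two values by a single assignment. -/
theorem binop {f g : Store → α → ℕ} (e : Expr → Expr → Expr) (o : ℕ → ℕ → ℕ)
    (hc : ∀ a b, (e a b).cost = a.cost + b.cost + 1)
    (he : ∀ a b σ, (e a b).eval σ = o (a.eval σ) (b.eval σ))
    (hf : CompE f) (hg : CompE g) : CompE fun s x => o (f s x) (g s x) := by
  obtain ⟨p, T, hT, h⟩ := hf
  obtain ⟨q, U, hU, h'⟩ := hg
  refine ⟨fun loc r => .seq (p loc r) (.seq (q loc (r + 1)) (.set r (e (.reg r) (.reg (r + 1))))),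
    _, hT.add (hU.add (PolyBdd.const 4)), fun loc r hr s x σ hH hl => ?_⟩
  obtain ⟨t, τ, hE, ht, hv, hreg, hm, ho⟩ := h loc r hr s x σ hH hl
  obtain ⟨u, ρ, hE', hu, hv', hreg', hm', ho'⟩ := h' loc (r + 1) (hr.mono (Nat.le_succ r)) s x τ
    (hH.congr (hreg 0 hr.1) hm ho) (hl.congr hr hreg)
  refine ⟨_, _, hE.seq (hE'.seq (Exec.set _ _ _)), add_le_add ht (add_le_add hu ?_), ?_,
    fun i hi => ?_, hm'.trans hm, ho'.trans ho⟩
  · simp [hc, Expr.cost]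
  · simp [he, Expr.eval, hv', hreg' r (Nat.lt_succ_self r), hv]
  · simp [Function.update_of_ne hi.ne, hreg i hi, hreg' i (Nat.lt_succ_of_lt hi)]

theorem add {f g : Store → α → ℕ} (hf : CompE f) (hg : CompE g) :
    CompE fun s x => f s x + g s x :=
  binop .add _ (fun _ _ => rfl) (fun _ _ _ => rfl) hf hg

theorem sub {f g : Store → α → ℕ} (hf : CompE f) (hg : CompE g) :
    CompE fun s x => f s x - g s x :=
  binop .sub _ (fun _ _ => rfl) (fun _ _ _ => rfl) hf hg

theorem arr {f : Store → α → ℕ} {a : ℕ} (ha : a < 3) (hf : CompE f) :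
    CompE fun s x => s.arr a (f s x) := by
  refine hf.unop (fun r => .mem (.add (.add (.reg 0) (.add (.add (.reg r) (.reg r))
    (.add (.reg r) (.reg r)))) (.lit a))) 13 (fun r => by simp [Expr.cost]) ?_
  intro s x σ r hr hH hv
  rw [← hH.arr a ha]
  simp only [Expr.eval, hv, hH.bound]
  congr 1; omega

theorem ite_ne {c f g : Store → α → ℕ} (hc : CompE c) (hf : CompE f) (hg : CompE g) :
    CompE fun s x => if c s x ≠ 0 then f s x else g s x := by
  obtain ⟨p, T, hT, h⟩ := hc
  obtain ⟨q, U, hU, h'⟩ := hf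
  obtain ⟨w, W, hW, h''⟩ := hg
  refine ⟨fun loc r => .seq (p loc r) (.ite (.reg r) (q loc r) (w loc r)), _,
    hT.add ((PolyBdd.const 2).add (hU.add hW)), fun loc r hr s x σ hH hl => ?_⟩
  obtain ⟨t, τ, hE, ht, hv, hreg, hm, ho⟩ := h loc r hr s x σ hH hl
  have hH' := hH.congr (hreg 0 hr.1) hm ho
  have hl' := hl.congr hr hreg
  by_cases h0 : c s x = 0
  · obtain ⟨u, ρ, hE', hu, hv', hreg', hm', ho'⟩ := h'' loc r hr s x τ hH' hl'
    refine ⟨_, ρ, hE.seq (Exec.ite_false (hv.trans h0) hE'), ?_, ?_,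
      fun i hi => (hreg' i hi).trans (hreg i hi), hm'.trans hm, ho'.trans ho⟩
    · simp only [Expr.cost]; omega
    · simp [h0, hv']
  · obtain ⟨u, ρ, hE', hu, hv', hreg', hm', ho'⟩ := h' loc r hr s x τ hH' hl'
    refine ⟨_, ρ, hE.seq (Exec.ite_true (by simpa [Expr.eval, hv] using h0) hE'), ?_, ?_,
      fun i hi => (hreg' i hi).trans (hreg i hi), hm'.trans hm, ho'.trans ho⟩
    · simp only [Expr.cost]; omega
    · simp [h0, hv']

/-- Reading the input. -/
def _root_.DSP.Base.read (b : Base) (i : ℕ) : ℕ := if b.bound - i ≠ 0 then b.inp i else 0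

theorem read {f : Store → α → ℕ} (hf : CompE f) : CompE fun s x => (base x).read (f s x) := by
  obtain ⟨p, T, hT, h⟩ := hf
  refine ⟨fun loc r => .seq (p loc r) (.ite (.sub (.reg 0) (.reg r)) (.set r (.mem (.reg r)))
    (.set r (.lit 0))), _, hT.add (PolyBdd.const 7), fun loc r hr s x σ hH hl => ?_⟩
  obtain ⟨t, τ, hE, ht, hv, hreg, hm, ho⟩ := h loc r hr s x σ hH hl
  have hH' := hH.congr (hreg 0 hr.1) hm ho
  by_cases h0 : (base x).bound - f s x = 0
  · refine ⟨_, _, hE.seq (Exec.ite_false ?_ (Exec.set _ _ _)), add_le_add ht ?_, ?_,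
      fun i hi => ?_, hm, ho⟩
    · simp [Expr.eval, hv, hH'.bound, h0]
    · simp [Expr.cost]
    · simp [Expr.eval, Base.read, h0]
    · simp [Function.update_of_ne hi.ne, hreg i hi]
  · refine ⟨_, _, hE.seq (Exec.ite_true ?_ (Exec.set _ _ _)), add_le_add ht ?_, ?_,
      fun i hi => ?_, hm, ho⟩
    · simpa [Expr.eval, hv, hH'.bound] using h0
    · simp [Expr.cost]
    · simp [Expr.eval, Base.read, h0, hv, hH'.inp (f s x) (by omega)]
    · simp [Function.update_of_ne hi.ne, hreg i hi]

theorem iter {f : Store → α → ℕ} {g : Store → α → ℕ → ℕ → ℕ} (hf : CompE f)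
    (hg : CompE fun s (x : (α × ℕ) × ℕ) => g s x.1.1 x.2 x.1.2) :
    CompE fun s x => iter (base x).bound (f s x) fun i acc => g s x i acc := by
  obtain ⟨p, T, hT, h⟩ := hf
  obtain ⟨q, U, hU, h'⟩ := hg
  -- Register `r` holds the accumulator, `r + 1` the counter and `r + 2` the result of the body. The
  -- body sees the first two as new variables.
  refine ⟨fun loc r => .seq (p loc r) (.seq (.set (r + 1) (.lit 0))
    (.loop (.sub (.reg 0) (.reg (r + 1)))
      (.seq (q (Function.update (Function.update loc (size α) r) (size α + 1) (r + 1)) (r + 2))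
        (.seq (.set r (.reg (r + 2)))
          (.set (r + 1) (.add (.reg (r + 1)) (.lit 1))))))), _,
    hT.add ((PolyBdd.const 2).add ((PolyBdd.id.mul ((hU.add (PolyBdd.const 6)).add
      (PolyBdd.const 4))).add (PolyBdd.const 4))), fun loc r hr s x σ hH hl => ?_⟩
  obtain ⟨t, τ, hE, ht, hv, hreg, hm, ho⟩ := h loc r hr s x σ hH hl
  have hr0 := hr.1
  obtain ⟨u, ρ, hE', hu, -, hv', hv'', hreg', hm', ho'⟩ := exec_count (y := r + 1)
    (B := (base x).bound) (T := U (base x).bound + 6)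
    (p := .seq (q (Function.update (Function.update loc (size α) r) (size α + 1) (r + 1)) (r + 2))
        (.seq (.set r (.reg (r + 2))) (.set (r + 1) (.add (.reg (r + 1)) (.lit 1)))))
    (fun i ρ => ρ.reg 0 = (base x).bound ∧ ρ.reg (r + 1) = i ∧
      ρ.reg r = DSP.iter i (f s x) (fun i acc => g s x i acc) ∧
      (∀ i < r, ρ.reg i = σ.reg i) ∧ ρ.mem = σ.mem ∧ ρ.out = σ.out)
    (fun i σ h => ⟨h.1, h.2.1⟩) (by
      rintro i hi σ' ⟨h0, h1, h2, h3, h4, h5⟩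
      have hl' := hl.congr hr h3
      obtain ⟨t, τ, hE, ht, hv, hreg, hm, ho⟩ := h' (Function.update (Function.update loc
        (size α) r) (size α + 1) (r + 1)) (r + 2)
        ((hr.push (r' := r + 2) (q := r) (by omega) (by omega)).push (by omega) (by omega)) s
        ((x, DSP.iter i (f s x) (fun i acc => g s x i acc)), i) σ'
        (hH.congr (h3 0 hr0) h4 h5) ((hl'.push h2).push h1)
      refine ⟨_, _, hE.seq ((Exec.set _ _ _).seq (Exec.set _ _ _)),
        add_le_add ht (by simp [Expr.cost]), ?_, ?_, ?_, fun j hj => ?_, ?_, ?_⟩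
      · simp [hr0.ne, hreg 0, h0]
      · simp [Expr.eval, hreg (r + 1), h1]
      · simp [Expr.eval, hv]
      · have : j ≠ r := by omega
        have : j ≠ r + 1 := by omega
        simp [*, hreg j (by omega)]
      · exact hm.trans h4
      · exact ho.trans h5) { τ with reg := Function.update τ.reg (r + 1) 0 } (by
      refine ⟨?_, ?_, ?_, fun j hj => ?_, hm, ho⟩
      · simp [hreg 0 hr0, hH.bound]
      · simp
      · simp [hv]
      · have : j ≠ r + 1 := by omega
        simp [this, hreg j hj])
  exact ⟨_, ρ, hE.seq ((Exec.set _ _ _).seq hE'), add_le_add ht (add_le_add (by simp [Expr.cost])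
    hu), hv'', hreg', hm', ho'⟩

/-- A variable that is not used may be inserted before the last one. -/
theorem skip {g : Store → α × ℕ → ℕ} (hg : CompE g) :
    CompE fun s (x : (α × ℕ) × ℕ) => g s (x.1.1, x.2) := by
  obtain ⟨p, T, hT, h⟩ := hg
  refine ⟨fun loc r => p (Function.update loc (size α) (loc (size α + 1))) r, T, hT,
    fun loc r hr s x σ hH hl => ?_⟩
  refine h (Function.update loc (size α) (loc (size α + 1))) r ⟨hr.1, fun i hi => ?_⟩ s
    (x.1.1, x.2) σ hH fun i hi => ?_
  · by_cases hi' : i = size α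
    · subst hi'; simpa using hr.2 (size α + 1) (Nat.lt_succ_self _)
    · rw [Function.update_of_ne hi']
      exact hr.2 i (Nat.lt_succ_of_lt hi)
  · by_cases hi' : i = size α
    · subst hi'
      have := hl (size α + 1) (Nat.lt_succ_self _)
      simp only [Function.update_self, this]
      simp [var, size]
    · have hi2 : i < size α + 1 := hi
      have := hl i (Nat.lt_succ_of_lt hi)
      have h3 : i ≠ size α + 1 := by omega
      simp only [Function.update_of_ne hi', this]
      simp [var, size, hi', h3]

theorem sum {g : Store → α → ℕ → ℕ} (hg : CompE fun s (x : α × ℕ) => g s x.1 x.2) :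
    CompE fun s x => ∑ i ∈ Finset.range (base x).bound, g s x i := by
  have := iter (const 0) (g := fun s x i acc => acc + g s x i)
    ((last (α := α)).weak.add hg.skip)
  convert this using 3 with s x
  induction (base x).bound with
  | zero => simp
  | succ n ih => rw [Finset.sum_range_succ, ih]; rfl

end CompE

/-! ### Decidable properties -/

namespace CompP

theorem ite {q : Store → α → Prop} {f g : Store → α → ℕ} {_ : ∀ s x, Decidable (q s x)}
    (hq : CompP q) (hf : CompE f) (hg : CompE g) :
    CompE fun s x => if q s x then f s x else g s x := by
  obtain ⟨c, hc, h⟩ := hq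
  convert hc.ite_ne hf hg using 4 with s x
  exact (h s x).symm

theorem _root_.DSP.CompE.lt {f g : Store → α → ℕ} (hf : CompE f) (hg : CompE g) :
    CompP fun s x => f s x < g s x :=
  ⟨_, hg.sub hf, fun s x => by omega⟩

theorem not {q : Store → α → Prop} (hq : CompP q) : CompP fun s x => ¬ q s x := by
  obtain ⟨c, hc, h⟩ := hq
  refine ⟨_, (CompE.const 1).sub hc, fun s x => ?_⟩
  change 1 - c s x ≠ 0 ↔ ¬ q s x
  rw [← h]; omega

theorem and {q q' : Store → α → Prop} (hq : CompP q) (hq' : CompP q') :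
    CompP fun s x => q s x ∧ q' s x := by
  obtain ⟨c, hc, h⟩ := hq
  obtain ⟨c', hc', h'⟩ := hq'
  refine ⟨_, hc.ite_ne hc' (CompE.const 0), fun s x => ?_⟩
  change _ ↔ q s x ∧ q' s x
  rw [← h, ← h']
  split_ifs with h0 <;> simp [h0]

theorem of_iff {q q' : Store → α → Prop} (hq : CompP q) (h : ∀ s x, q s x ↔ q' s x) :
    CompP q' := by
  obtain ⟨c, hc, h'⟩ := hq
  exact ⟨c, hc, fun s x => (h' s x).trans (h s x)⟩

theorem or {q q' : Store → α → Prop} (hq : CompP q) (hq' : CompP q') :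
    CompP fun s x => q s x ∨ q' s x :=
  (hq.not.and hq'.not).not.of_iff fun s x => by tauto

theorem imp {q q' : Store → α → Prop} (hq : CompP q) (hq' : CompP q') :
    CompP fun s x => q s x → q' s x :=
  (hq.and hq'.not).not.of_iff fun s x => by tauto

theorem _root_.DSP.CompE.le {f g : Store → α → ℕ} (hf : CompE f) (hg : CompE g) : CompP fun s x => f s x ≤ g s x :=
  (hg.lt hf).not.of_iff fun s x => by omega

theorem _root_.DSP.CompE.eq {f g : Store → α → ℕ} (hf : CompE f) (hg : CompE g) : CompP fun s x => f s x = g s x :=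
  ((hf.le hg).and (hg.le hf)).of_iff fun s x => by omega

theorem _root_.DSP.CompE.ne {f g : Store → α → ℕ} (hf : CompE f) (hg : CompE g) : CompP fun s x => f s x ≠ g s x :=
  (hf.eq hg).not

theorem ex {q : Store → α → ℕ → Prop} (hq : CompP fun s (x : α × ℕ) => q s x.1 x.2) :
    CompP fun s x => ∃ i < (base x).bound, q s x i := by
  obtain ⟨c, hc, h⟩ := hq
  refine ⟨_, CompE.sum (g := fun s x i => c s (x, i)) hc, fun s x => ?_⟩
  simp only [ne_eq, Finset.sum_eq_zero_iff, Finset.mem_range, not_forall]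
  exact ⟨fun ⟨i, hi, hc⟩ => ⟨i, hi, (h s (x, i)).1 hc⟩,
    fun ⟨i, hi, hc⟩ => ⟨i, hi, (h s (x, i)).2 hc⟩⟩

theorem all {q : Store → α → ℕ → Prop} (hq : CompP fun s (x : α × ℕ) => q s x.1 x.2) :
    CompP fun s x => ∀ i < (base x).bound, q s x i :=
  (ex (q := fun s x i => ¬ q s x i) hq.not).not.of_iff fun s x => by
    push Not; rfl

end CompP

/-! ### Computable changes of the store -/

namespace CompC

theorem skip : CompC fun s (_ : α) => s :=
  ⟨fun _ _ => .skip, _, PolyBdd.const 1, fun _ _ _ _ _ σ hH _ =>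
    ⟨_, σ, Exec.skip σ, le_rfl, hH, fun _ _ => rfl⟩⟩

theorem seq {f g : Store → α → Store} (hf : CompC f) (hg : CompC g) :
    CompC fun s x => g (f s x) x := by
  obtain ⟨p, T, hT, h⟩ := hf
  obtain ⟨q, U, hU, h'⟩ := hg
  refine ⟨fun loc r => .seq (p loc r) (q loc r), _, hT.add hU, fun loc r hr s x σ hH hl => ?_⟩
  obtain ⟨t, τ, hE, ht, hH', hreg⟩ := h loc r hr s x σ hH hl
  obtain ⟨u, ρ, hE', hu, hH'', hreg'⟩ := h' loc r hr _ x τ hH' (hl.congr hr hreg)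
  exact ⟨_, ρ, hE.seq hE', add_le_add ht hu, hH'', fun i hi => (hreg' i hi).trans (hreg i hi)⟩

/-- Computation of a value that is a variable for the rest of the program. -/
theorem bind {f : Store → α → ℕ} {g : Store → α → ℕ → Store} (hf : CompE f)
    (hg : CompC fun s (x : α × ℕ) => g s x.1 x.2) : CompC fun s x => g s x (f s x) := by
  obtain ⟨p, T, hT, h⟩ := hf
  obtain ⟨q, U, hU, h'⟩ := hg
  refine ⟨fun loc r => .seq (p loc r) (q (Function.update loc (size α) r) (r + 1)), _, hT.add hU,
    fun loc r hr s x σ hH hl => ?_⟩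
  obtain ⟨t, τ, hE, ht, hv, hreg, hm, ho⟩ := h loc r hr s x σ hH hl
  obtain ⟨u, ρ, hE', hu, hH'', hreg'⟩ := h' _ (r + 1) (hr.push (by omega) (by omega)) s
    (x, f s x) τ (hH.congr (hreg 0 hr.1) hm ho) ((hl.congr hr hreg).push hv)
  exact ⟨_, ρ, hE.seq hE', add_le_add ht hu, hH'', fun i hi =>
    (hreg' i (by omega)).trans (hreg i hi)⟩

theorem ite {q : Store → α → Prop} {f g : Store → α → Store} {_ : ∀ s x, Decidable (q s x)}
    (hq : CompP q) (hf : CompC f) (hg : CompC g) :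
    CompC fun s x => if q s x then f s x else g s x := by
  obtain ⟨c, ⟨p, T, hT, h⟩, hcq⟩ := hq
  obtain ⟨q', U, hU, h'⟩ := hf
  obtain ⟨w, W, hW, h''⟩ := hg
  refine ⟨fun loc r => .seq (p loc r) (.ite (.reg r) (q' loc r) (w loc r)), _,
    hT.add ((PolyBdd.const 2).add (hU.add hW)), fun loc r hr s x σ hH hl => ?_⟩
  obtain ⟨t, τ, hE, ht, hv, hreg, hm, ho⟩ := h loc r hr s x σ hH hl
  have hH' := hH.congr (hreg 0 hr.1) hm ho
  have hl' := hl.congr hr hreg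
  by_cases h0 : c s x = 0
  · obtain ⟨u, ρ, hE', hu, hv', hreg'⟩ := h'' loc r hr s x τ hH' hl'
    refine ⟨_, ρ, hE.seq (Exec.ite_false (hv.trans h0) hE'), ?_, ?_,
      fun i hi => (hreg' i hi).trans (hreg i hi)⟩
    · simp only [Expr.cost]; omega
    · have : ¬ q s x := fun hh => (hcq s x).2 hh h0
      simpa [this] using hv'
  · obtain ⟨u, ρ, hE', hu, hv', hreg'⟩ := h' loc r hr s x τ hH' hl'
    refine ⟨_, ρ, hE.seq (Exec.ite_true (by simpa [Expr.eval, hv] using h0) hE'), ?_, ?_,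
      fun i hi => (hreg' i hi).trans (hreg i hi)⟩
    · simp only [Expr.cost]; omega
    · have : q s x := (hcq s x).1 h0
      simpa [this] using hv'

theorem write {f : Store → α → ℕ} (hf : CompE f) :
    CompC fun s x => { s with out := s.out ++ [f s x] } := by
  obtain ⟨p, T, hT, h⟩ := hf
  refine ⟨fun loc r => .seq (p loc r) (.write (.reg r)), _, hT.add (PolyBdd.const 2),
    fun loc r hr s x σ hH hl => ?_⟩
  obtain ⟨t, τ, hE, ht, hv, hreg, hm, ho⟩ := h loc r hr s x σ hH hl
  have hH' := hH.congr (hreg 0 hr.1) hm ho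
  refine ⟨_, _, hE.seq (Exec.write _ _), add_le_add ht le_rfl,
    ⟨hH'.bound, hH'.inp, hH'.arr, ?_⟩, hreg⟩
  simp [Expr.eval, hv, hH'.out]

theorem iter {g : Store → α → ℕ → Store} (hg : CompC fun s (x : α × ℕ) => g s x.1 x.2) :
    CompC fun s x => iter (base x).bound s fun i s => g s x i := by
  obtain ⟨q, U, hU, h'⟩ := hg
  refine ⟨fun loc r => .seq (.set r (.lit 0)) (.loop (.sub (.reg 0) (.reg r))
      (.seq (q (Function.update loc (size α) r) (r + 1)) (.set r (.add (.reg r) (.lit 1))))), _,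
    (PolyBdd.const 2).add ((PolyBdd.id.mul ((hU.add (PolyBdd.const 4)).add
      (PolyBdd.const 4))).add (PolyBdd.const 4)), fun loc r hr s x σ hH hl => ?_⟩
  have hr0 := hr.1
  obtain ⟨u, ρ, hE', hu, -, hHρ, hreg'⟩ := exec_count (y := r)
    (B := (base x).bound) (T := U (base x).bound + 4)
    (p := .seq (q (Function.update loc (size α) r) (r + 1)) (.set r (.add (.reg r) (.lit 1))))
    (fun i ρ => ρ.reg r = i ∧ Holds (base x) (DSP.iter i s fun i s => g s x i) ρ ∧
      (∀ i < r, ρ.reg i = σ.reg i))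
    (fun i σ h => ⟨h.2.1.bound, h.1⟩) (by
      rintro i hi σ' ⟨h0, h1, h2⟩
      obtain ⟨t, τ, hE, ht, hH, hreg⟩ := h' (Function.update loc (size α) r) (r + 1)
        (hr.push (by omega) (by omega)) _ (x, i) σ' h1 ((hl.congr hr h2).push h0)
      refine ⟨_, _, hE.seq (Exec.set _ _ _), add_le_add ht (by simp [Expr.cost]), ?_, ?_,
        fun j hj => ?_⟩
      · simp [Expr.eval, hreg r, h0]
      · exact hH.congr (by simp [hr0.ne]) rfl rfl
      · simp [hj.ne, hreg j (by omega), h2 j hj])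
    { σ with reg := Function.update σ.reg r 0 } (by
      refine ⟨by simp, hH.congr (by simp [hr0.ne]) rfl rfl, fun j hj => ?_⟩
      simp [hj.ne])
  exact ⟨_, ρ, (Exec.set _ _ _).seq hE', add_le_add (by simp [Expr.cost]) hu, hHρ, hreg'⟩

/-- The cells with index below the bound of the array `a` get the values given by `f`. -/
def _root_.DSP.Store.fill (s : Store) (a B : ℕ) (f : ℕ → ℕ) : Store :=
  { s with arr := Function.update s.arr a fun i => if i < B then f i else s.arr a i }

/-- The cell `i` of the array `a` gets the value `v`. -/
def _root_.DSP.Store.set (s : Store) (a i v : ℕ) : Store :=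
  { s with arr := Function.update s.arr a (Function.update (s.arr a) i v) }

/-- The expression for the address of a cell. -/
def cellAddress (a r : ℕ) : Expr :=
  .add (.add (.reg 0) (.add (.add (.reg r) (.reg r)) (.add (.reg r) (.reg r)))) (.lit a)

theorem eval_cellAddress (a r : ℕ) (σ : Config) :
    (cellAddress a r).eval σ = σ.reg 0 + 4 * σ.reg r + a := by
  simp only [cellAddress, Expr.eval]; omega

/-- The case `a = 3` is included on purpose: `Holds` says nothing about the fourth array, so the
lemma also covers writing to the auxiliary cells. -/
theorem holds_update {b : Base} {s : Store} {σ : Config} (h : Holds b s σ) (a : ℕ) (ha : a < 4)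
    (i v : ℕ) : Holds b (s.set a i v)
      { σ with mem := Function.update σ.mem (b.bound + 4 * i + a) v } := by
  refine ⟨h.bound, fun j hj => ?_, fun a' ha' j => ?_, h.out⟩
  · refine (Function.update_of_ne (by omega) _ _).trans (h.inp j hj)
  · by_cases haa : a' = a
    · subst haa
      by_cases hj : j = i
      · subst hj; simp [Store.set]
      · have h1 : b.bound + 4 * j + a' ≠ b.bound + 4 * i + a' := by omega
        simp [Store.set, hj, h.arr a' ha' j]
    · have h1 : b.bound + 4 * j + a' ≠ b.bound + 4 * i + a := by omega
      simp only [Function.update_of_ne h1, Store.set, Function.update_of_ne haa]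
      exact h.arr a' ha' j

theorem set {f : Store → α → ℕ} {a : ℕ} (ha : a < 3) {g : Store → α → ℕ} (hf : CompE f)
    (hg : CompE g) : CompC fun s x => s.set a (f s x) (g s x) := by
  obtain ⟨p, T, hT, h⟩ := hf
  obtain ⟨q, U, hU, h'⟩ := hg
  refine ⟨fun loc r => .seq (p loc r) (.seq (q loc (r + 1)) (.store (cellAddress a r)
    (.reg (r + 1)))), _, hT.add (hU.add (PolyBdd.const 13)), fun loc r hr s x σ hH hl => ?_⟩
  obtain ⟨t, τ, hE, ht, hv, hreg, hm, ho⟩ := h loc r hr s x σ hH hl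
  have hH' := hH.congr (hreg 0 hr.1) hm ho
  obtain ⟨u, ρ, hE', hu, hv', hreg', hm', ho'⟩ := h' loc (r + 1) (hr.mono (Nat.le_succ r)) s x τ
    hH' (hl.congr hr hreg)
  have hH'' := hH'.congr (hreg' 0 (Nat.succ_pos r)) hm' ho'
  refine ⟨_, _, hE.seq (hE'.seq (Exec.store _ _ _)), add_le_add ht (add_le_add hu ?_), ?_,
    fun i hi => ?_⟩
  · simp [cellAddress, Expr.cost]
  · have := holds_update hH'' a (by omega) (f s x) (g s x)
    convert this using 3
    · rw [eval_cellAddress, hH''.bound, hreg' r (Nat.lt_succ_self r), hv]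
    · simp [Expr.eval, hv']
  · exact (hreg' i (by omega)).trans (hreg i hi)

theorem fill {a : ℕ} (ha : a < 3) {f : Store → α → ℕ → ℕ}
    (hf : CompE fun s (x : α × ℕ) => f s x.1 x.2) :
    CompC fun s x => s.fill a (base x).bound (f s x) := by
  obtain ⟨q, U, hU, h'⟩ := hf
  -- The values may depend on the old contents of the array that is overwritten. They are therefore
  -- collected in the fourth array and copied only when all of them are known.
  refine ⟨fun loc r => .seq (.seq (.set r (.lit 0)) (.loop (.sub (.reg 0) (.reg r))
      (.seq (q (Function.update loc (size α) r) (r + 1))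
        (.seq (.store (cellAddress 3 r) (.reg (r + 1))) (.set r (.add (.reg r) (.lit 1)))))))
      (.seq (.set r (.lit 0)) (.loop (.sub (.reg 0) (.reg r))
      (.seq (.store (cellAddress a r) (.mem (cellAddress 3 r)))
        (.set r (.add (.reg r) (.lit 1)))))), _,
    ((PolyBdd.const 2).add ((PolyBdd.id.mul ((hU.add (PolyBdd.const 30)).add
      (PolyBdd.const 4))).add (PolyBdd.const 4))).add
    ((PolyBdd.const 2).add ((PolyBdd.id.mul ((PolyBdd.const 40).add
      (PolyBdd.const 4))).add (PolyBdd.const 4))), fun loc r hr s x σ hH hl => ?_⟩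
  have hr0 := hr.1
  obtain ⟨t, τ, hE, ht, -, hHτ, hcell, hreg⟩ := exec_count (y := r)
    (B := (base x).bound) (T := U (base x).bound + 30)
    (p := .seq (q (Function.update loc (size α) r) (r + 1))
        (.seq (.store (cellAddress 3 r) (.reg (r + 1))) (.set r (.add (.reg r) (.lit 1)))))
    (fun i ρ => ρ.reg r = i ∧ Holds (base x) s ρ ∧
      (∀ j < i, ρ.mem ((base x).bound + 4 * j + 3) = f s x j) ∧ (∀ i < r, ρ.reg i = σ.reg i))
    (fun i σ h => ⟨h.2.1.bound, h.1⟩) (by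
      rintro i hi σ' ⟨h0, h1, h2, h3⟩
      obtain ⟨t, τ, hE, ht, hv, hreg, hm, ho⟩ := h' (Function.update loc (size α) r) (r + 1)
        (hr.push (by omega) (by omega)) _ (x, i) σ' h1 ((hl.congr hr h3).push h0)
      have hH' := h1.congr (hreg 0 (by omega)) hm ho
      refine ⟨_, _, hE.seq ((Exec.store _ _ _).seq (Exec.set _ _ _)),
        add_le_add ht (by simp [Expr.cost, cellAddress]), ?_, ?_, ?_, fun j hj => ?_⟩
      · simp [Expr.eval, hreg r, h0]
      · refine (Holds.congr (σ := { τ with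
          mem := Function.update τ.mem ((base x).bound + 4 * i + 3) (f s x i) }) ?_
          (by simp [hr0.ne]) ?_ rfl)
        · have := holds_update hH' 3 (by omega) i (f s x i)
          exact ⟨this.bound, this.inp, fun a' ha' j => (this.arr a' ha' j).trans (by
            have : a' ≠ 3 := by omega
            simp [Store.set, this]), this.out⟩
        · simp [eval_cellAddress, Expr.eval, hH'.bound, hreg r, h0, hv]
      · intro j hj
        simp only [eval_cellAddress, Expr.eval, hH'.bound, hreg r (Nat.lt_succ_self r), h0, hv]
        by_cases hji : j = i
        · subst hji; simp
        · rw [Function.update_of_ne (by omega), hm]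
          exact h2 j (by omega)
      · simp [hj.ne, hreg j (by omega), h3 j hj])
    { σ with reg := Function.update σ.reg r 0 } (by
      refine ⟨by simp, hH.congr (by simp [hr0.ne]) rfl rfl, by simp, fun j hj => ?_⟩
      simp [hj.ne])
  obtain ⟨u, ρ, hE', hu, -, hHρ, -, hreg'⟩ := exec_count (y := r)
    (B := (base x).bound) (T := 40)
    (p := .seq (.store (cellAddress a r) (.mem (cellAddress 3 r)))
        (.set r (.add (.reg r) (.lit 1))))
    (fun i ρ => ρ.reg r = i ∧ Holds (base x) (s.fill a i (f s x)) ρ ∧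
      (∀ j < (base x).bound, ρ.mem ((base x).bound + 4 * j + 3) = f s x j) ∧
      (∀ i < r, ρ.reg i = σ.reg i))
    (fun i σ h => ⟨h.2.1.bound, h.1⟩) (by
      rintro i hi σ' ⟨h0, h1, h2, h3⟩
      refine ⟨_, _, ((Exec.store _ _ _).seq (Exec.set _ _ _)),
        by simp [Expr.cost, cellAddress], ?_, ?_, ?_, fun j hj => ?_⟩
      · simp [Expr.eval, h0]
      · refine (Holds.congr (σ := { σ' with
          mem := Function.update σ'.mem ((base x).bound + 4 * i + a) (f s x i) }) ?_ (by simp [hr0.ne]) ?_ rfl)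
        · have := holds_update h1 a (by omega) i (f s x i)
          refine ⟨this.bound, this.inp, fun a' ha' j => (this.arr a' ha' j).trans ?_, this.out⟩
          by_cases haa : a' = a
          · subst haa
            by_cases hj : j = i
            · subst hj; simp [Store.set, Store.fill]
            · have : j < i ↔ j ≤ i := by omega
              simp [Store.set, Store.fill, hj, this]
          · simp [Store.set, Store.fill, haa]
        · simp [eval_cellAddress, Expr.eval, h1.bound, h0, h2 i hi]
      · intro j hj
        simp only [eval_cellAddress, Expr.eval, h1.bound, h0, h2 i hi]
        rw [Function.update_of_ne (by omega)]
        exact h2 j hj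
      · simp [hj.ne, h3 j hj])
    { τ with reg := Function.update τ.reg r 0 } (by
      refine ⟨by simp, ?_, hcell, fun j hj => ?_⟩
      · have h1 := hHτ.congr (τ := { τ with reg := Function.update τ.reg r 0 })
          (by simp [hr0.ne]) rfl rfl
        convert h1 using 1
        simp [Store.fill]
      · simp [hj.ne, hreg j hj])
  exact ⟨_, ρ, ((Exec.set _ _ _).seq hE).seq ((Exec.set _ _ _).seq hE'),
    add_le_add (add_le_add (by simp [Expr.cost]) ht) (add_le_add (by simp [Expr.cost]) hu), hHρ,
    hreg'⟩

end CompC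

end DSP

namespace DSP
open Ctx
variable {α : Type} [Ctx α]

/-! ### The algorithm as a function -/

noncomputable section Algorithm

open scoped Classical

/-- A solution of `q` below `B`, and `z` if there is none. -/
def pick (B : ℕ) (q : ℕ → Prop) (z : ℕ) : ℕ := iter B z fun i acc => if q i then i else acc

namespace Base

variable (b : Base)

def numVert : ℕ := b.read 0

def numPairs : ℕ := b.read 1

def capacity : ℕ := b.read 2

/-- The base of the number system for states and selections. -/
def radix : ℕ := b.numVert + b.numPairs + 2

def defect : ℕ := b.numPairs - b.capacity

/-- The number of selected pairs, `min numPairs (3 * defect)`. -/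
def numSel : ℕ := b.numPairs - (b.numPairs - (b.defect + b.defect + b.defect))

/-- The machine offers no multiplication or division. These are done by loops of `bound` rounds, so
the results are the right ones only while the operands that control the loops stay within the bound.
-/
def mul (u v : ℕ) : ℕ := iter b.bound 0 fun i acc => if i < u then acc + v else acc

def pow (j : ℕ) : ℕ := iter b.bound 1 fun i acc => if i < j then b.mul b.radix acc else acc

def div (u v : ℕ) : ℕ := ∑ i ∈ Finset.range b.bound, if b.mul (i + 1) v ≤ u then 1 else 0

def mod (u v : ℕ) : ℕ := u - b.mul (b.div u v) v

def digit (s j : ℕ) : ℕ := b.mod (b.div s (b.pow j)) b.radix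

def weight (u v : ℕ) : ℕ :=
  b.read (3 + (b.numPairs + b.numPairs) + (b.mul u b.numVert + v))

def source (i : ℕ) : ℕ := b.read (3 + (i + i))

def target (i : ℕ) : ℕ := b.read (4 + (i + i))

/-- A number that exceeds the length of every path. -/
def infinity : ℕ :=
  1 + ∑ _i ∈ Finset.range b.bound, ∑ j ∈ Finset.range b.bound, b.read j

def distInit (i : ℕ) : ℕ := if b.div i b.radix = b.mod i b.radix then 0 else b.infinity

/-- The distance from `u` to `v` according to the table `D`. -/
def dist (D : ℕ → ℕ) (u v : ℕ) : ℕ := D (b.mul u b.radix + v)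

/-- One round of improvements of the distance table. -/
def relax (D : ℕ → ℕ) (i : ℕ) : ℕ :=
  iter b.bound (D i) fun y acc =>
    if (y < b.numVert ∧ 0 < b.weight (b.div i b.radix) y) ∧
      b.weight (b.div i b.radix) y + b.dist D y (b.mod i b.radix) < acc
    then b.weight (b.div i b.radix) y + b.dist D y (b.mod i b.radix) else acc

/-- The edge from `u` to `v` begins a shortest path from `u` to `t`. -/
def Tight (D : ℕ → ℕ) (t u v : ℕ) : Prop :=
  (v < b.numVert ∧ 0 < b.weight u v) ∧ b.weight u v + b.dist D v t = b.dist D u t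

/-- One can pass from the state `p` to the state `q`, for the selection `z`. -/
def Move (D : ℕ → ℕ) (z p q : ℕ) : Prop :=
  ∀ j < b.bound, j < b.numSel → b.digit q j = b.digit p j ∨
    (b.Tight D (b.target (b.digit z j)) (b.digit p j) (b.digit q j) ∧
      ∀ l < b.bound, l < b.numSel → b.digit p l ≠ b.digit p j →
        b.dist D (b.digit p l) (b.digit p j) + b.dist D (b.digit p j) (b.target (b.digit z l)) ≠
          b.dist D (b.digit p l) (b.target (b.digit z l)))

/-- The state `p` respects the capacities. -/
def Light (p : ℕ) : Prop :=
  ∀ j < b.bound, j < b.numSel →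
    (∑ l ∈ Finset.range b.bound, if l < b.numSel ∧ b.digit p l = b.digit p j then 1 else 0) ≤
      b.numSel - b.defect

def Final (z p : ℕ) : Prop :=
  ∀ j < b.bound, j < b.numSel → b.digit p j = b.target (b.digit z j)

def Start (z p : ℕ) : Prop :=
  ∀ j < b.bound, j < b.numSel → b.digit p j = b.source (b.digit z j)

/-- The new mark of the state `p` in round `r`. -/
def mark (D T : ℕ → ℕ) (z r p : ℕ) : ℕ :=
  -- Marks are never changed, and the mark records the round; `r + 1` is used because `0` stands for
  -- an unmarked state. Every state marked through a move has a successor with a smaller mark.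
  if T p ≠ 0 then T p else
    if b.Light p ∧ (b.Final z p ∨ ∃ q < b.bound, T q ≠ 0 ∧ b.Move D z p q) then r + 1 else 0

/-- The marks for the selection `z`. -/
def table (s : Store) (z : ℕ) : Store :=
  iter b.bound (s.fill 1 b.bound fun _ => 0) fun r s =>
    s.fill 1 b.bound (b.mark (s.arr 0) (s.arr 1) z r)

def Valid (z : ℕ) : Prop :=
  ∀ j < b.bound, j < b.numSel → b.digit z j < b.numPairs ∧
    ∀ l < b.bound, l < j → b.digit z l ≠ b.digit z j

def Wins (T : ℕ → ℕ) (z : ℕ) : Prop := ∃ p < b.bound, T p ≠ 0 ∧ b.Start z p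

/-- Array 0 contains the distances and array 1 the marks. Cell 0 of array 2 contains the selection
that was found, shifted by one so that `0` can mean that there is none yet. -/
def test (s : Store) (z : ℕ) : Store :=
  if b.Wins (s.arr 1) z then s.set 2 0 (z + 1) else s

def search (s : Store) : Store :=
  iter b.bound s fun z s =>
    if s.arr 2 0 = 0 ∧ b.Valid z then b.test (b.table s z) z else s

/-- For a pair outside the selection this is the only requirement: any shortest path will do. -/
def Feasible (D : ℕ → ℕ) : Prop :=
  ∀ i < b.bound, i < b.numPairs → b.dist D (b.source i) (b.target i) < b.infinity

/-- The state after `r` steps. -/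
def walk (D T : ℕ → ℕ) (z r : ℕ) : ℕ :=
  iter b.bound (pick b.bound (fun p => T p ≠ 0 ∧ b.Start z p) 0) fun i p =>
    -- The mark has to drop, which forces the walk to end; the default `p` makes it rest when there
    -- is no further move.
    if i < r then pick b.bound (fun q => (T q ≠ 0 ∧ T q < T p) ∧ b.Move D z p q) p else p

/-- The place of the pair `i` in the selection. -/
def slot (z i : ℕ) : ℕ := pick b.bound (fun j => j < b.numSel ∧ b.digit z j = i) b.bound

/-- The vertex that is reached after `r` steps from `u` to `t` along a shortest path. -/
def follow (D : ℕ → ℕ) (t u r : ℕ) : ℕ :=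
  iter b.bound u fun i u => if i < r then pick b.bound (fun v => b.Tight D t u v) u else u

/-- The vertex of the path of the pair `i` that is reached after `r` steps. -/
def position (D T : ℕ → ℕ) (z i r : ℕ) : ℕ :=
  if b.slot z i < b.numSel then b.digit (b.walk D T z r) (b.slot z i)
  else b.follow D (b.target i) (b.source i) r

end Base

def Store.write (s : Store) (v : ℕ) : Store := { s with out := s.out ++ [v] }

namespace Base

variable (b : Base)

/-- Pebbles wait, so consecutive positions may coincide. Only changes of position are written, and
the number of vertices is one more than the number of changes. -/
def writePath (s : Store) (z i : ℕ) : Store :=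
  iter b.bound ((s.write (1 + ∑ r ∈ Finset.range b.bound,
      if b.position (s.arr 0) (s.arr 1) z i (r + 1) ≠ b.position (s.arr 0) (s.arr 1) z i r
        then 1 else 0)).write (b.position (s.arr 0) (s.arr 1) z i 0)) fun r s =>
    if b.position (s.arr 0) (s.arr 1) z i (r + 1) ≠ b.position (s.arr 0) (s.arr 1) z i r
      then s.write (b.position (s.arr 0) (s.arr 1) z i (r + 1)) else s

def writeSolution (s : Store) (z : ℕ) : Store :=
  iter b.bound ((b.table s z).write 1) fun i s =>
    if i < b.numPairs then b.writePath s z i else s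

def distances (s : Store) : Store :=
  iter b.bound (s.fill 0 b.bound b.distInit) fun _ s => s.fill 0 b.bound (b.relax (s.arr 0))

def answer (s : Store) : Store :=
  if b.Feasible (s.arr 0) ∧ s.arr 2 0 ≠ 0 then b.writeSolution s (s.arr 2 0 - 1) else s.write 0

def solve (s : Store) : Store := b.answer (b.search (b.distances s))

end Base

end Algorithm

/-! ### Running times of the parts of the algorithm -/

namespace CompE

section
variable {f g h e : Store → α → ℕ}

theorem numVert : CompE fun _ (x : α) => (base x).numVert := (const 0).read

theorem numPairs : CompE fun _ (x : α) => (base x).numPairs := (const 1).read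

theorem capacity : CompE fun _ (x : α) => (base x).capacity := (const 2).read

theorem radix : CompE fun _ (x : α) => (base x).radix := (numVert.add numPairs).add (const 2)

theorem defect : CompE fun _ (x : α) => (base x).defect := numPairs.sub capacity

theorem numSel : CompE fun _ (x : α) => (base x).numSel :=
  numPairs.sub (numPairs.sub ((defect.add defect).add defect))

theorem mul (hf : CompE f) (hg : CompE g) : CompE fun s x => (base x).mul (f s x) (g s x) :=
  iter (g := fun s x i acc => if i < f s x then acc + g s x else acc) (const 0)
    (CompP.ite (last.lt hf.weak.weak) (last.weak.add hg.weak.weak) last.weak)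

theorem pow (hf : CompE f) : CompE fun s x => (base x).pow (f s x) :=
  iter (g := fun s x i acc => if i < f s x then (base x).mul (base x).radix acc else acc)
    (const 1) (CompP.ite (last.lt hf.weak.weak) (radix.mul last.weak) last.weak)

theorem div (hf : CompE f) (hg : CompE g) : CompE fun s x => (base x).div (f s x) (g s x) :=
  sum (g := fun s x i => if (base x).mul (i + 1) (g s x) ≤ f s x then 1 else 0)
    (CompP.ite (((last.add (const 1)).mul hg.weak).le hf.weak) (const 1) (const 0))

theorem mod (hf : CompE f) (hg : CompE g) : CompE fun s x => (base x).mod (f s x) (g s x) :=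
  hf.sub ((hf.div hg).mul hg)

theorem digit (hf : CompE f) (hg : CompE g) : CompE fun s x => (base x).digit (f s x) (g s x) :=
  (hf.div hg.pow).mod radix

theorem weight (hf : CompE f) (hg : CompE g) :
    CompE fun s x => (base x).weight (f s x) (g s x) :=
  (((const 3).add (numPairs.add numPairs)).add ((hf.mul numVert).add hg)).read

theorem source (hf : CompE f) : CompE fun s x => (base x).source (f s x) :=
  ((const 3).add (hf.add hf)).read

theorem target (hf : CompE f) : CompE fun s x => (base x).target (f s x) :=
  ((const 4).add (hf.add hf)).read

theorem infinity : CompE fun _ (x : α) => (base x).infinity :=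
  (const 1).add (sum (g := fun _ x _ => ∑ j ∈ Finset.range (base x).bound, (base x).read j)
    (sum (g := fun _ x j => (base x).read j) last.read))

theorem distInit (hf : CompE f) : CompE fun s x => (base x).distInit (f s x) :=
  CompP.ite ((hf.div radix).eq (hf.mod radix)) (const 0) infinity

theorem dist (hf : CompE f) (hg : CompE g) :
    CompE fun s x => (base x).dist (s.arr 0) (f s x) (g s x) :=
  ((hf.mul radix).add hg).arr (by omega)

theorem relax (hf : CompE f) : CompE fun s x => (base x).relax (s.arr 0) (f s x) := by
  have h0 : CompE fun s (x : (α × ℕ) × ℕ) =>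
      (base x).weight ((base x).div (f s x.1.1) (base x).radix) x.2 :=
    (hf.weak.weak.div radix).weight last
  have h1 := h0.add (last.dist (hf.weak.weak.mod radix))
  exact iter (g := fun s x y acc =>
    if (y < (base x).numVert ∧ 0 < (base x).weight ((base x).div (f s x) (base x).radix) y) ∧
      (base x).weight ((base x).div (f s x) (base x).radix) y +
        (base x).dist (s.arr 0) y ((base x).mod (f s x) (base x).radix) < acc
    then (base x).weight ((base x).div (f s x) (base x).radix) y +
      (base x).dist (s.arr 0) y ((base x).mod (f s x) (base x).radix) else acc)
    (hf.arr (by omega))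
    (CompP.ite (((last.lt numVert).and ((const 0).lt h0)).and (h1.lt last.weak)) h1 last.weak)

theorem pick {q : Store → α → ℕ → Prop} (hq : CompP fun s (x : α × ℕ) => q s x.1 x.2)
    (hf : CompE f) : CompE fun s x => pick (base x).bound (q s x) (f s x) := by
  have hq' : CompP fun s (x : (α × ℕ) × ℕ) => q s x.1.1 x.2 := by
    obtain ⟨c, hc, h⟩ := hq
    exact ⟨_, hc.skip, fun s x => h s (x.1.1, x.2)⟩
  classical
  exact iter (g := fun s x i acc => if q s x i then i else acc) hf (CompP.ite hq' last last.weak)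

end

end CompE

namespace CompP

variable {f g h e : Store → α → ℕ}

theorem tight (hf : CompE f) (hg : CompE g) (hh : CompE h) :
    CompP fun s x => (base x).Tight (s.arr 0) (f s x) (g s x) (h s x) :=
  ((hh.lt CompE.numVert).and ((CompE.const 0).lt (hg.weight hh))).and
    (((hg.weight hh).add (hh.dist hf)).eq (hg.dist hf))

theorem allSel {q : Store → α → ℕ → Prop} (hq : CompP fun s (x : α × ℕ) => q s x.1 x.2) :
    CompP fun s x => ∀ i < (base x).bound, i < (base x).numSel → q s x i :=
  all (q := fun s x i => i < (base x).numSel → q s x i) ((CompE.last.lt CompE.numSel).imp hq)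

theorem move (hf : CompE f) (hg : CompE g) (hh : CompE h) :
    CompP fun s x => (base x).Move (s.arr 0) (f s x) (g s x) (h s x) := by
  refine allSel (q := fun s x j => (base x).digit (h s x) j = (base x).digit (g s x) j ∨
    ((base x).Tight (s.arr 0) ((base x).target ((base x).digit (f s x) j))
      ((base x).digit (g s x) j) ((base x).digit (h s x) j) ∧
      ∀ l < (base x).bound, l < (base x).numSel →
        (base x).digit (g s x) l ≠ (base x).digit (g s x) j →
        (base x).dist (s.arr 0) ((base x).digit (g s x) l) ((base x).digit (g s x) j) +
          (base x).dist (s.arr 0) ((base x).digit (g s x) j)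
            ((base x).target ((base x).digit (f s x) l)) ≠
          (base x).dist (s.arr 0) ((base x).digit (g s x) l)
            ((base x).target ((base x).digit (f s x) l)))) ?_
  have hz := hf.weak.digit CompE.last
  have hp := hg.weak.digit CompE.last
  have hq := hh.weak.digit CompE.last
  refine (hq.eq hp).or ((tight hz.target hp hq).and ?_)
  have hz' := (hf.weak.weak.digit CompE.last).target
  have hp' := hg.weak.weak.digit CompE.last
  have hp'' := hp.weak
  refine allSel (q := fun s (x : α × ℕ) l =>
        (base x).digit (g s x.1) l ≠ (base x).digit (g s x.1) x.2 →
        (base x).dist (s.arr 0) ((base x).digit (g s x.1) l) ((base x).digit (g s x.1) x.2) +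
          (base x).dist (s.arr 0) ((base x).digit (g s x.1) x.2)
            ((base x).target ((base x).digit (f s x.1) l)) ≠
          (base x).dist (s.arr 0) ((base x).digit (g s x.1) l)
            ((base x).target ((base x).digit (f s x.1) l))) ?_
  exact (hp'.ne hp'').imp (((hp'.dist hp'').add (hp''.dist hz')).ne (hp'.dist hz'))

theorem light (hf : CompE f) : CompP fun s x => (base x).Light (f s x) := by
  refine allSel (q := fun s x j => (∑ l ∈ Finset.range (base x).bound,
    if l < (base x).numSel ∧ (base x).digit (f s x) l = (base x).digit (f s x) j then 1 else 0) ≤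
      (base x).numSel - (base x).defect) ?_
  refine CompE.le (CompE.sum (g := fun s (x : α × ℕ) l => if l < (base x).numSel ∧
    (base x).digit (f s x.1) l = (base x).digit (f s x.1) x.2 then 1 else 0) ?_)
    (CompE.numSel.sub CompE.defect)
  exact ite ((CompE.last.lt CompE.numSel).and ((hf.weak.weak.digit CompE.last).eq
    (hf.weak.weak.digit CompE.last.weak))) (CompE.const 1) (CompE.const 0)

theorem final (hf : CompE f) (hg : CompE g) :
    CompP fun s x => (base x).Final (f s x) (g s x) :=
  allSel (q := fun s x j => (base x).digit (g s x) j =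
    (base x).target ((base x).digit (f s x) j))
    ((hg.weak.digit CompE.last).eq (hf.weak.digit CompE.last).target)

theorem start (hf : CompE f) (hg : CompE g) :
    CompP fun s x => (base x).Start (f s x) (g s x) :=
  allSel (q := fun s x j => (base x).digit (g s x) j =
    (base x).source ((base x).digit (f s x) j))
    ((hg.weak.digit CompE.last).eq (hf.weak.digit CompE.last).source)

theorem valid (hf : CompE f) : CompP fun s x => (base x).Valid (f s x) := by
  refine allSel (q := fun s x j => (base x).digit (f s x) j < (base x).numPairs ∧
    ∀ l < (base x).bound, l < j → (base x).digit (f s x) l ≠ (base x).digit (f s x) j) ?_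
  refine ((hf.weak.digit CompE.last).lt CompE.numPairs).and (all (q := fun s (x : α × ℕ) l =>
    l < x.2 → (base x).digit (f s x.1) l ≠ (base x).digit (f s x.1) x.2) ?_)
  exact (CompE.last.lt CompE.last.weak).imp ((hf.weak.weak.digit CompE.last).ne
    (hf.weak.weak.digit CompE.last.weak))

theorem wins (hf : CompE f) : CompP fun s x => (base x).Wins (s.arr 1) (f s x) :=
  ex (q := fun s x p => s.arr 1 p ≠ 0 ∧ (base x).Start (f s x) p)
    (((CompE.last.arr (by omega)).ne (CompE.const 0)).and (start hf.weak CompE.last))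

theorem feasible : CompP fun s (x : α) => (base x).Feasible (s.arr 0) :=
  all (q := fun s x i => i < (base x).numPairs →
    (base x).dist (s.arr 0) ((base x).source i) ((base x).target i) < (base x).infinity)
    ((CompE.last.lt CompE.numPairs).imp
      ((CompE.last.source.dist CompE.last.target).lt CompE.infinity))

end CompP

namespace CompE

variable {f g h e : Store → α → ℕ}

theorem mark (hf : CompE f) (hg : CompE g) (hh : CompE h) :
    CompE fun s x => (base x).mark (s.arr 0) (s.arr 1) (f s x) (g s x) (h s x) := by
  have h1 : CompE fun s x => s.arr 1 (h s x) := hh.arr (by omega)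
  refine CompP.ite (h1.ne (const 0)) h1 (CompP.ite ((CompP.light hh).and
    ((CompP.final hf hh).or (CompP.ex (q := fun s x q => s.arr 1 q ≠ 0 ∧
      (base x).Move (s.arr 0) (f s x) (h s x) q) ?_))) (hg.add (const 1)) (const 0))
  exact ((last.arr (by omega)).ne (const 0)).and (CompP.move hf.weak hh.weak last)

theorem walk (hf : CompE f) (hg : CompE g) :
    CompE fun s x => (base x).walk (s.arr 0) (s.arr 1) (f s x) (g s x) := by
  classical
  refine iter (g := fun s x i p => if i < g s x then DSP.pick (base x).bound (fun q =>
    (s.arr 1 q ≠ 0 ∧ s.arr 1 q < s.arr 1 p) ∧ (base x).Move (s.arr 0) (f s x) p q) p else p)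
    (pick (q := fun s x p => s.arr 1 p ≠ 0 ∧ (base x).Start (f s x) p)
      (((last.arr (by omega)).ne (const 0)).and (CompP.start hf.weak last)) (const 0))
    (CompP.ite (last.lt hg.weak.weak) (pick (q := fun s (x : (α × ℕ) × ℕ) q =>
      (s.arr 1 q ≠ 0 ∧ s.arr 1 q < s.arr 1 x.1.2) ∧
        (base x).Move (s.arr 0) (f s x.1.1) x.1.2 q) ?_ last.weak) last.weak)
  exact (((last.arr (by omega)).ne (const 0)).and ((last.arr (by omega)).lt
    (last.weak.weak.arr (by omega)))).and (CompP.move hf.weak.weak.weak last.weak.weak last)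

theorem slot (hf : CompE f) (hg : CompE g) : CompE fun s x => (base x).slot (f s x) (g s x) :=
  pick (q := fun s x j => j < (base x).numSel ∧ (base x).digit (f s x) j = g s x)
    ((last.lt numSel).and ((hf.weak.digit last).eq hg.weak)) bound

theorem follow (hf : CompE f) (hg : CompE g) (hh : CompE h) :
    CompE fun s x => (base x).follow (s.arr 0) (f s x) (g s x) (h s x) :=
  iter (g := fun s x i u => if i < h s x then DSP.pick (base x).bound
      (fun v => (base x).Tight (s.arr 0) (f s x) u v) u else u) hg
    (CompP.ite (last.lt hh.weak.weak) (pick (q := fun s (x : (α × ℕ) × ℕ) v =>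
      (base x).Tight (s.arr 0) (f s x.1.1) x.1.2 v)
      (CompP.tight hf.weak.weak.weak last.weak.weak last) last.weak) last.weak)

theorem position (hf : CompE f) (hg : CompE g) (hh : CompE h) :
    CompE fun s x => (base x).position (s.arr 0) (s.arr 1) (f s x) (g s x) (h s x) :=
  CompP.ite ((hf.slot hg).lt numSel) ((hf.walk hh).digit (hf.slot hg))
    (hg.target.follow hg.source hh)

end CompE

namespace CompC

variable {f g : Store → α → ℕ}

theorem table (hf : CompE f) : CompC fun s x => (base x).table s (f s x) := by
  refine bind (g := fun s x z => (base x).table s z) hf ?_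
  exact seq (f := fun s (x : α × ℕ) => s.fill 1 (base x).bound fun _ => 0)
    (g := fun s (x : α × ℕ) => DSP.iter (base x).bound s fun r s =>
      s.fill 1 (base x).bound ((base x).mark (s.arr 0) (s.arr 1) x.2 r))
    (fill (by omega) (CompE.const 0))
    (iter (g := fun s (x : α × ℕ) r =>
      s.fill 1 (base x).bound ((base x).mark (s.arr 0) (s.arr 1) x.2 r))
      (fill (f := fun s (x : (α × ℕ) × ℕ) => (base x).mark (s.arr 0) (s.arr 1) x.1.2 x.2)
        (by omega) (CompE.last.weak.weak.mark CompE.last.weak CompE.last)))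

theorem test (hf : CompE f) : CompC fun s x => (base x).test s (f s x) :=
  ite (CompP.wins hf) (set (by omega) (CompE.const 0) (hf.add (CompE.const 1))) skip

theorem search : CompC fun s (x : α) => (base x).search s := by
  classical
  refine iter (g := fun s (x : α) z => if s.arr 2 0 = 0 ∧ (base x).Valid z then
    (base x).test ((base x).table s z) z else s) ?_
  exact ite ((((CompE.const 0).arr (by omega)).eq (CompE.const 0)).and (CompP.valid CompE.last))
    (seq (table CompE.last) (test CompE.last)) skip

theorem writePath (hf : CompE f) (hg : CompE g) :
    CompC fun s x => (base x).writePath s (f s x) (g s x) := by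
  refine bind (g := fun s x z => (base x).writePath s z (g s x)) hf ?_
  refine bind (g := fun s (x : α × ℕ) i => (base x).writePath s x.2 i) hg.weak ?_
  have hp : ∀ {e : Store → ((α × ℕ) × ℕ) → ℕ}, CompE e → CompE fun s x =>
      (base x).position (s.arr 0) (s.arr 1) x.1.2 x.2 (e s x) := fun he =>
    CompE.last.weak.position CompE.last he
  have hp' : CompE fun s (x : ((α × ℕ) × ℕ) × ℕ) =>
      (base x).position (s.arr 0) (s.arr 1) x.1.1.2 x.1.2 x.2 :=
    CompE.last.weak.weak.position CompE.last.weak CompE.last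
  have hp'' : CompE fun s (x : ((α × ℕ) × ℕ) × ℕ) =>
      (base x).position (s.arr 0) (s.arr 1) x.1.1.2 x.1.2 (x.2 + 1) :=
    CompE.last.weak.weak.position CompE.last.weak (CompE.last.add (CompE.const 1))
  refine seq (f := fun s (x : (α × ℕ) × ℕ) => (s.write (1 + ∑ r ∈ Finset.range (base x).bound,
      if (base x).position (s.arr 0) (s.arr 1) x.1.2 x.2 (r + 1) ≠
        (base x).position (s.arr 0) (s.arr 1) x.1.2 x.2 r then 1 else 0)).write
        ((base x).position (s.arr 0) (s.arr 1) x.1.2 x.2 0))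
    (g := fun s (x : (α × ℕ) × ℕ) => DSP.iter (base x).bound s fun r s =>
      if (base x).position (s.arr 0) (s.arr 1) x.1.2 x.2 (r + 1) ≠
        (base x).position (s.arr 0) (s.arr 1) x.1.2 x.2 r
      then s.write ((base x).position (s.arr 0) (s.arr 1) x.1.2 x.2 (r + 1)) else s) ?_ ?_
  · refine seq (f := fun s (x : (α × ℕ) × ℕ) => s.write (1 + ∑ r ∈ Finset.range (base x).bound,
      if (base x).position (s.arr 0) (s.arr 1) x.1.2 x.2 (r + 1) ≠
        (base x).position (s.arr 0) (s.arr 1) x.1.2 x.2 r then 1 else 0))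
      (g := fun s (x : (α × ℕ) × ℕ) => s.write
        ((base x).position (s.arr 0) (s.arr 1) x.1.2 x.2 0))
      (write ((CompE.const 1).add (CompE.sum (g := fun s (x : (α × ℕ) × ℕ) r =>
      if (base x).position (s.arr 0) (s.arr 1) x.1.2 x.2 (r + 1) ≠
        (base x).position (s.arr 0) (s.arr 1) x.1.2 x.2 r then 1 else 0) ?_)))
      (write (hp (CompE.const 0)))
    exact CompP.ite (hp''.ne hp') (CompE.const 1) (CompE.const 0)
  · refine iter (g := fun s (x : (α × ℕ) × ℕ) r =>
      if (base x).position (s.arr 0) (s.arr 1) x.1.2 x.2 (r + 1) ≠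
        (base x).position (s.arr 0) (s.arr 1) x.1.2 x.2 r
      then s.write ((base x).position (s.arr 0) (s.arr 1) x.1.2 x.2 (r + 1)) else s) ?_
    exact ite (hp''.ne hp') (write hp'') skip

theorem writeSolution (hf : CompE f) :
    CompC fun s x => (base x).writeSolution s (f s x) := by
  refine bind (g := fun s x z => (base x).writeSolution s z) hf ?_
  exact seq (f := fun s (x : α × ℕ) => ((base x).table s x.2).write 1)
    (g := fun s (x : α × ℕ) => DSP.iter (base x).bound s fun i s =>
      if i < (base x).numPairs then (base x).writePath s x.2 i else s)
    (seq (f := fun s (x : α × ℕ) => (base x).table s x.2) (table CompE.last)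
      (write (CompE.const 1)))
    (iter (g := fun s (x : α × ℕ) i =>
      if i < (base x).numPairs then (base x).writePath s x.2 i else s)
      (ite (CompE.last.lt CompE.numPairs) (writePath CompE.last.weak CompE.last) skip))

theorem distances : CompC fun s (x : α) => (base x).distances s :=
  seq (f := fun s x => s.fill 0 (base x).bound (base x).distInit)
    (g := fun s x => DSP.iter (base x).bound s fun _ s =>
      s.fill 0 (base x).bound ((base x).relax (s.arr 0)))
    (fill (f := fun _ x => (base x).distInit) (by omega) CompE.last.distInit)
    (iter (g := fun s x _ => s.fill 0 (base x).bound ((base x).relax (s.arr 0)))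
      (fill (f := fun s (x : α × ℕ) => (base x).relax (s.arr 0)) (by omega) CompE.last.relax))

theorem answer : CompC fun s (x : α) => (base x).answer s := by
  have h0 : CompE fun s (_ : α) => s.arr 2 0 := (CompE.const 0).arr (by omega)
  exact ite (CompP.feasible.and (h0.ne (CompE.const 0)))
    (writeSolution (h0.sub (CompE.const 1))) (write (CompE.const 0))

theorem solve : CompC fun s (x : α) => (base x).solve s :=
  (distances.seq search).seq answer

end CompC

end DSP

namespace DSP

/-! ### Shortest paths in acyclic digraphs -/

namespace WeightedDigraph

variable {V : Type} {G : WeightedDigraph V}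

/-- The values of `ρ` increase strictly along the edges. -/
structure IsRank (G : WeightedDigraph V) (ρ : V → ℕ) : Prop where
  inj : Function.Injective ρ
  lt : ∀ u v, G.Adj u v → ρ u < ρ v

/-- The number of ancestors of a vertex increases strictly along edges. Multiplying it by `n` and
adding the vertex itself makes the rank injective; the explicit bound limits the length of walks
later. -/
theorem exists_isRank {n : ℕ} {G : WeightedDigraph (Fin n)} (hG : G.IsAcyclic) :
    ∃ ρ, G.IsRank ρ ∧ ∀ v, ρ v < n * n + n := by
  classical
  let A : Fin n → Finset (Fin n) := fun v => Finset.univ.filter fun u => Relation.TransGen G.Adj u v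
  refine ⟨fun v => n * (A v).card + v, ⟨fun u v h => ?_, fun u v h => ?_⟩, fun v => ?_⟩
  · have := congrArg (· % n) h
    simpa [Nat.mod_eq_of_lt, Fin.ext_iff] using this
  · have h1 : (A u).card < (A v).card := by
      refine Finset.card_lt_card ⟨fun x hx => ?_, fun hs => ?_⟩
      · simp only [A, Finset.mem_filter, Finset.mem_univ, true_and] at hx ⊢
        exact hx.tail h
      · have : u ∈ A u := hs (by simpa [A] using Relation.TransGen.single h)
        exact hG u (by simpa [A] using this)
    have h2 := Nat.mul_le_mul_left n h1
    have := u.isLt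
    rw [Nat.succ_eq_add_one, mul_add] at h2
    omega
  · have h1 : (A v).card ≤ n := by simpa using Finset.card_le_univ (A v)
    have h2 := Nat.mul_le_mul_left n h1
    have := v.isLt
    simp only
    omega

theorem IsRank.pairwise {ρ : V → ℕ} (hρ : G.IsRank ρ) {p : List V} (hp : p.IsChain G.Adj) :
    p.Pairwise fun u v => ρ u < ρ v :=
  haveI : IsTrans V fun u v => ρ u < ρ v := ⟨fun _ _ _ => lt_trans⟩
  List.isChain_iff_pairwise.1 (hp.imp hρ.lt)

theorem IsRank.nodup {ρ : V → ℕ} (hρ : G.IsRank ρ) {p : List V} (hp : p.IsChain G.Adj) :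
    p.Nodup :=
  (hρ.pairwise hp).imp fun h h' => by simp [h'] at h

theorem length_append_cons (p q : List V) (u : V) :
    G.length (p ++ u :: q) = G.length (p ++ [u]) + G.length (u :: q) := by
  induction p with
  | nil => simp [length]
  | cons a p ih =>
    cases p with
    | nil => simp [length]
    | cons b p => simp only [List.cons_append, length] at ih ⊢; omega

theorem length_concat (p : List V) (u v : V) :
    G.length (p ++ [u, v]) = G.length (p ++ [u]) + G.weight u v := by
  rw [length_append_cons]; simp [length]

theorem IsRank.eq_append {ρ : V → ℕ} (hρ : G.IsRank ρ) {p : List V} (hp : p.IsChain G.Adj)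
    {u w : V} (hu : u ∈ p) (hw : w ∈ p) (huw : ρ u < ρ w) :
    ∃ A M C, p = A ++ u :: (M ++ w :: C) := by
  obtain ⟨A, X, rfl⟩ := List.append_of_mem hu
  have h := hρ.pairwise hp
  simp only [List.pairwise_append, List.pairwise_cons, List.mem_cons, List.mem_append] at h hw
  rcases hw with hw | rfl | hw
  · have := h.2.2 w hw u (Or.inl rfl)
    omega
  · omega
  · obtain ⟨M, C, rfl⟩ := List.append_of_mem hw
    exact ⟨A, M, C, rfl⟩

/-- Two shortest paths through `u` and `w` may exchange the segments between these vertices. -/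
theorem IsRank.splice {ρ : V → ℕ} (hρ : G.IsRank ρ) {s t s' t' u w : V} {p q : List V}
    (hp : G.IsShortestPath s t p) (hq : G.IsShortestPath s' t' q) (hup : u ∈ p) (hwp : w ∈ p)
    (huq : u ∈ q) (hwq : w ∈ q) (huw : ρ u < ρ w) :
    ∃ r, G.IsShortestPath s t r ∧
      ∀ v, v ∈ r ↔ if ρ u < ρ v ∧ ρ v < ρ w then v ∈ q else v ∈ p := by
  obtain ⟨A, M, C, rfl⟩ := hρ.eq_append hp.1.chain hup hwp huw
  obtain ⟨A', M', C', rfl⟩ := hρ.eq_append hq.1.chain huq hwq huw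
  have hpath : ∀ {s t A M C s' t' A' M' C'}, G.IsPath s t (A ++ u :: (M ++ w :: C)) →
      G.IsPath s' t' (A' ++ u :: (M' ++ w :: C')) → G.IsPath s t (A ++ u :: (M' ++ w :: C)) := by
    intro s t A M C s' t' A' M' C' h h'
    have hc : (A ++ u :: (M' ++ w :: C)).IsChain G.Adj := by
      have h1 := h.chain
      have h2 := h'.chain
      have e : ∀ A M C, (A ++ u :: (M ++ w :: C)).IsChain G.Adj ↔ (A ++ [u]).IsChain G.Adj ∧
          (u :: M ++ [w]).IsChain G.Adj ∧ (w :: C).IsChain G.Adj := fun A M C =>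
        List.isChain_split.trans (and_congr_right fun _ => by
          rw [← List.cons_append]; exact List.isChain_split)
      rw [e] at h1 h2 ⊢
      exact ⟨h1.1, h2.2.1, h1.2.2⟩
    refine ⟨hc, hρ.nodup hc, ?_, ?_⟩
    · rw [← h.head]; cases A <;> simp
    · have e : ∀ M, (A ++ u :: (M ++ w :: C)).getLast? = (w :: C).getLast? := fun M => by
        rw [show A ++ u :: (M ++ w :: C) = (A ++ u :: M) ++ w :: C by simp,
          List.getLast?_append_of_ne_nil _ (by simp)]
      rw [← h.last, e, e]
  have hlen : ∀ A M C, G.length (A ++ u :: (M ++ w :: C)) =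
      G.length (A ++ [u]) + G.length (u :: (M ++ [w])) + G.length (w :: C) := by
    intro A M C
    rw [length_append_cons A, ← List.cons_append, length_append_cons (u :: M), List.cons_append,
      add_assoc]
  refine ⟨A ++ u :: (M' ++ w :: C), ⟨hpath hp.1 hq.1, fun r hr => ?_⟩, fun v => ?_⟩
  · refine le_trans ?_ (hp.2 r hr)
    -- The segment of `q` is no longer than that of `p`, since otherwise `q` could be shortened by
    -- the segment of `p`.
    have := hq.2 _ (hpath hq.1 hp.1)
    rw [hlen, hlen] at this ⊢
    omega
  · have h1 := hρ.pairwise hp.1.chain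
    have h2 := hρ.pairwise hq.1.chain
    simp only [List.pairwise_append, List.pairwise_cons, List.mem_cons, List.mem_append] at h1 h2 ⊢
    obtain ⟨-, ⟨h3, -, -, h4⟩, h5⟩ := h1
    obtain ⟨-, ⟨h3', ⟨-, ⟨h7, -⟩, h4'⟩⟩, h5'⟩ := h2
    have e1 : v ∈ A → ρ v < ρ u := fun h => h5 v h u (Or.inl rfl)
    have e2 : v ∈ M → ρ u < ρ v ∧ ρ v < ρ w := fun h => ⟨h3 v (Or.inl h), h4 v h w (Or.inl rfl)⟩
    have e3 : v ∈ C → ρ w < ρ v := fun h => by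
      have h1 := hρ.pairwise hp.1.chain
      simp only [List.pairwise_append, List.pairwise_cons] at h1
      exact h1.2.1.2.2.1.1 v h
    have e1' : v ∈ A' → ρ v < ρ u := fun h => h5' v h u (Or.inl rfl)
    have e2' : v ∈ M' → ρ u < ρ v ∧ ρ v < ρ w :=
      fun h => ⟨h3' v (Or.inl h), h4' v h w (Or.inl rfl)⟩
    have e3' : v ∈ C' → ρ w < ρ v := h7 v
    have e4 : v = u → ρ v = ρ u := fun h => by rw [h]
    have e5 : v = w → ρ v = ρ w := fun h => by rw [h]
    split_ifs with hv
    · constructor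
      · rintro (h | h | h | h | h)
        · have := e1 h; omega
        · exact Or.inr (Or.inl h)
        · exact Or.inr (Or.inr (Or.inl h))
        · exact Or.inr (Or.inr (Or.inr (Or.inl h)))
        · have := e3 h; omega
      · rintro (h | h | h | h | h)
        · have := e1' h; omega
        · exact Or.inr (Or.inl h)
        · exact Or.inr (Or.inr (Or.inl h))
        · exact Or.inr (Or.inr (Or.inr (Or.inl h)))
        · have := e3' h; omega
    · constructor
      · rintro (h | h | h | h | h)
        · exact Or.inl h
        · exact Or.inr (Or.inl h)
        · exact absurd (e2' h) hv
        · exact Or.inr (Or.inr (Or.inr (Or.inl h)))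
        · exact Or.inr (Or.inr (Or.inr (Or.inr h)))
      · rintro (h | h | h | h | h)
        · exact Or.inl h
        · exact Or.inr (Or.inl h)
        · exact absurd (e2 h) hv
        · exact Or.inr (Or.inr (Or.inr (Or.inl h)))
        · exact Or.inr (Or.inr (Or.inr (Or.inr h)))

/-! ### Omitting paths from a family -/

section Family

variable [DecidableEq V] {ι : Type} [DecidableEq ι] {s t : ι → V}

/-- The number of paths of the family that avoid `v`. -/
def avoid (S : Finset ι) (P : ι → List V) (v : V) : ℕ := (S.filter fun i => v ∉ P i).card

/-- At a vertex with rank strictly between those of `u` and `w` the exchange swaps the roles of the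
paths `i` and `j`; at any other vertex it changes nothing. Hence the number of avoiding paths is the
same everywhere. -/
theorem IsRank.exchange {ρ : V → ℕ} (hρ : G.IsRank ρ) {S : Finset ι} {P : ι → List V}
    (hP : ∀ i ∈ S, G.IsShortestPath (s i) (t i) (P i)) {i j : ι} (hi : i ∈ S) (hj : j ∈ S)
    (hij : i ≠ j) {u w : V} (hui : u ∈ P i) (hwi : w ∈ P i) (huj : u ∈ P j) (hwj : w ∈ P j)
    (huw : ρ u ≤ ρ w) :
    ∃ P' : ι → List V, (∀ i ∈ S, G.IsShortestPath (s i) (t i) (P' i)) ∧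
      (∀ v, avoid S P' v = avoid S P v) ∧
      ∀ v, v ∈ P' i ↔ if ρ u < ρ v ∧ ρ v < ρ w then v ∈ P j else v ∈ P i := by
  rcases huw.eq_or_lt with huw | huw
  -- If the ranks agree, no vertex lies strictly between, and nothing has to be exchanged.
  · exact ⟨P, hP, fun v => rfl, fun v => by rw [if_neg (by omega)]⟩
  obtain ⟨p, hp, hpm⟩ := hρ.splice (hP i hi) (hP j hj) hui hwi huj hwj huw
  obtain ⟨q, hq, hqm⟩ := hρ.splice (hP j hj) (hP i hi) huj hwj hui hwi huw
  refine ⟨Function.update (Function.update P i p) j q, fun x hx => ?_, fun v => ?_, fun v => ?_⟩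
  · by_cases hxj : x = j
    · subst hxj; simpa using hq
    · by_cases hxi : x = i
      · subst hxi; simpa [hxj] using hp
      · simpa [hxj, hxi] using hP x hx
  · unfold avoid
    by_cases hv : ρ u < ρ v ∧ ρ v < ρ w
    · have key : ∀ x, v ∈ Function.update (Function.update P i p) j q x ↔
          v ∈ P (Equiv.swap i j x) := by
        intro x
        by_cases hxj : x = j
        · subst hxj; simp [hqm, hv]
        · by_cases hxi : x = i
          · subst hxi; simp [hxj, hpm, hv]
          · simp [hxj, hxi, Equiv.swap_apply_of_ne_of_ne]
      refine Finset.card_equiv (Equiv.swap i j) fun x => ?_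
      simp only [Finset.mem_filter, key]
      refine and_congr_left fun _ => ?_
      by_cases hxj : x = j
      · subst hxj; simp [hi, hj]
      · by_cases hxi : x = i
        · subst hxi; simp [hi, hj]
        · simp [Equiv.swap_apply_of_ne_of_ne hxi hxj]
    · congr 1
      ext x
      simp only [Finset.mem_filter]
      refine and_congr_right fun _ => not_congr ?_
      by_cases hxj : x = j
      · subst hxj; simp [hqm, hv]
      · by_cases hxi : x = i
        · subst hxi; simp [hxj, hpm, hv]
        · simp [hxj, hxi]
  · simp [hij, hpm]

/-- Three sets of at most `d` paths each cannot cover `S`. This is where the factor 3 comes from. -/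
theorem exists_through_three {S : Finset ι} {P : ι → List V} {d : ℕ} (hS : 3 * d < S.card)
    {x y z : V} (hx : avoid S P x ≤ d) (hy : avoid S P y ≤ d) (hz : avoid S P z ≤ d) :
    ∃ i ∈ S, x ∈ P i ∧ y ∈ P i ∧ z ∈ P i := by
  by_contra! h
  have : S ⊆ (S.filter fun i => x ∉ P i) ∪ (S.filter fun i => y ∉ P i) ∪
      (S.filter fun i => z ∉ P i) := by
    intro i hi
    have := h i hi
    simp only [Finset.mem_union, Finset.mem_filter]
    tauto
  have h1 := Finset.card_le_card this
  have h2 := Finset.card_union_le ((S.filter fun i => x ∉ P i) ∪ (S.filter fun i => y ∉ P i))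
    (S.filter fun i => z ∉ P i)
  have h3 := Finset.card_union_le (S.filter fun i => x ∉ P i) (S.filter fun i => y ∉ P i)
  unfold avoid at hx hy hz
  omega

/-- Exchanges of segments lead to a path through all vertices of `F`. -/
theorem IsRank.exists_through {ρ : V → ℕ} (hρ : G.IsRank ρ) {S : Finset ι} {d : ℕ}
    (hS : 3 * d < S.card) (F : Finset V) (g : ℕ) : ∀ (P : ι → List V) (i : ι), i ∈ S →
    (∀ i ∈ S, G.IsShortestPath (s i) (t i) (P i)) → (∀ v ∈ F, avoid S P v ≤ d) →
    (F.filter fun v => v ∉ P i).card ≤ g →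
    ∃ (P' : ι → List V) (j : ι), j ∈ S ∧ (∀ i ∈ S, G.IsShortestPath (s i) (t i) (P' i)) ∧
      (∀ v, avoid S P' v = avoid S P v) ∧ ∀ v ∈ F, v ∈ P' j := by
  induction g with
  | zero =>
    intro P i hi hP hF hg
    refine ⟨P, i, hi, hP, fun v => rfl, fun v hv => ?_⟩
    by_contra hvi
    have : v ∈ F.filter fun v => v ∉ P i := by simp [hv, hvi]
    rw [Finset.card_eq_zero.1 (Nat.le_zero.1 hg)] at this
    simp at this
  | succ g ih =>
    intro P i hi hP hF hg
    by_cases hall : ∀ v ∈ F, v ∈ P i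
    · exact ⟨P, i, hi, hP, fun v => rfl, hall⟩
    push Not at hall
    obtain ⟨x, hxF, hxi⟩ := hall
    -- it suffices to find a path through `x` and the vertices of `F` on `P i`
    suffices H : ∃ (P' : ι → List V) (j : ι), j ∈ S ∧
        (∀ i ∈ S, G.IsShortestPath (s i) (t i) (P' i)) ∧ (∀ v, avoid S P' v = avoid S P v) ∧
        x ∈ P' j ∧ ∀ v ∈ F, v ∈ P i → v ∈ P' j by
      obtain ⟨P', j, hj, hP', hav, hxj, hsub⟩ := H
      obtain ⟨P'', j', h1, h2, h3, h4⟩ := ih P' j hj hP' (fun v hv => hav v ▸ hF v hv) (by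
        have : (F.filter fun v => v ∉ P' j).card < (F.filter fun v => v ∉ P i).card := by
          refine Finset.card_lt_card ⟨fun v hv => ?_, fun hs => ?_⟩
          · simp only [Finset.mem_filter] at hv ⊢
            exact ⟨hv.1, fun h => hv.2 (hsub v hv.1 h)⟩
          · have : x ∈ F.filter fun v => v ∉ P' j := hs (by simp [hxF, hxi])
            simp [hxj] at this
        omega)
      exact ⟨P'', j', h1, h2, fun v => (h3 v).trans (hav v), h4⟩
    set H := F.filter fun v => v ∈ P i with hH
    have hHF : ∀ v ∈ H, avoid S P v ≤ d ∧ v ∈ P i := fun v hv => by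
      simp only [hH, Finset.mem_filter] at hv
      exact ⟨hF v hv.1, hv.2⟩
    rcases H.eq_empty_or_nonempty with h0 | h0
    · obtain ⟨j, hj, hxj, -, -⟩ := exists_through_three hS (hF x hxF) (hF x hxF) (hF x hxF)
      refine ⟨P, j, hj, hP, fun v => rfl, hxj, fun v hv hvi => ?_⟩
      have : v ∈ H := by simp [hH, hv, hvi]
      simp [h0] at this
    -- If `H` has vertices on both sides of `x`, let `u` and `w` be its neighbours in `H`. Some path
    -- `j` contains `u`, `x` and `w`; taking over its segment between `u` and `w`, the path `i`
    -- gains `x` and loses no vertex of `H`.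
    by_cases hAC : (H.filter fun v => ρ v < ρ x).Nonempty ∧ (H.filter fun v => ρ x < ρ v).Nonempty
    · obtain ⟨u, hu, hmax⟩ := Finset.exists_max_image _ ρ hAC.1
      obtain ⟨w, hw, hmin⟩ := Finset.exists_min_image _ ρ hAC.2
      simp only [Finset.mem_filter] at hu hw hmax hmin
      obtain ⟨j, hj, huj, hxj, hwj⟩ := exists_through_three hS (hHF u hu.1).1 (hF x hxF)
        (hHF w hw.1).1
      obtain ⟨P', hP', hav, hm⟩ := hρ.exchange hP hi hj (fun h => hxi (h ▸ hxj)) (hHF u hu.1).2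
        (hHF w hw.1).2 huj hwj (by omega)
      refine ⟨P', i, hi, hP', hav, (hm x).2 (by simp [hu.2, hw.2, hxj]), fun v hv hvi => ?_⟩
      have hvH : v ∈ H := by simp [hH, hv, hvi]
      refine (hm v).2 ?_
      rw [if_neg]
      · exact hvi
      · rintro ⟨h1, h2⟩
        have hvx : ρ v ≠ ρ x := fun h => hxi (hρ.inj h ▸ hvi)
        rcases hvx.lt_or_gt with h | h
        · have := hmax v ⟨hvH, h⟩; omega
        · have := hmin v ⟨hvH, h⟩; omega
    -- Otherwise `x` lies outside the span of `H`. With `u` first and `w` last in `H`, a path `j`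
    -- through `u`, `x` and `w` takes over the segment of `P i`, which contains all of `H`, and
    -- keeps `x`.
    · obtain ⟨u, hu, hmin⟩ := Finset.exists_min_image H ρ h0
      obtain ⟨w, hw, hmax⟩ := Finset.exists_max_image H ρ h0
      obtain ⟨j, hj, huj, hxj, hwj⟩ := exists_through_three hS (hHF u hu).1 (hF x hxF)
        (hHF w hw).1
      obtain ⟨P', hP', hav, hm⟩ := hρ.exchange hP hj hi (fun h => hxi (h ▸ hxj)) huj hwj
        (hHF u hu).2 (hHF w hw).2 (hmin w hw)
      refine ⟨P', j, hj, hP', hav, (hm x).2 ?_, fun v hv hvi => ?_⟩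
      · rw [if_neg]
        · exact hxj
        · rintro ⟨h1, h2⟩
          exact hAC ⟨⟨u, by simp [hu, h1]⟩, ⟨w, by simp [hw, h2]⟩⟩
      · have hvH : v ∈ H := by simp [hH, hv, hvi]
        refine (hm v).2 ?_
        split_ifs with h
        · exact hvi
        · have h1 := hmin v hvH
          have h2 := hmax v hvH
          by_cases h3 : ρ u = ρ v
          · exact hρ.inj h3 ▸ huj
          · have h4 : ρ w = ρ v := by omega
            exact hρ.inj h4 ▸ hwj

/-- If every vertex is avoided by `d` paths of a family, then this holds for a family for at most
`3 * d` of the pairs. -/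
theorem IsRank.exists_small_family [Fintype V] {ρ : V → ℕ} (hρ : G.IsRank ρ) {d : ℕ} (g : ℕ) :
    ∀ (S : Finset ι) (P : ι → List V), S.card = g →
    (∀ i ∈ S, G.IsShortestPath (s i) (t i) (P i)) → (∀ v, d ≤ avoid S P v) →
    ∃ (S' : Finset ι) (P' : ι → List V), S'.card = min g (3 * d) ∧
      (∀ i ∈ S', G.IsShortestPath (s i) (t i) (P' i)) ∧ ∀ v, d ≤ avoid S' P' v := by
  induction g with
  | zero => exact fun S P hS hP hd => ⟨S, P, by simp [hS], hP, hd⟩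
  | succ g ih =>
    intro S P hS hP hd
    by_cases hg : g + 1 ≤ 3 * d
    · exact ⟨S, P, by omega, hP, hd⟩
    obtain ⟨i, hi⟩ := Finset.card_pos.1 (show 0 < S.card by omega)
    -- The path `j` contains every vertex avoided by exactly `d` paths, so erasing `j` does not
    -- lower the count there. Elsewhere the count exceeds `d` and drops by at most one.
    obtain ⟨P', j, hj, hP', hav, hthr⟩ := hρ.exists_through (show 3 * d < S.card by omega)
      (Finset.univ.filter fun v => avoid S P v = d) _ P i hi hP
      (by simp +contextual) le_rfl
    obtain ⟨S', P'', h1, h2, h3⟩ := ih (S.erase j) P' (by rw [Finset.card_erase_of_mem hj]; omega)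
      (fun i hi => hP' i (Finset.mem_of_mem_erase hi)) (fun v => by
        have h1 : avoid (S.erase j) P' v = ((S.filter fun i => v ∉ P' i).erase j).card := by
          unfold avoid
          rw [Finset.filter_erase]
        have h2 := hav v
        have h3 := hd v
        by_cases hv : avoid S P v = d
        · have : v ∈ P' j := hthr v (by simp [hv])
          rw [h1, Finset.erase_eq_of_notMem (by simp [this])]
          unfold avoid at h2 h3
          omega
        · have := Finset.pred_card_le_card_erase (s := S.filter fun i => v ∉ P' i) (a := j)
          rw [h1]
          unfold avoid at h2 h3 hv
          omega)
    exact ⟨S', P'', by omega, h2, h3⟩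

end Family

end WeightedDigraph

end DSP

namespace DSP

namespace WeightedDigraph

variable {V : Type} {G : WeightedDigraph V}

/-! ### Distance tables -/

/-- The entries of `D` below `M` are the distances, and all paths are shorter than `M`. -/
structure IsDist (G : WeightedDigraph V) (D : V → V → ℕ) (M : ℕ) : Prop where
  attained : ∀ u v, D u v < M → ∃ p, G.IsPath u v p ∧ G.length p = D u v
  le : ∀ u v p, G.IsPath u v p → D u v ≤ G.length p
  lt : ∀ u v p, G.IsPath u v p → G.length p < M

/-- The edge from `u` to `v` begins a shortest path from `u` to `t`. -/
def Tight (G : WeightedDigraph V) (D : V → V → ℕ) (t u v : V) : Prop :=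
  G.Adj u v ∧ G.weight u v + D v t = D u t

theorem isPath_singleton (u : V) : G.IsPath u u [u] :=
  ⟨List.isChain_singleton u, by simp, by simp, by simp⟩

theorem IsPath.exists_cons {s t : V} {p : List V} (h : G.IsPath s t p) : ∃ q, p = s :: q := by
  cases p with
  | nil => simpa using h.head
  | cons a q => exact ⟨q, by simpa using h.head⟩

theorem IsPath.exists_concat {s t : V} {p : List V} (h : G.IsPath s t p) :
    ∃ q, p = q ++ [t] := by
  rcases List.eq_nil_or_concat p with rfl | ⟨q, a, rfl⟩
  · simpa using h.head
  · exact ⟨q, by simpa using h.last⟩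

theorem IsRank.isPath_append {ρ : V → ℕ} (hρ : G.IsRank ρ) {u v w : V} {p q : List V}
    (hp : G.IsPath u v (p ++ [v])) (hq : G.IsPath v w (v :: q)) : G.IsPath u w (p ++ v :: q) := by
  have hc : (p ++ v :: q).IsChain G.Adj := List.isChain_split.2 ⟨hp.chain, hq.chain⟩
  refine ⟨hc, hρ.nodup hc, ?_, ?_⟩
  · rw [← hp.head]; cases p <;> simp
  · rw [← hq.last, List.getLast?_append_of_ne_nil _ (by simp)]

theorem IsRank.isPath_of_append {ρ : V → ℕ} (hρ : G.IsRank ρ) {u v w : V} {p q : List V}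
    (h : G.IsPath u w (p ++ v :: q)) : G.IsPath u v (p ++ [v]) ∧ G.IsPath v w (v :: q) := by
  obtain ⟨h1, h2⟩ := List.isChain_split.1 h.chain
  refine ⟨⟨h1, hρ.nodup h1, ?_, by simp⟩, ⟨h2, hρ.nodup h2, by simp, ?_⟩⟩
  · rw [← h.head]; cases p <;> simp
  · rw [← h.last, List.getLast?_append_of_ne_nil _ (by simp)]

theorem IsRank.lt_of_isPath {ρ : V → ℕ} (hρ : G.IsRank ρ) {u v : V} {p : List V}
    (h : G.IsPath u v p) (huv : u ≠ v) : ρ u < ρ v ∧ 0 < G.length p := by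
  obtain ⟨q, rfl⟩ := h.exists_cons
  cases q with
  | nil => exact absurd (by simpa using h.last) huv
  | cons b q =>
    have hv : v ∈ b :: q := by
      have := List.mem_of_getLast? h.last
      simp only [List.mem_cons] at this ⊢
      rcases this with h | h
      · exact absurd h.symm huv
      · exact h
    refine ⟨(List.pairwise_cons.1 (hρ.pairwise h.chain)).1 v hv, ?_⟩
    have : 0 < G.weight u b := (G.weight_pos_iff u b).2 (List.isChain_cons_cons.1 h.chain).1
    simp only [length]
    omega

variable {D : V → V → ℕ} {M : ℕ}

theorem IsDist.self (hD : G.IsDist D M) (u : V) : D u u = 0 := by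
  simpa [length] using hD.le u u [u] (isPath_singleton u)

/-- Entries below `M` come from paths, and in an acyclic digraph the concatenation of two paths is
again a path. -/
theorem IsDist.triangle (hD : G.IsDist D M) {ρ : V → ℕ} (hρ : G.IsRank ρ) {u v w : V}
    (h : D u v < M) (h' : D v w < M) : D u w ≤ D u v + D v w := by
  obtain ⟨p, hp, hpl⟩ := hD.attained u v h
  obtain ⟨q, hq, hql⟩ := hD.attained v w h'
  obtain ⟨p, rfl⟩ := hp.exists_concat
  obtain ⟨q, rfl⟩ := hq.exists_cons
  have := hD.le u w _ (hρ.isPath_append hp hq)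
  rw [length_append_cons] at this
  omega

theorem IsDist.isShortestPath_iff (hD : G.IsDist D M) {s t : V} {p : List V} :
    G.IsShortestPath s t p ↔ G.IsPath s t p ∧ G.length p = D s t := by
  refine ⟨fun h => ⟨h.1, ?_⟩, fun h => ⟨h.1, fun q hq => h.2 ▸ hD.le s t q hq⟩⟩
  have h1 := hD.le s t p h.1
  obtain ⟨q, hq, hql⟩ := hD.attained s t (h1.trans_lt (hD.lt s t p h.1))
  have := h.2 q hq
  omega

theorem IsDist.lt_of_isPath (hD : G.IsDist D M) {s t : V} {p : List V} (h : G.IsPath s t p) :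
    D s t < M := (hD.le s t p h).trans_lt (hD.lt s t p h)

/-- The second part of a shortest path is a shortest path. -/
theorem IsDist.length_suffix (hD : G.IsDist D M) {ρ : V → ℕ} (hρ : G.IsRank ρ) {s t u : V}
    {p q : List V} (h : G.IsShortestPath s t (p ++ u :: q)) :
    G.IsPath u t (u :: q) ∧ G.length (u :: q) = D u t := by
  obtain ⟨h1, h2⟩ := hD.isShortestPath_iff.1 h
  obtain ⟨h3, h4⟩ := hρ.isPath_of_append h1
  refine ⟨h4, ?_⟩
  have h5 := hD.le _ _ _ h3
  have h6 := hD.le _ _ _ h4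
  have h7 := hD.triangle hρ (hD.lt_of_isPath h3) (hD.lt_of_isPath h4)
  rw [length_append_cons] at h2
  omega

/-- The first edge of a shortest path. -/
theorem IsDist.exists_tight (hD : G.IsDist D M) {ρ : V → ℕ} (hρ : G.IsRank ρ) {u t : V}
    (h : D u t < M) (hut : u ≠ t) : ∃ v, G.Tight D t u v := by
  obtain ⟨p, hp, hpl⟩ := hD.attained u t h
  obtain ⟨q, rfl⟩ := hp.exists_cons
  cases q with
  | nil => exact absurd (by simpa using hp.last) hut
  | cons v q =>
    have hs : G.IsShortestPath u t ([u] ++ v :: q) := hD.isShortestPath_iff.2 ⟨hp, hpl⟩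
    have := hD.length_suffix hρ hs
    refine ⟨v, (List.isChain_cons_cons.1 hp.chain).1, ?_⟩
    rw [← this.2, ← hpl]
    rfl

/-! ### Traces -/

section Trace

variable [DecidableEq V]

/-- The sequence `a 0, …, a L` without repetitions of consecutive terms. -/
def trace (a : ℕ → V) : ℕ → List V
  | 0 => [a 0]
  | L + 1 => trace a L ++ if a (L + 1) = a L then [] else [a (L + 1)]

theorem trace_eq_concat (a : ℕ → V) (L : ℕ) : ∃ X, trace a L = X ++ [a L] := by
  induction L with
  | zero => exact ⟨[], rfl⟩
  | succ L ih =>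
    by_cases h : a (L + 1) = a L
    · simpa [trace, h] using ih
    · exact ⟨trace a L, by simp [trace, h]⟩

theorem mem_trace {a : ℕ → V} {L : ℕ} {v : V} : v ∈ trace a L ↔ ∃ r ≤ L, a r = v := by
  induction L with
  | zero => simp [trace, eq_comm]
  | succ L ih =>
    have : v ∈ trace a (L + 1) ↔ v ∈ trace a L ∨ a (L + 1) = v := by
      by_cases h : a (L + 1) = a L
      · simp only [trace, h, if_true, List.append_nil]
        exact ⟨Or.inl, fun h' => h'.elim id fun h' => ih.2 ⟨L, le_rfl, h'⟩⟩
      · simp [trace, h, eq_comm]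
    rw [this, ih]
    constructor
    · rintro (⟨r, hr, h⟩ | h)
      · exact ⟨r, by omega, h⟩
      · exact ⟨L + 1, le_rfl, h⟩
    · rintro ⟨r, hr, h⟩
      rcases hr.eq_or_lt with rfl | hr
      · exact Or.inr h
      · exact Or.inl ⟨r, by omega, h⟩

/-- The equations of the tight edges telescope: length covered plus remaining distance stays
constant, and waiting changes neither. -/
theorem isPath_trace {ρ : V → ℕ} (hρ : G.IsRank ρ) {t : V} {a : ℕ → V} {L : ℕ}
    (h : ∀ r < L, a (r + 1) = a r ∨ G.Tight D t (a r) (a (r + 1))) :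
    G.IsPath (a 0) (a L) (trace a L) ∧ G.length (trace a L) + D (a L) t = D (a 0) t := by
  induction L with
  | zero => exact ⟨isPath_singleton _, by simp [trace, length]⟩
  | succ L ih =>
    obtain ⟨h1, h2⟩ := ih fun r hr => h r (by omega)
    by_cases h0 : a (L + 1) = a L
    · simpa [trace, h0] using And.intro h1 h2
    obtain ⟨h3, h4⟩ := (h L (by omega)).resolve_left h0
    obtain ⟨X, hX⟩ := trace_eq_concat a L
    have hX' : trace a (L + 1) = X ++ a L :: [a (L + 1)] := by simp [trace, h0, hX]
    rw [hX] at h1 h2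
    rw [hX', length_concat]
    have hc : [a L, a (L + 1)].IsChain G.Adj := by simpa using h3
    exact ⟨hρ.isPath_append h1 ⟨hc, hρ.nodup hc, by simp, by simp⟩, by omega⟩

/-- A position reached later lies on a shortest path from the current position to the terminal. This
is the very equation that `PebbleMove` excludes for the vertex a pebble leaves. -/
theorem IsDist.add_eq (hD : G.IsDist D M) {ρ : V → ℕ} (hρ : G.IsRank ρ) {t : V} {a : ℕ → V}
    {L : ℕ} (h : ∀ r < L, a (r + 1) = a r ∨ G.Tight D t (a r) (a (r + 1))) (h0 : D (a 0) t < M)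
    {r r' : ℕ} (hr : r ≤ r') (hr' : r' ≤ L) :
    D (a r) (a r') + D (a r') t = D (a r) t := by
  have key : ∀ r ≤ L, D (a r) t < M := by
    intro r hr
    have := (isPath_trace hρ fun r' hr' => h r' (by omega : r' < L) : G.IsPath (a 0) (a r) _ ∧ _).2
    omega
  obtain ⟨e, rfl⟩ := Nat.exists_eq_add_of_le hr
  obtain ⟨h1, h2⟩ := isPath_trace (a := fun i => a (r + i)) (L := e) hρ (t := t) (D := D) (G := G)
    fun i hi => by simpa [add_assoc] using h (r + i) (by omega)
  simp only [add_zero] at h1 h2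
  have h3 := hD.le _ _ _ h1
  have h4 := hD.triangle hρ (hD.lt_of_isPath h1) (key _ hr')
  omega

end Trace

/-! ### The pebble game -/

section Pebbles

variable {J : Type} {t : J → V}

/-- Every pebble stays or moves along a tight edge; it may move only if no pebble on another vertex
can still come to its place along a shortest path. -/
def PebbleMove (G : WeightedDigraph V) (D : V → V → ℕ) (t : J → V) (a b : J → V) : Prop :=
  ∀ j, b j = a j ∨ (G.Tight D (t j) (a j) (b j) ∧
    ∀ l, a l ≠ a j → D (a l) (a j) + D (a j) (t l) ≠ D (a l) (t l))

theorem PebbleMove.tight {a b : J → V} (h : G.PebbleMove D t a b) (j : J) :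
    b j = a j ∨ G.Tight D (t j) (a j) (b j) :=
  (h j).imp_right And.left

variable [DecidableEq V] [Fintype J]

/-- No vertex holds more than `c` pebbles. -/
def IsLight (c : ℕ) (a : J → V) : Prop :=
  ∀ j, (Finset.univ.filter fun l => a l = a j).card ≤ c

/-- In a course of the game no vertex is visited by more than `c` pebbles. -/
theorem card_visitors_le (hD : G.IsDist D M) {ρ : V → ℕ} (hρ : G.IsRank ρ) {a : ℕ → J → V}
    {L c : ℕ} (hm : ∀ r < L, G.PebbleMove D t (a r) (a (r + 1))) (hl : ∀ r ≤ L, IsLight c (a r))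
    (h0 : ∀ j, D (a 0 j) (t j) < M) (w : V) :
    (Finset.univ.filter fun j => ∃ r ≤ L, a r j = w).card ≤ c := by
  classical
  -- The time `r₀` is the first at which some pebble is about to leave `w`, or the end of the game.
  -- All visitors of `w` turn out to be there at this time.
  have hex : ∃ r, r = L ∨ ∃ p, a r p = w ∧ a (r + 1) p ≠ w := ⟨L, Or.inl rfl⟩
  set r₀ := Nat.find hex with hr₀
  have hr₀L : r₀ ≤ L := Nat.find_min' hex (Or.inl rfl)
  have key : ∀ j, (∃ r ≤ L, a r j = w) → a r₀ j = w := by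
    rintro j ⟨r, hr, hrj⟩
    -- A pebble that arrived by the time `r₀` has not left. One that arrives later and is elsewhere
    -- at time `r₀` could still come to `w` along a shortest path, so the departure at `r₀` would be
    -- forbidden.
    rcases le_or_gt r r₀ with hrr | hrr
    · have : ∀ i, r + i ≤ r₀ → a (r + i) j = w := by
        intro i
        induction i with
        | zero => exact fun _ => hrj
        | succ i ih =>
          intro hi
          have h1 := ih (by omega)
          have h2 := Nat.find_min hex (m := r + i) (by omega)
          push Not at h2
          exact h2.2 j h1
      simpa [Nat.add_sub_cancel' hrr] using this (r₀ - r) (by omega)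
    · obtain h1 | ⟨p, hp, hp'⟩ := Nat.find_spec hex
      · omega
      by_contra hj
      have h2 := ((hm r₀ (by omega) p).resolve_left (by rw [hp]; exact hp')).2 j
        (by rw [hp]; exact hj)
      rw [hp, ← hrj] at h2
      exact h2 (hD.add_eq (a := fun r => a r j) hρ (fun r hr => (hm r hr).tight j) (h0 j) hrr.le hr)
  rcases (Finset.univ.filter fun j => ∃ r ≤ L, a r j = w).eq_empty_or_nonempty with he | ⟨j, hj⟩
  · simp [he]
  · simp only [Finset.mem_filter, Finset.mem_univ, true_and] at hj
    refine le_trans (Finset.card_le_card fun l hl => ?_) (hl r₀ hr₀L j)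
    simp only [Finset.mem_filter, Finset.mem_univ, true_and] at hl ⊢
    rw [key l hl, key j hj]

/-- A family of shortest paths is a way to win the game. -/
theorem pebble_induction (hD : G.IsDist D M) {ρ : V → ℕ} (hρ : G.IsRank ρ) {s : J → V} {c : ℕ}
    {P : J → List V} (hP : ∀ j, G.IsShortestPath (s j) (t j) (P j))
    (hc : ∀ v, (Finset.univ.filter fun j => v ∈ P j).card ≤ c)
    {R : ℕ → (J → V) → Prop} (hR0 : IsLight c t → R 0 t)
    (hR : ∀ r a b, IsLight c a → R r b → G.PebbleMove D t a b → R (r + 1) a) :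
    ∃ r, r ≤ ∑ j, (P j).length ∧ R r s := by
  classical
  -- The claim is generalized to any state on the way: `X j` is the part of `P j` still ahead of
  -- pebble `j`. The total number of vertices ahead is the number of moves, as one pebble advances
  -- at a time.
  have main : ∀ r (a : J → V) (X : J → List V), (∀ j, (a j :: X j) <:+ P j) →
      ∑ j, (X j).length = r → R r a := by
    intro r
    induction r with
    | zero =>
      intro a X hX hr
      have hX0 : ∀ j, X j = [] := fun j => by
        have := Finset.sum_eq_zero_iff.1 hr j (Finset.mem_univ j)
        exact List.length_eq_zero_iff.1 this
      have hat : a = t := by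
        funext j
        obtain ⟨A, hA⟩ := hX j
        have := (hP j).1.last
        rw [← hA, hX0 j] at this
        simpa using this
      rw [hat]
      refine hR0 fun j => le_trans (Finset.card_le_card fun l hl => ?_) (hc (t j))
      simp only [Finset.mem_filter, Finset.mem_univ, true_and] at hl ⊢
      rw [← hl, ← hat]
      exact (hX l).subset (by simp)
    | succ r ih =>
      intro a X hX hr
      have hlight : IsLight c a := fun j => by
        refine le_trans (Finset.card_le_card fun l hl => ?_) (hc (a j))
        simp only [Finset.mem_filter, Finset.mem_univ, true_and] at hl ⊢
        rw [← hl]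
        exact (hX l).subset (by simp)
      have hne : (Finset.univ.filter fun j => X j ≠ []).Nonempty := by
        by_contra h
        rw [Finset.not_nonempty_iff_eq_empty, Finset.filter_eq_empty_iff] at h
        rw [Finset.sum_eq_zero fun j hj => by simpa using h hj] at hr
        omega
      -- Among the pebbles that are not yet at the end, one on a vertex of least rank moves.
      obtain ⟨j, hj, hmin⟩ := Finset.exists_min_image _ (fun j => ρ (a j)) hne
      simp only [Finset.mem_filter, Finset.mem_univ, true_and] at hj hmin
      obtain ⟨v, Y, hvY⟩ := List.exists_cons_of_ne_nil hj
      refine hR r a (Function.update a j v) hlight (ih _ (Function.update X j Y) ?_ ?_) ?_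
      · intro l
        by_cases hlj : l = j
        · subst hlj
          simp only [Function.update_self]
          refine List.IsSuffix.trans ?_ (hX l)
          rw [hvY]
          exact List.suffix_cons _ _
        · simpa [hlj] using hX l
      · have h1 := Finset.sum_erase_add Finset.univ (fun j => (X j).length) (Finset.mem_univ j)
        have h2 := Finset.sum_erase_add Finset.univ (fun l => (Function.update X j Y l).length)
          (Finset.mem_univ j)
        have h3 : ∑ x ∈ Finset.univ.erase j, (Function.update X j Y x).length =
            ∑ x ∈ Finset.univ.erase j, (X x).length :=
          Finset.sum_congr rfl fun x hx => by simp [Finset.ne_of_mem_erase hx]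
        simp only [Function.update_self] at h2
        rw [hvY] at h1
        simp only [List.length_cons] at h1
        omega
      · intro l
        by_cases hlj : l = j
        · subst hlj
          obtain ⟨A, hA⟩ := hX l
          rw [hvY] at hA
          have hs := hP l
          rw [← hA] at hs
          obtain ⟨h1, h2⟩ := hD.length_suffix hρ hs
          rw [show A ++ a l :: v :: Y = (A ++ [a l]) ++ v :: Y by simp] at hs
          obtain ⟨h3, h4⟩ := hD.length_suffix hρ hs
          refine Or.inr ⟨⟨?_, ?_⟩, fun x hx he => ?_⟩
          · simpa using (List.isChain_cons_cons.1 h1.chain).1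
          · rw [← h2]; simp [h4, length]
          · obtain ⟨B, hB⟩ := hX x
            have hs' := hP x
            rw [← hB] at hs'
            obtain ⟨h5, h6⟩ := hD.length_suffix hρ hs'
            have h7 := hD.lt_of_isPath h5
            obtain ⟨q, hq, hql⟩ := hD.attained (a x) (a l) (by omega)
            obtain ⟨h8, h9⟩ := hρ.lt_of_isPath hq hx
            -- A pebble `x` that could still come to the vertex being left has smaller rank. If it
            -- is finished, its remaining distance is zero, yet it would have to cover a positive
            -- length; if not, the choice of the moving pebble is contradicted.
            by_cases hXx : X x = []
            · rw [hXx] at h6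
              simp only [length] at h6
              omega
            · have := hmin x hXx
              omega
        · left; simp [hlj]
  choose X hX using fun j => (hP j).1.exists_cons
  refine ⟨∑ j, (X j).length, Finset.sum_le_sum fun j _ => ?_, main _ s X (fun j => ?_) rfl⟩
  · rw [hX j]; simp
  · rw [hX j]

end Pebbles

end WeightedDigraph

end DSP

namespace DSP

/-! ### Arithmetic of the algorithm -/

theorem iter_induction {β : Type} {B : ℕ} {z : β} {f : ℕ → β → β} (Inv : ℕ → β → Prop)
    (h0 : Inv 0 z) (h : ∀ i < B, ∀ a, Inv i a → Inv (i + 1) (f i a)) : Inv B (iter B z f) := by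
  induction B with
  | zero => exact h0
  | succ B ih => exact h B (Nat.lt_succ_self B) _ (ih fun i hi => h i (Nat.lt_succ_of_lt hi))

/-- Loops always have `B` rounds; an `r`-fold iteration with `r ≤ B` is obtained by letting the
remaining rounds idle. -/
theorem iter_ite_lt {β : Type} (B : ℕ) (z : β) (f : β → β) (r : ℕ) :
    iter B z (fun i a => if i < r then f a else a) = f^[min r B] z := by
  induction B with
  | zero => simp
  | succ B ih =>
    rw [iter_succ, ih]
    by_cases h : B < r
    · rw [if_pos h, min_eq_right h.le, min_eq_right h, Function.iterate_succ_apply']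
    · rw [if_neg h, min_eq_left (by omega), min_eq_left (by omega)]

theorem pick_spec (B : ℕ) (q : ℕ → Prop) (z : ℕ) :
    (pick B q z < B ∧ q (pick B q z)) ∨ (pick B q z = z ∧ ∀ i < B, ¬ q i) := by
  classical
  unfold pick
  refine iter_induction (Inv := fun j x => (x < j ∧ q x) ∨ (x = z ∧ ∀ i < j, ¬ q i))
    (Or.inr ⟨rfl, by simp⟩) fun i _ a ha => ?_
  split_ifs with hi
  · exact Or.inl ⟨Nat.lt_succ_self i, hi⟩
  · refine ha.imp (fun h => ⟨by omega, h.2⟩) fun h => ⟨h.1, fun j hj => ?_⟩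
    rcases (Nat.lt_succ_iff_lt_or_eq.1 hj) with hj | rfl
    · exact h.2 j hj
    · exact hi

namespace Base

variable {b : Base}

theorem mul_eq {u : ℕ} (hu : u ≤ b.bound) (v : ℕ) : b.mul u v = u * v := by
  unfold mul
  rw [iter_ite_lt b.bound 0 (fun a => a + v) u, min_eq_left hu]
  clear hu
  induction u with
  | zero => simp
  | succ u ih => rw [Function.iterate_succ_apply', ih]; ring

theorem div_eq {u v : ℕ} (hv : 0 < v) (hu : u ≤ b.bound) : b.div u v = u / v := by
  unfold div
  rw [← Finset.card_filter]
  have : (Finset.range b.bound).filter (fun i => b.mul (i + 1) v ≤ u) =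
      Finset.range (u / v) := by
    ext i
    have h1 := Nat.div_le_self u v
    simp only [Finset.mem_filter, Finset.mem_range]
    constructor
    · rintro ⟨hi, h⟩
      rw [mul_eq (by omega)] at h
      exact (Nat.le_div_iff_mul_le hv).2 h
    · intro h
      refine ⟨by omega, ?_⟩
      rw [mul_eq (by omega)]
      exact (Nat.le_div_iff_mul_le hv).1 h
  rw [this, Finset.card_range]

theorem mod_eq {u v : ℕ} (hv : 0 < v) (hu : u ≤ b.bound) : b.mod u v = u % v := by
  unfold mod
  rw [div_eq hv hu, mul_eq ((Nat.div_le_self u v).trans hu), mul_comm, Nat.mod_eq_sub]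

theorem pow_eq (hb : b.radix ≤ b.bound) {j : ℕ} (hj : j ≤ b.bound) :
    b.pow j = b.radix ^ j := by
  unfold pow
  rw [iter_ite_lt b.bound 1 (fun a => b.mul b.radix a) j, min_eq_left hj]
  clear hj
  induction j with
  | zero => simp
  | succ j ih => rw [Function.iterate_succ_apply', ih, mul_eq hb]; ring

theorem radix_pos : 0 < b.radix := by unfold radix; omega

theorem digit_eq (hb : b.radix ≤ b.bound) {s j : ℕ} (hs : s ≤ b.bound) (hj : j ≤ b.bound) :
    b.digit s j = s / b.radix ^ j % b.radix := by
  unfold digit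
  rw [pow_eq hb hj, div_eq (pow_pos radix_pos _) hs,
    mod_eq radix_pos ((Nat.div_le_self _ _).trans hs)]

end Base

theorem exists_digits {N : ℕ} (m : ℕ) : ∀ f : ℕ → ℕ, (∀ j < m, f j < N) →
    ∃ p < N ^ m, ∀ j < m, p / N ^ j % N = f j := by
  induction m with
  | zero => exact fun f _ => ⟨0, by simp⟩
  | succ m ih =>
    intro f hf
    obtain ⟨p, hp, h⟩ := ih (fun j => f (j + 1)) fun j hj => hf (j + 1) (by omega)
    have h0 := hf 0 (by omega)
    refine ⟨f 0 + N * p, ?_, fun j hj => ?_⟩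
    · have := Nat.mul_le_mul_left N hp
      rw [Nat.succ_eq_add_one, mul_add] at this
      rw [pow_succ']
      omega
    · cases j with
      | zero => simp [Nat.mod_eq_of_lt h0]
      | succ j =>
        rw [pow_succ', ← Nat.div_div_eq_div_mul, Nat.add_mul_div_left _ _ (by omega),
          Nat.div_eq_of_lt h0, zero_add]
        exact h j (by omega)

theorem getD_flatMap_finRange {k l : ℕ} (f : Fin k → List ℕ) (hf : ∀ i, (f i).length = l)
    (i : Fin k) {e : ℕ} (he : e < l) :
    ((List.finRange k).flatMap f).getD (i * l + e) 0 = (f i).getD e 0 := by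
  induction k with
  | zero => exact i.elim0
  | succ k ih =>
    rw [List.finRange_succ, List.flatMap_cons, List.flatMap_map]
    refine Fin.cases ?_ (fun i => ?_) i
    · simp only [Fin.val_zero, zero_mul, zero_add]
      rw [List.getD_append _ _ _ _ (by rw [hf]; exact he)]
    · have : ((i.succ : Fin (k + 1)) : ℕ) * l + e = l + (i * l + e) := by
        simp only [Fin.val_succ]; ring
      rw [List.getD_append_right _ _ _ _ (by rw [hf]; omega), hf, this, Nat.add_sub_cancel_left]
      exact ih (fun i => f i.succ) (fun i => hf _) i

theorem length_flatMap_finRange {k l : ℕ} (f : Fin k → List ℕ) (hf : ∀ i, (f i).length = l) :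
    ((List.finRange k).flatMap f).length = k * l := by
  simp [List.length_flatMap, hf]

/-! ### Access to the encoded instance, and sizes of the numbers -/

namespace Instance

/-- The number of selected pairs. -/
def selCount (k c : ℕ) : ℕ := k - (k - ((k - c) + (k - c) + (k - c)))

variable {n k c : ℕ} (I : Instance n k c)

/-- The fixed data for the algorithm on the instance `I`. -/
def toBase : Base where
  -- A state or a selection is a number with `selCount k c` digits in base `n + k + 2`. Two more
  -- factors make room for the input and for the distance table, and exceed the length of every
  -- walk.
  bound := (n + k + 2) ^ (selCount k c + 2)
  inp i := I.encode.getD i 0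

theorem length_encode : I.encode.length = 3 + k * 2 + n * n := by
  unfold encode
  rw [List.length_append, List.length_append, length_flatMap_finRange _ (l := 2) (by simp),
    length_flatMap_finRange _ (l := n) (by simp)]
  simp

theorem sq_le_bound : (n + k + 2) * (n + k + 2) ≤ I.toBase.bound := by
  have : (n + k + 2) ^ 2 ≤ (n + k + 2) ^ (selCount k c + 2) :=
    Nat.pow_le_pow_right (by omega) (by omega)
  simpa [toBase, sq] using this

theorem length_encode_le : I.encode.length ≤ I.toBase.bound := by
  refine le_trans ?_ I.sq_le_bound
  rw [length_encode]
  ring_nf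
  nlinarith

theorem read_toBase (i : ℕ) : I.toBase.read i = I.encode.getD i 0 := by
  unfold Base.read
  split_ifs with h
  · rfl
  · rw [List.getD_eq_default _ _ (by have := I.length_encode_le; omega)]

theorem numVert_toBase : I.toBase.numVert = n := by
  simp [Base.numVert, read_toBase, encode]

theorem numPairs_toBase : I.toBase.numPairs = k := by
  simp [Base.numPairs, read_toBase, encode]

theorem capacity_toBase : I.toBase.capacity = c := by
  simp [Base.capacity, read_toBase, encode]

theorem radix_toBase : I.toBase.radix = n + k + 2 := by
  simp [Base.radix, numVert_toBase, numPairs_toBase]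

theorem defect_toBase : I.toBase.defect = k - c := by
  simp [Base.defect, capacity_toBase, numPairs_toBase]

theorem numSel_toBase : I.toBase.numSel = selCount k c := by
  simp [Base.numSel, defect_toBase, numPairs_toBase, selCount]

theorem radix_le_bound : n + k + 2 ≤ I.toBase.bound :=
  le_trans (Nat.le_mul_of_pos_left _ (by omega)) I.sq_le_bound

theorem selCount_le : selCount k c ≤ k := by unfold selCount; omega

theorem source_toBase (i : Fin k) : I.toBase.source i = I.source i := by
  have h := getD_flatMap_finRange (fun i : Fin k => [(I.source i : ℕ), (I.target i : ℕ)])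
    (l := 2) (by simp) i (e := 0) (by omega)
  have hl := length_flatMap_finRange (fun i : Fin k => [(I.source i : ℕ), (I.target i : ℕ)])
    (l := 2) (by simp)
  have := i.isLt
  rw [Base.source, read_toBase, encode, List.append_assoc,
    List.getD_append_right _ _ _ _ (by simp), List.getD_append _ _ _ _ (by rw [hl]; simp; omega)]
  rw [show 3 + ((i : ℕ) + i) - [n, k, c].length = i * 2 + 0 by simp; omega, h]
  simp

theorem target_toBase (i : Fin k) : I.toBase.target i = I.target i := by
  have h := getD_flatMap_finRange (fun i : Fin k => [(I.source i : ℕ), (I.target i : ℕ)])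
    (l := 2) (by simp) i (e := 1) (by omega)
  have hl := length_flatMap_finRange (fun i : Fin k => [(I.source i : ℕ), (I.target i : ℕ)])
    (l := 2) (by simp)
  have := i.isLt
  rw [Base.target, read_toBase, encode, List.append_assoc,
    List.getD_append_right _ _ _ _ (by simp; omega),
    List.getD_append _ _ _ _ (by rw [hl]; simp; omega)]
  rw [show 4 + ((i : ℕ) + i) - [n, k, c].length = i * 2 + 1 by simp; omega, h]
  simp

theorem weight_toBase (u v : Fin n) : I.toBase.weight u v = I.graph.weight u v := by
  have h := getD_flatMap_finRange (fun u : Fin n => (List.finRange n).map fun v =>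
    I.graph.weight u v) (l := n) (by simp) u (e := v) v.isLt
  have hl := length_flatMap_finRange (fun i : Fin k => [(I.source i : ℕ), (I.target i : ℕ)])
    (l := 2) (by simp)
  have := u.isLt
  have hle := I.radix_le_bound
  rw [Base.weight, read_toBase, encode, Base.mul_eq (by omega), numVert_toBase, numPairs_toBase,
    List.getD_append_right _ _ _ _ (by rw [List.length_append, hl]; simp; omega),
    List.length_append, hl]
  rw [show 3 + (k + k) + ((u : ℕ) * n + v) - ([n, k, c].length + k * 2) = u * n + v by
    simp; omega, h]
  simp [List.getD_eq_getElem?_getD]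

theorem digit_toBase {s j : ℕ} (hs : s < I.toBase.bound) (hj : j < selCount k c) :
    I.toBase.digit s j = s / (n + k + 2) ^ j % (n + k + 2) := by
  have h1 := I.radix_le_bound
  have h2 : selCount k c ≤ k := selCount_le
  rw [Base.digit_eq (by rw [radix_toBase]; exact h1) hs.le (by omega), radix_toBase]

theorem exists_code (f : ℕ → ℕ) (hf : ∀ j < selCount k c, f j < n + k + 2) :
    ∃ p < I.toBase.bound, ∀ j < selCount k c, I.toBase.digit p j = f j := by
  obtain ⟨p, hp, h⟩ := exists_digits (selCount k c) f hf
  have hp' : p < I.toBase.bound :=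
    hp.trans_le (Nat.pow_le_pow_right (by omega) (by omega))
  exact ⟨p, hp', fun j hj => (I.digit_toBase hp' hj).trans (h j hj)⟩

theorem dist_toBase (D : ℕ → ℕ) (u v : Fin n) :
    I.toBase.dist D u v = D (u * (n + k + 2) + v) := by
  have := I.radix_le_bound
  have := u.isLt
  rw [Base.dist, Base.mul_eq (by omega), radix_toBase]

theorem index_lt (u v : Fin n) : (u : ℕ) * (n + k + 2) + v < I.toBase.bound := by
  refine lt_of_lt_of_le ?_ I.sq_le_bound
  have hu := u.isLt
  have hv := v.isLt
  have : ((u : ℕ) + 1) * (n + k + 2) ≤ (n + k + 2) * (n + k + 2) :=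
    Nat.mul_le_mul_right _ (by omega)
  rw [add_mul] at this
  omega

theorem div_index (u v : Fin n) :
    I.toBase.div ((u : ℕ) * (n + k + 2) + v) I.toBase.radix = u := by
  rw [Base.div_eq Base.radix_pos (I.index_lt u v).le, radix_toBase, mul_comm,
    Nat.mul_add_div (by omega), Nat.div_eq_of_lt (by omega)]
  rfl

theorem mod_index (u v : Fin n) :
    I.toBase.mod ((u : ℕ) * (n + k + 2) + v) I.toBase.radix = v := by
  rw [Base.mod_eq Base.radix_pos (I.index_lt u v).le, radix_toBase, mul_comm,
    Nat.mul_add_mod, Nat.mod_eq_of_lt (by omega)]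

end Instance

end DSP

namespace DSP

open WeightedDigraph

theorem Store.fill_arr_self {s : Store} {a B : ℕ} {f : ℕ → ℕ} {i : ℕ} (hi : i < B) :
    (s.fill a B f).arr a i = f i := by simp [Store.fill, hi]

theorem Store.fill_arr_ne {s : Store} {a a' B : ℕ} {f : ℕ → ℕ} (h : a' ≠ a) :
    (s.fill a B f).arr a' = s.arr a' := by simp [Store.fill, h]

theorem WeightedDigraph.length_le {V : Type} {G : WeightedDigraph V} {W : ℕ}
    (hW : ∀ u v, G.weight u v ≤ W) (p : List V) : G.length p ≤ p.length * W := by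
  induction p with
  | nil => simp [WeightedDigraph.length]
  | cons u p ih =>
    cases p with
    | nil => simp [WeightedDigraph.length]
    | cons v p =>
      have := hW u v
      simp only [WeightedDigraph.length, List.length_cons] at ih ⊢
      rw [add_mul (p.length + 1) 1 W]
      omega

namespace Instance

variable {n k c : ℕ} (I : Instance n k c)

/-! ### The distance table -/

theorem relax_toBase (D : ℕ → ℕ) (u v : Fin n) :
    (∀ x, I.graph.Adj u x → I.toBase.relax D (u * (n + k + 2) + v) ≤
      I.graph.weight u x + I.toBase.dist D x v) ∧
    I.toBase.relax D (u * (n + k + 2) + v) ≤ I.toBase.dist D u v ∧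
    (I.toBase.relax D (u * (n + k + 2) + v) = I.toBase.dist D u v ∨
      ∃ x, I.graph.Adj u x ∧ I.toBase.relax D (u * (n + k + 2) + v) =
        I.graph.weight u x + I.toBase.dist D x v) := by
  have hB := I.radix_le_bound
  suffices H : (∀ x : Fin n, (x : ℕ) < I.toBase.bound → I.graph.Adj u x →
      I.toBase.relax D (u * (n + k + 2) + v) ≤ I.graph.weight u x + I.toBase.dist D x v) ∧
      I.toBase.relax D (u * (n + k + 2) + v) ≤ I.toBase.dist D u v ∧
      (I.toBase.relax D (u * (n + k + 2) + v) = I.toBase.dist D u v ∨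
        ∃ x, I.graph.Adj u x ∧ I.toBase.relax D (u * (n + k + 2) + v) =
          I.graph.weight u x + I.toBase.dist D x v) from
    ⟨fun x => H.1 x (by omega), H.2⟩
  unfold Base.relax
  rw [div_index, mod_index, ← I.dist_toBase D u v]
  refine iter_induction (Inv := fun y a => (∀ x : Fin n, (x : ℕ) < y → I.graph.Adj u x →
      a ≤ I.graph.weight u x + I.toBase.dist D x v) ∧ a ≤ I.toBase.dist D u v ∧
      (a = I.toBase.dist D u v ∨ ∃ x, I.graph.Adj u x ∧
        a = I.graph.weight u x + I.toBase.dist D x v)) ⟨by simp, le_rfl, Or.inl rfl⟩ ?_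
  intro y _ a ⟨h1, h2, h3⟩
  rw [numVert_toBase]
  split_ifs with hy
  · obtain ⟨⟨hyn, hw⟩, hlt⟩ := hy
    lift y to Fin n using hyn
    rw [weight_toBase] at hw hlt ⊢
    refine ⟨fun x hx ha => ?_, hlt.le.trans h2, Or.inr ⟨y, (I.graph.weight_pos_iff u y).1 hw, rfl⟩⟩
    rcases Nat.lt_succ_iff_lt_or_eq.1 hx with hx | hx
    · exact hlt.le.trans (h1 x hx ha)
    · rw [Fin.ext hx]
  · refine ⟨fun x hx ha => ?_, h2, h3⟩
    rcases Nat.lt_succ_iff_lt_or_eq.1 hx with hx | hx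
    · exact h1 x hx ha
    · subst hx
      rw [weight_toBase] at hy
      have := (I.graph.weight_pos_iff u x).2 ha
      by_contra hlt
      exact hy ⟨⟨x.isLt, this⟩, by omega⟩

/-- The path has at most `n ≤ bound` vertices, and every weight is an input cell, hence at most the
sum of all of them. -/
theorem length_lt_infinity {ρ : Fin n → ℕ} (hρ : I.graph.IsRank ρ) {p : List (Fin n)}
    (hp : p.IsChain I.graph.Adj) : I.graph.length p < I.toBase.infinity := by
  have hB := I.radix_le_bound
  have h1 : p.length ≤ n := by simpa using (hρ.nodup hp).length_le_card
  have h2 := length_le (G := I.graph)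
    (W := ∑ j ∈ Finset.range I.toBase.bound, I.toBase.read j) (fun u v => by
      rw [← weight_toBase]
      unfold Base.weight
      by_cases h : 3 + (I.toBase.numPairs + I.toBase.numPairs) +
          (I.toBase.mul u I.toBase.numVert + v) < I.toBase.bound
      · exact Finset.single_le_sum (f := fun j => I.toBase.read j) (fun i _ => Nat.zero_le _)
          (Finset.mem_range.2 h)
      · rw [Base.read, if_neg (by omega)]
        exact Nat.zero_le _) p
  have h3 : p.length * (∑ j ∈ Finset.range I.toBase.bound, I.toBase.read j) ≤
      I.toBase.bound * ∑ j ∈ Finset.range I.toBase.bound, I.toBase.read j :=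
    Nat.mul_le_mul_right _ (by omega)
  unfold Base.infinity
  rw [Finset.sum_const, Finset.card_range, smul_eq_mul]
  omega

/-- After `r` rounds an entry is at most the length of every path with at most `r + 1` vertices,
while an entry below infinity is always the length of some path. The bound is at least `n`, so all
paths are covered at the end. -/
theorem distances_spec {ρ : Fin n → ℕ} (hρ : I.graph.IsRank ρ) (s : Store) :
    I.graph.IsDist (fun u v => I.toBase.dist ((I.toBase.distances s).arr 0) u v)
      I.toBase.infinity ∧
    (∀ a, a ≠ 0 → (I.toBase.distances s).arr a = s.arr a) ∧
    (I.toBase.distances s).out = s.out := by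
  have hB := I.radix_le_bound
  have main : (∀ u v : Fin n, (I.toBase.dist ((I.toBase.distances s).arr 0) u v <
        I.toBase.infinity → ∃ p, I.graph.IsPath u v p ∧
          I.graph.length p = I.toBase.dist ((I.toBase.distances s).arr 0) u v) ∧
      ∀ p, I.graph.IsPath u v p → p.length ≤ I.toBase.bound + 1 →
        I.toBase.dist ((I.toBase.distances s).arr 0) u v ≤ I.graph.length p) ∧
      (∀ a, a ≠ 0 → (I.toBase.distances s).arr a = s.arr a) ∧
      (I.toBase.distances s).out = s.out := by
    unfold Base.distances
    refine iter_induction (Inv := fun r (s' : Store) => (∀ u v : Fin n, (I.toBase.dist (s'.arr 0) u v <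
        I.toBase.infinity → ∃ p, I.graph.IsPath u v p ∧
          I.graph.length p = I.toBase.dist (s'.arr 0) u v) ∧
      ∀ p, I.graph.IsPath u v p → p.length ≤ r + 1 →
        I.toBase.dist (s'.arr 0) u v ≤ I.graph.length p) ∧
      (∀ a, a ≠ 0 → s'.arr a = s.arr a) ∧ s'.out = s.out) ?_ ?_
    · refine ⟨fun u v => ?_, fun a ha => Store.fill_arr_ne ha, rfl⟩
      rw [dist_toBase, Store.fill_arr_self (I.index_lt u v), Base.distInit, div_index, mod_index]
      split_ifs with huv
      · have huv := Fin.ext huv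
        subst huv
        exact ⟨fun _ => ⟨[u], isPath_singleton u, rfl⟩, fun p _ _ => Nat.zero_le _⟩
      · refine ⟨fun h => absurd h (lt_irrefl _), fun p hp hl => ?_⟩
        obtain ⟨q, rfl⟩ := hp.exists_cons
        have : q = [] := List.length_eq_zero_iff.1 (by simpa using hl)
        subst this
        have := hp.last
        simp only [List.getLast?_singleton, Option.some.injEq] at this
        exact absurd (congrArg Fin.val this) huv
    · rintro r - s' ⟨h1, h2, h3⟩
      refine ⟨fun u v => ?_, fun a ha => (Store.fill_arr_ne ha).trans (h2 a ha), h3⟩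
      obtain ⟨r1, r2, r3⟩ := I.relax_toBase (s'.arr 0) u v
      rw [dist_toBase, Store.fill_arr_self (I.index_lt u v)]
      refine ⟨fun h => ?_, fun p hp hl => ?_⟩
      · rcases r3 with r3 | ⟨x, hx, r3⟩
        · rw [r3] at h ⊢
          exact (h1 u v).1 h
        · rw [r3] at h ⊢
          obtain ⟨p, hp, hpl⟩ := (h1 x v).1 (by omega)
          obtain ⟨q, rfl⟩ := hp.exists_cons
          have hc : (u :: x :: q).IsChain I.graph.Adj := List.isChain_cons_cons.2 ⟨hx, hp.chain⟩
          exact ⟨u :: x :: q, ⟨hc, hρ.nodup hc, rfl, by simpa using hp.last⟩, by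
            simp [WeightedDigraph.length, hpl]⟩
      · obtain ⟨q, rfl⟩ := hp.exists_cons
        cases q with
        | nil => exact r2.trans ((h1 u v).2 _ hp (by simp))
        | cons x q =>
          obtain ⟨hx, hc⟩ := List.isChain_cons_cons.1 hp.chain
          refine (r1 x hx).trans (Nat.add_le_add_left ((h1 x v).2 (x :: q)
            ⟨hc, hρ.nodup hc, rfl, by simpa using hp.last⟩ (by simpa using hl)) _)
  refine ⟨⟨fun u v h => (main.1 u v).1 h, fun u v p hp => (main.1 u v).2 p hp ?_,
    fun u v p hp => I.length_lt_infinity hρ hp.chain⟩, main.2⟩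
  have := hp.nodup.length_le_card
  simp only [Fintype.card_fin] at this
  omega

/-! ### The table of marked states -/

/-- The state `p` leads to the final state in fewer than `r` moves. -/
def _root_.DSP.Base.Marked (b : Base) (D : ℕ → ℕ) (z : ℕ) : ℕ → ℕ → Prop
  | 0, _ => False
  | r + 1, p => b.Marked D z r p ∨ (b.Light p ∧
      (b.Final z p ∨ ∃ q < b.bound, b.Marked D z r q ∧ b.Move D z p q))

theorem _root_.DSP.Base.Marked.mono {b : Base} {D : ℕ → ℕ} {z r r' p : ℕ}
    (h : b.Marked D z r p) (hr : r ≤ r') : b.Marked D z r' p := by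
  induction hr with
  | refl => exact h
  | step _ ih => exact Or.inl ih

/-- Beyond deciding `Marked`, the marks guide the extraction of a course: a marked state is final or
has a move to a state with a smaller nonzero mark. The invariant survives since old marks persist
and new ones exceed them. -/
theorem _root_.DSP.Base.table_spec (b : Base) (s : Store) (z : ℕ) :
    (∀ p < b.bound, ((b.table s z).arr 1 p ≠ 0 ↔ b.Marked (s.arr 0) z b.bound p) ∧
      (b.table s z).arr 1 p ≤ b.bound ∧ ((b.table s z).arr 1 p ≠ 0 → b.Light p ∧
        (b.Final z p ∨ ∃ q < b.bound, ((b.table s z).arr 1 q ≠ 0 ∧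
          (b.table s z).arr 1 q < (b.table s z).arr 1 p) ∧ b.Move (s.arr 0) z p q))) ∧
    (∀ a, a ≠ 1 → (b.table s z).arr a = s.arr a) ∧ (b.table s z).out = s.out := by
  unfold Base.table
  refine iter_induction (Inv := fun r (s' : Store) => (∀ p < b.bound, (s'.arr 1 p ≠ 0 ↔
      b.Marked (s.arr 0) z r p) ∧ s'.arr 1 p ≤ r ∧ (s'.arr 1 p ≠ 0 → b.Light p ∧
        (b.Final z p ∨ ∃ q < b.bound, (s'.arr 1 q ≠ 0 ∧ s'.arr 1 q < s'.arr 1 p) ∧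
          b.Move (s.arr 0) z p q))) ∧
    (∀ a, a ≠ 1 → s'.arr a = s.arr a) ∧ s'.out = s.out) ?_ ?_
  · refine ⟨fun p hp => ?_, fun a ha => Store.fill_arr_ne ha, rfl⟩
    rw [Store.fill_arr_self hp]
    simp [Base.Marked]
  · rintro r - s' ⟨h1, h2, h3⟩
    refine ⟨fun p hp => ?_, fun a ha => (Store.fill_arr_ne ha).trans (h2 a ha), h3⟩
    have hD := h2 0 (by omega)
    have hold : ∀ q < b.bound, s'.arr 1 q ≠ 0 →
        (s'.fill 1 b.bound (b.mark (s'.arr 0) (s'.arr 1) z r)).arr 1 q = s'.arr 1 q :=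
      fun q hq hq' => by rw [Store.fill_arr_self hq, Base.mark, if_pos hq']
    by_cases hp0 : s'.arr 1 p ≠ 0
    · obtain ⟨a1, a2, a3⟩ := h1 p hp
      rw [hold p hp hp0]
      refine ⟨⟨fun h => Or.inl (a1.1 h), fun _ => hp0⟩, by omega, fun h => ?_⟩
      obtain ⟨b1, b2⟩ := a3 h
      refine ⟨b1, b2.imp_right ?_⟩
      rintro ⟨q, hq, hq', hmv⟩
      exact ⟨q, hq, by rwa [hold q hq hq'.1], hmv⟩
    · have hnm : ¬ b.Marked (s.arr 0) z r p := fun h => hp0 ((h1 p hp).1.2 h)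
      have hiff : (b.Light p ∧ (b.Final z p ∨ ∃ q < b.bound, s'.arr 1 q ≠ 0 ∧
          b.Move (s'.arr 0) z p q)) ↔ b.Marked (s.arr 0) z (r + 1) p := by
        simp only [Base.Marked, hnm, false_or, hD]
        refine and_congr_right fun _ => or_congr_right ⟨?_, ?_⟩
        · rintro ⟨q, hq, hq', hmv⟩
          exact ⟨q, hq, (h1 q hq).1.1 hq', hmv⟩
        · rintro ⟨q, hq, hq', hmv⟩
          exact ⟨q, hq, (h1 q hq).1.2 hq', hmv⟩
      rw [Store.fill_arr_self hp, Base.mark, if_neg hp0]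
      split_ifs with hc
      · refine ⟨⟨fun _ => hiff.1 hc, fun _ => by omega⟩, le_rfl, fun _ => ⟨hc.1, hc.2.imp_right ?_⟩⟩
        rintro ⟨q, hq, hq', hmv⟩
        have := (h1 q hq).2.1
        exact ⟨q, hq, by rw [hold q hq hq']; exact ⟨hq', by omega⟩, hD ▸ hmv⟩
      · refine ⟨⟨fun h => absurd rfl h, fun h => absurd (hiff.2 h) hc⟩, Nat.zero_le _,
          fun h => absurd rfl h⟩

/-! ### States and positions of pebbles -/

/-- The digits of `p` are the positions `a`. -/
def Codes (p : ℕ) (a : Fin (selCount k c) → Fin n) : Prop :=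
  ∀ j : Fin (selCount k c), I.toBase.digit p j = a j

theorem exists_codes (a : Fin (selCount k c) → Fin n) : ∃ p < I.toBase.bound, I.Codes p a := by
  obtain ⟨p, hp, h⟩ := I.exists_code (fun j => if h : j < selCount k c then a ⟨j, h⟩ else 0)
    (fun j hj => by rw [dif_pos hj]; omega)
  exact ⟨p, hp, fun j => by rw [h j j.isLt, dif_pos j.isLt]⟩

theorem forall_sel {q : ℕ → Prop} :
    (∀ j < I.toBase.bound, j < I.toBase.numSel → q j) ↔ ∀ j : Fin (selCount k c), q j := by
  rw [numSel_toBase]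
  have h1 := I.radix_le_bound
  have h2 : selCount k c ≤ k := selCount_le
  exact ⟨fun h j => h j (by omega) j.isLt, fun h j _ hj => h ⟨j, hj⟩⟩

theorem tight_toBase {D : ℕ → ℕ} {t u v : Fin n} :
    I.toBase.Tight D t u v ↔ I.graph.Tight (fun u v => I.toBase.dist D u v) t u v := by
  unfold Base.Tight Tight
  rw [weight_toBase, numVert_toBase, I.graph.weight_pos_iff]
  simp

variable {I}

theorem Codes.light_iff {p : ℕ} {a : Fin (selCount k c) → Fin n} (h : I.Codes p a) :
    I.toBase.Light p ↔ IsLight (selCount k c - (k - c)) a := by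
  have h1 := I.radix_le_bound
  have h2 : selCount k c ≤ k := selCount_le
  unfold Base.Light IsLight
  rw [forall_sel]
  refine forall_congr' fun j => ?_
  rw [numSel_toBase, defect_toBase, ← Finset.card_filter]
  have : ((Finset.range I.toBase.bound).filter fun l => l < selCount k c ∧
      I.toBase.digit p l = I.toBase.digit p j) =
      (Finset.univ.filter fun l => a l = a j).map Fin.valEmbedding := by
    ext l
    simp only [Finset.mem_filter, Finset.mem_range, Finset.mem_map, Finset.mem_univ, true_and,
      Fin.valEmbedding_apply]
    constructor
    · rintro ⟨_, hl, hlj⟩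
      refine ⟨⟨l, hl⟩, ?_, rfl⟩
      have := h ⟨l, hl⟩
      simp only at this
      rw [this, h j] at hlj
      exact Fin.ext hlj
    · rintro ⟨l, hl, rfl⟩
      exact ⟨by omega, l.isLt, by rw [h l, h j, hl]⟩
  rw [this, Finset.card_map]

theorem Codes.final_iff {p z : ℕ} {a : Fin (selCount k c) → Fin n} (h : I.Codes p a)
    {sel : Fin (selCount k c) → Fin k} (hz : ∀ j : Fin (selCount k c), I.toBase.digit z j = sel j) :
    I.toBase.Final z p ↔ a = fun j => I.target (sel j) := by
  unfold Base.Final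
  rw [forall_sel, funext_iff]
  refine forall_congr' fun j => ?_
  rw [h j, hz j, target_toBase, Fin.ext_iff]

theorem start_iff {p z : ℕ} {sel : Fin (selCount k c) → Fin k}
    (hz : ∀ j : Fin (selCount k c), I.toBase.digit z j = sel j) :
    I.toBase.Start z p ↔ I.Codes p fun j => I.source (sel j) := by
  unfold Base.Start
  rw [forall_sel]
  refine forall_congr' fun j => ?_
  rw [hz j, source_toBase]

/-- A digit of `q` need not be a vertex, as the radix exceeds `n`. It is one after a legal move,
being either copied from `p` or tested by `Tight`. -/
theorem Codes.move_iff {p q z : ℕ} {D : ℕ → ℕ} {a : Fin (selCount k c) → Fin n} (h : I.Codes p a)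
    {sel : Fin (selCount k c) → Fin k} (hz : ∀ j : Fin (selCount k c), I.toBase.digit z j = sel j) :
    I.toBase.Move D z p q ↔ ∃ b, I.Codes q b ∧
      I.graph.PebbleMove (fun u v => I.toBase.dist D u v) (fun j => I.target (sel j)) a b := by
  have key : ∀ j, (∀ l < I.toBase.bound, l < I.toBase.numSel →
      I.toBase.digit p l ≠ I.toBase.digit p j →
      I.toBase.dist D (I.toBase.digit p l) (I.toBase.digit p j) +
        I.toBase.dist D (I.toBase.digit p j) (I.toBase.target (I.toBase.digit z l)) ≠
          I.toBase.dist D (I.toBase.digit p l) (I.toBase.target (I.toBase.digit z l))) ↔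
      ∀ l, I.toBase.digit p (l : Fin (selCount k c)) ≠ I.toBase.digit p j →
      I.toBase.dist D (I.toBase.digit p l) (I.toBase.digit p j) +
        I.toBase.dist D (I.toBase.digit p j) (I.toBase.target (I.toBase.digit z l)) ≠
          I.toBase.dist D (I.toBase.digit p l) (I.toBase.target (I.toBase.digit z l)) :=
    fun j => I.forall_sel
  unfold Base.Move PebbleMove
  simp only [key]
  rw [forall_sel]
  constructor
  · intro hm
    have hlt : ∀ j : Fin (selCount k c), I.toBase.digit q j < n := fun j => by
      rcases hm j with hj | hj
      · rw [hj, h j]; omega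
      · simpa [numVert_toBase] using hj.1.1.1
    refine ⟨fun j => ⟨_, hlt j⟩, fun j => rfl, fun j => ?_⟩
    refine (hm j).imp (fun hj => Fin.ext (hj.trans (h j))) fun hj => ⟨?_, fun l hl => ?_⟩
    · have := hj.1
      rw [h j, hz j, target_toBase] at this
      exact (I.tight_toBase (v := ⟨_, hlt j⟩)).1 this
    · have := hj.2 l
      rw [h l, h j, hz l, target_toBase] at this
      exact this fun he => hl (Fin.ext he)
  · rintro ⟨b, hb, hm⟩ j
    refine (hm j).imp (fun hj => by rw [hb j, h j, hj]) fun hj => ⟨?_, fun l hl => ?_⟩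
    · rw [h j, hz j, target_toBase, hb j]
      exact I.tight_toBase.2 hj.1
    · rw [h l, h j] at hl
      rw [h l, h j, hz l, target_toBase]
      exact hj.2 l fun he => hl (congrArg Fin.val he)

end Instance

end DSP

/-! ### Correctness of the search and of the extracted paths -/

namespace DSP

open WeightedDigraph

/-- The selection `z` admits a family of paths. -/
def Base.Winning (b : Base) (D : ℕ → ℕ) (z : ℕ) : Prop :=
  ∃ p < b.bound, b.Marked D z b.bound p ∧ b.Start z p

theorem Base.wins_table_iff (b : Base) (s : Store) (z : ℕ) :
    b.Wins ((b.table s z).arr 1) z ↔ b.Winning (s.arr 0) z := by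
  unfold Base.Wins Base.Winning
  refine exists_congr fun p => and_congr_right fun hp => ?_
  rw [((b.table_spec s z).1 p hp).1]

/-- Once a winning selection is recorded, the guard blocks all later rounds, so the record persists.
-/
theorem Base.search_spec (b : Base) (s : Store) (hs : s.arr 2 0 = 0) :
    (b.search s).arr 0 = s.arr 0 ∧ (b.search s).out = s.out ∧
    (((b.search s).arr 2 0 = 0 ∧ ∀ z < b.bound, b.Valid z → ¬ b.Winning (s.arr 0) z) ∨
      ∃ z < b.bound, (b.search s).arr 2 0 = z + 1 ∧ b.Valid z ∧ b.Winning (s.arr 0) z) := by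
  unfold Base.search
  refine iter_induction (Inv := fun i (s' : Store) => s'.arr 0 = s.arr 0 ∧ s'.out = s.out ∧
    ((s'.arr 2 0 = 0 ∧ ∀ z < i, b.Valid z → ¬ b.Winning (s.arr 0) z) ∨
      ∃ z < b.bound, s'.arr 2 0 = z + 1 ∧ b.Valid z ∧ b.Winning (s.arr 0) z))
    ⟨rfl, rfl, Or.inl ⟨hs, by simp⟩⟩ ?_
  rintro z hz s' ⟨h1, h2, h3⟩
  split_ifs with hc
  · obtain ⟨-, t1, t2⟩ := b.table_spec s' z
    have hw := b.wins_table_iff s' z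
    rw [h1] at hw
    unfold Base.test
    split_ifs with hwin
    · refine ⟨?_, t2.trans h2, Or.inr ⟨z, hz, ?_, hc.2, hw.1 hwin⟩⟩
      · simp [Store.set, t1, h1]
      · simp [Store.set]
    · refine ⟨(t1 0 (by omega)).trans h1, t2.trans h2, ?_⟩
      rw [t1 2 (by omega)]
      refine h3.imp_left ?_
      rintro ⟨h4, h5⟩
      refine ⟨h4, fun z' hz' hv => ?_⟩
      rcases Nat.lt_succ_iff_lt_or_eq.1 hz' with hz' | rfl
      · exact h5 z' hz' hv
      · exact fun h => hwin (hw.2 h)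
  · refine ⟨h1, h2, h3.imp_left ?_⟩
    rintro ⟨h4, h5⟩
    refine ⟨h4, fun z' hz' hv => ?_⟩
    rcases Nat.lt_succ_iff_lt_or_eq.1 hz' with hz' | rfl
    · exact h5 z' hz' hv
    · exact absurd ⟨h4, hv⟩ hc

namespace Instance

variable {n k c : ℕ} {I : Instance n k c}

theorem exists_sel_of_valid {z : ℕ} (hz : I.toBase.Valid z) :
    ∃ sel : Fin (selCount k c) → Fin k, Function.Injective sel ∧
      ∀ j : Fin (selCount k c), I.toBase.digit z j = sel j := by
  unfold Base.Valid at hz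
  rw [forall_sel, numPairs_toBase] at hz
  refine ⟨fun j => ⟨_, (hz j).1⟩, fun i j hij => ?_, fun j => rfl⟩
  have hB := I.radix_le_bound
  have hm : selCount k c ≤ k := selCount_le
  simp only [Fin.mk.injEq] at hij
  rcases lt_trichotomy (i : ℕ) j with h | h | h
  · exact absurd hij ((hz j).2 i (by omega) h)
  · exact Fin.ext h
  · exact absurd hij.symm ((hz i).2 j (by omega) h)

theorem valid_of_sel {z : ℕ} {sel : Fin (selCount k c) → Fin k} (hs : Function.Injective sel)
    (hz : ∀ j : Fin (selCount k c), I.toBase.digit z j = sel j) : I.toBase.Valid z := by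
  unfold Base.Valid
  rw [forall_sel, numPairs_toBase]
  refine fun j => ⟨by rw [hz j]; exact (sel j).isLt, fun l _ hl he => ?_⟩
  have h1 := hz ⟨l, hl.trans j.isLt⟩
  simp only at h1
  rw [h1, hz j] at he
  have := congrArg Fin.val (hs (Fin.ext he))
  simp only at this
  omega

theorem Codes.unique {p : ℕ} {a b : Fin (selCount k c) → Fin n} (ha : I.Codes p a)
    (hb : I.Codes p b) : a = b :=
  funext fun j => Fin.ext ((ha j).symm.trans (hb j))

/-- The states on the way to the final state form a course of the pebble game. -/
theorem walk_spec {D T : ℕ → ℕ} {z : ℕ} (hw : I.toBase.Wins T z)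
    (hT : ∀ p < I.toBase.bound, T p ≤ I.toBase.bound ∧ (T p ≠ 0 → I.toBase.Light p ∧
      (I.toBase.Final z p ∨ ∃ q < I.toBase.bound, (T q ≠ 0 ∧ T q < T p) ∧ I.toBase.Move D z p q)))
    {sel : Fin (selCount k c) → Fin k}
    (hz : ∀ j : Fin (selCount k c), I.toBase.digit z j = sel j) :
    ∃ a : ℕ → Fin (selCount k c) → Fin n,
      (∀ r ≤ I.toBase.bound, I.Codes (I.toBase.walk D T z r) (a r)) ∧
      (a 0 = fun j => I.source (sel j)) ∧ (a I.toBase.bound = fun j => I.target (sel j)) ∧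
      (∀ r, I.graph.PebbleMove (fun u v => I.toBase.dist D u v) (fun j => I.target (sel j))
        (a r) (a (r + 1))) ∧ ∀ r, IsLight (selCount k c - (k - c)) (a r) := by
  set b := I.toBase with hb
  set step : ℕ → ℕ := fun p =>
    pick b.bound (fun q => (T q ≠ 0 ∧ T q < T p) ∧ b.Move D z p q) p with hstep
  set p₀ := pick b.bound (fun p => T p ≠ 0 ∧ b.Start z p) 0 with hp₀
  have hwalk : ∀ r ≤ b.bound, b.walk D T z r = step^[r] p₀ := fun r hr => by
    unfold Base.walk
    rw [iter_ite_lt b.bound p₀ step r, min_eq_left hr]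
  have h0 : p₀ < b.bound ∧ T p₀ ≠ 0 ∧ b.Start z p₀ := by
    refine (pick_spec b.bound (fun p => T p ≠ 0 ∧ b.Start z p) 0).resolve_right fun h => ?_
    obtain ⟨p, hp, hp'⟩ := hw
    exact h.2 p hp hp'
  have hcode : ∀ r, (step^[r] p₀ < b.bound ∧ T (step^[r] p₀) ≠ 0) ∧
      ∃ a, I.Codes (step^[r] p₀) a := by
    intro r
    induction r with
    | zero => exact ⟨⟨h0.1, h0.2.1⟩, _, (start_iff hz).1 h0.2.2⟩
    | succ r ih =>
      rw [Function.iterate_succ_apply']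
      obtain ⟨ih1, a, ha⟩ := ih
      rcases pick_spec b.bound (fun q => (T q ≠ 0 ∧ T q < T (step^[r] p₀)) ∧
        b.Move D z (step^[r] p₀) q) (step^[r] p₀) with h | h
      · obtain ⟨a', ha', -⟩ := (ha.move_iff hz).1 h.2.2
        exact ⟨⟨h.1, h.2.1.1⟩, a', ha'⟩
      · have : step (step^[r] p₀) = step^[r] p₀ := h.1
        rw [this]
        exact ⟨ih1, a, ha⟩
  choose hcode a ha using hcode
  -- Each step lowers the mark unless the walk is stuck. Marks are nonzero and at most the bound, so
  -- the walk is stuck after `bound` steps; a marked state that is stuck is final.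
  have hend : ∀ r, T (step^[r] p₀) + r ≤ b.bound ∨ ∀ q < b.bound,
      ¬ ((T q ≠ 0 ∧ T q < T (step^[r] p₀)) ∧ b.Move D z (step^[r] p₀) q) := by
    intro r
    induction r with
    | zero => exact Or.inl (hT _ h0.1).1
    | succ r ih =>
      rw [Function.iterate_succ_apply']
      rcases pick_spec b.bound (fun q => (T q ≠ 0 ∧ T q < T (step^[r] p₀)) ∧
        b.Move D z (step^[r] p₀) q) (step^[r] p₀) with h | h
      · refine ih.elim (fun ih => Or.inl ?_) fun ih => absurd h.2 (ih _ h.1)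
        have h1 : T (step (step^[r] p₀)) < T (step^[r] p₀) := h.2.1.2
        omega
      · have : step (step^[r] p₀) = step^[r] p₀ := h.1
        rw [this]
        exact Or.inr h.2
  refine ⟨a, fun r hr => hwalk r hr ▸ ha r, (ha 0).unique ((start_iff hz).1 h0.2.2), ?_,
    fun r => ?_, fun r => (ha r).light_iff.1 ((hT _ (hcode r).1).2 (hcode r).2).1⟩
  · have h1 := (hcode b.bound).2
    have h2 := (hend b.bound).resolve_left (by omega)
    have h3 := ((hT _ (hcode b.bound).1).2 h1).2
    refine ((ha b.bound).final_iff hz).1 (h3.resolve_right ?_)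
    rintro ⟨q, hq, hq'⟩
    exact h2 q hq hq'
  · have hr := ha (r + 1)
    rw [Function.iterate_succ_apply'] at hr
    rcases pick_spec b.bound (fun q => (T q ≠ 0 ∧ T q < T (step^[r] p₀)) ∧
      b.Move D z (step^[r] p₀) q) (step^[r] p₀) with h | h
    · obtain ⟨a', ha', hmv⟩ := ((ha r).move_iff hz).1 h.2.2
      rwa [hr.unique ha']
    · have : step (step^[r] p₀) = step^[r] p₀ := h.1
      rw [this] at hr
      rw [hr.unique (ha r)]
      exact fun j => Or.inl rfl

/-- Every tight step raises the rank, and ranks stay below the bound, so the walk comes to rest in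
time. It can rest only at `t`, because a tight edge leaves every other vertex with finite distance
to `t`. -/
theorem follow_spec {ρ : Fin n → ℕ} (hρ : I.graph.IsRank ρ) (hρn : ∀ v, ρ v < n * n + n)
    {D : ℕ → ℕ} {M : ℕ} (hD : I.graph.IsDist (fun u v => I.toBase.dist D u v) M) {s t : Fin n}
    (hst : I.toBase.dist D s t < M) :
    ∃ a : ℕ → Fin n, (∀ r ≤ I.toBase.bound, I.toBase.follow D t s r = a r) ∧ a 0 = s ∧
      a I.toBase.bound = t ∧ ∀ r, a (r + 1) = a r ∨
        I.graph.Tight (fun u v => I.toBase.dist D u v) t (a r) (a (r + 1)) := by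
  set b := I.toBase with hb
  set step : ℕ → ℕ := fun u => pick b.bound (fun v => b.Tight D t u v) u with hstep
  have hB : _ ≤ b.bound := I.sq_le_bound
  have hB' : _ ≤ b.bound := I.radix_le_bound
  have hcode : ∀ r, ∃ a : Fin n, step^[r] s = a ∧ b.dist D a t < M := by
    intro r
    induction r with
    | zero => exact ⟨s, rfl, hst⟩
    | succ r ih =>
      obtain ⟨a, ha, hal⟩ := ih
      rw [Function.iterate_succ_apply', ha]
      rcases pick_spec b.bound (fun v => b.Tight D t a v) a with h | h
      · have hlt : step a < n := by
          have := h.2.1.1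
          rwa [hb, numVert_toBase] at this
        refine ⟨⟨step a, hlt⟩, rfl, ?_⟩
        have h1 : b.weight a (step a) + b.dist D (step a) t = b.dist D a t := h.2.2
        simp only
        omega
      · exact ⟨a, h.1, hal⟩
  choose a ha hal using hcode
  have hstep' : ∀ r, I.graph.Tight (fun u v => b.dist D u v) t (a r) (a (r + 1)) ∨
      (a (r + 1) = a r ∧ ∀ v, ¬ I.graph.Tight (fun u v => b.dist D u v) t (a r) v) := by
    intro r
    have hr := ha (r + 1)
    rw [Function.iterate_succ_apply', ha r] at hr
    rcases pick_spec b.bound (fun v => b.Tight D t (a r) v) (a r) with h | h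
    · left
      have h2 : b.Tight D t (a r) (step (a r)) := h.2
      rw [hr] at h2
      exact I.tight_toBase.1 h2
    · refine Or.inr ⟨Fin.ext (hr.symm.trans h.1), fun v hv => h.2 v ?_ (I.tight_toBase.2 hv)⟩
      omega
  refine ⟨a, fun r hr => ?_, Fin.ext (ha 0).symm, ?_, fun r => (hstep' r).symm.imp_left And.left⟩
  · unfold Base.follow
    rw [iter_ite_lt b.bound (s : ℕ) step r, min_eq_left hr, ha r]
  · have hprog : ∀ r, r ≤ ρ (a r) ∨ a r = t := by
      intro r
      induction r with
      | zero => exact Or.inl (Nat.zero_le _)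
      | succ r ih =>
        rcases hstep' r with h | h
        · refine ih.elim (fun ih => Or.inl ?_) fun ih => ?_
          · have := hρ.lt _ _ h.1
            omega
          · have h0 : b.dist D t t = 0 := hD.self t
            have h1 : I.graph.weight (a r) (a (r + 1)) + b.dist D (a (r + 1)) t =
              b.dist D (a r) t := h.2
            rw [ih, h0] at h1
            have h2 := (I.graph.weight_pos_iff (a r) (a (r + 1))).2 h.1
            rw [ih] at h2
            omega
        · right
          by_contra hne
          rw [h.1] at hne
          obtain ⟨v, hv⟩ := hD.exists_tight hρ (hal r) hne
          exact h.2 v hv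
    refine (hprog b.bound).resolve_left fun h => ?_
    have h1 := hρn (a b.bound)
    nlinarith

/-- The positions computed by the algorithm trace a solution. -/
theorem position_spec {ρ : Fin n → ℕ} (hρ : I.graph.IsRank ρ) (hρn : ∀ v, ρ v < n * n + n)
    {D T : ℕ → ℕ} (hD : I.graph.IsDist (fun u v => I.toBase.dist D u v) I.toBase.infinity)
    (hf : I.toBase.Feasible D) {z : ℕ} (hv : I.toBase.Valid z) (hw : I.toBase.Wins T z)
    (hT : ∀ p < I.toBase.bound, T p ≤ I.toBase.bound ∧ (T p ≠ 0 → I.toBase.Light p ∧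
      (I.toBase.Final z p ∨
        ∃ q < I.toBase.bound, (T q ≠ 0 ∧ T q < T p) ∧ I.toBase.Move D z p q))) :
    ∃ a : Fin k → ℕ → Fin n,
      (∀ i : Fin k, ∀ r ≤ I.toBase.bound, I.toBase.position D T z i r = a i r) ∧
      I.IsSolution fun i => trace (a i) I.toBase.bound := by
  classical
  have hB := I.radix_le_bound
  have hm : selCount k c ≤ k := selCount_le
  have hdist : ∀ i : Fin k, I.toBase.dist D (I.source i) (I.target i) < I.toBase.infinity := by
    intro i
    have := hf i (by omega) (by rw [numPairs_toBase]; exact i.isLt)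
    rwa [source_toBase, target_toBase] at this
  obtain ⟨sel, hinj, hz⟩ := exists_sel_of_valid hv
  obtain ⟨a, ha1, ha2, ha3, ha4, ha5⟩ := walk_spec hw hT hz
  have hpos : ∀ i : Fin k, ∃ x : ℕ → Fin n,
      (∀ r ≤ I.toBase.bound, I.toBase.position D T z i r = x r) ∧ x 0 = I.source i ∧
      x I.toBase.bound = I.target i ∧ (∀ r, x (r + 1) = x r ∨
        I.graph.Tight (fun u v => I.toBase.dist D u v) (I.target i) (x r) (x (r + 1))) ∧
      ∀ j, sel j = i → ∀ r, x r = a r j := by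
    intro i
    have hslot := pick_spec I.toBase.bound
      (fun j => j < I.toBase.numSel ∧ I.toBase.digit z j = i) I.toBase.bound
    change (I.toBase.slot z i < _ ∧ I.toBase.slot z i < _ ∧
      I.toBase.digit z (I.toBase.slot z i) = i) ∨ (I.toBase.slot z i = _ ∧ _) at hslot
    unfold Base.position
    rcases hslot with ⟨-, h1, h2⟩ | ⟨h1, h2⟩
    · simp only [if_pos h1]
      rw [numSel_toBase] at h1
      set j : Fin (selCount k c) := ⟨_, h1⟩ with hj
      have hji : sel j = i := Fin.ext ((hz j).symm.trans h2)
      refine ⟨fun r => a r j, fun r hr => ha1 r hr j, ?_, ?_, fun r => ?_, fun l hl r => ?_⟩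
      · simp only [ha2, hji]
      · simp only [ha3, hji]
      · rw [← hji]
        exact (ha4 r).tight j
      · rw [hinj (hl.trans hji.symm)]
    · have h3 : ¬ I.toBase.slot z i < I.toBase.numSel := by
        rw [h1, numSel_toBase]; omega
      simp only [if_neg h3, source_toBase, target_toBase]
      obtain ⟨x, hx1, hx2, hx3, hx4⟩ := follow_spec hρ hρn hD (hdist i)
      refine ⟨x, hx1, hx2, hx3, hx4, fun j hj => ?_⟩
      refine absurd ⟨?_, ?_⟩ (h2 j (by omega))
      · rw [numSel_toBase]; exact j.isLt
      · rw [hz j, hj]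
  choose x hx1 hx2 hx3 hx4 hx5 using hpos
  refine ⟨x, hx1, fun i => ?_, fun v => ?_⟩
  · obtain ⟨h1, h2⟩ := isPath_trace hρ (fun r (_ : r < I.toBase.bound) => hx4 i r)
    rw [hx2, hx3] at h1 h2
    rw [hD.self, add_zero] at h2
    exact hD.isShortestPath_iff.2 ⟨h1, h2⟩
  · have hvis := card_visitors_le hD hρ (a := a) (L := I.toBase.bound) (fun r _ => ha4 r)
      (fun r _ => ha5 r) (fun j => by rw [ha2]; exact hdist (sel j)) v
    -- With `m = selCount k c`, at most `m - (k - c)` selected paths visit `v`. Even if all `k - m`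
    -- others do, the total is at most `k - (k - c) ≤ c`.
    have hsub : (Finset.univ.filter fun i => v ∈ trace (x i) I.toBase.bound) ⊆
        (Finset.univ.filter fun j => ∃ r ≤ I.toBase.bound, a r j = v).image sel ∪
          (Finset.univ \ Finset.univ.image sel) := by
      intro i hi
      simp only [Finset.mem_filter, Finset.mem_univ, true_and, mem_trace] at hi
      obtain ⟨r, hr, hrv⟩ := hi
      simp only [Finset.mem_union, Finset.mem_image, Finset.mem_filter, Finset.mem_univ, true_and,
        Finset.mem_sdiff]
      by_cases hs : ∃ j, sel j = i
      · obtain ⟨j, hj⟩ := hs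
        exact Or.inl ⟨j, ⟨r, hr, (hx5 i j hj r).symm.trans hrv⟩, hj⟩
      · exact Or.inr hs
    have h1 := Finset.card_le_card hsub
    have h2 := Finset.card_union_le ((Finset.univ.filter fun j =>
      ∃ r ≤ I.toBase.bound, a r j = v).image sel) (Finset.univ \ Finset.univ.image sel)
    have h3 : ((Finset.univ.filter fun j => ∃ r ≤ I.toBase.bound, a r j = v).image sel).card ≤ _ :=
      Finset.card_image_le
    have h4 : (Finset.univ.image sel).card = selCount k c := by
      rw [Finset.card_image_of_injective _ hinj, Finset.card_univ, Fintype.card_fin]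
    rw [Finset.card_sdiff_of_subset (Finset.subset_univ _), h4, Finset.card_univ,
      Fintype.card_fin] at h2
    simp only
    unfold selCount at *
    omega

/-- If there is a solution, then the algorithm finds a selection. -/
theorem exists_winning {ρ : Fin n → ℕ} (hρ : I.graph.IsRank ρ) {D : ℕ → ℕ}
    (hD : I.graph.IsDist (fun u v => I.toBase.dist D u v) I.toBase.infinity)
    {P : Fin k → List (Fin n)} (hP : I.IsSolution P) :
    I.toBase.Feasible D ∧ ∃ z < I.toBase.bound, I.toBase.Valid z ∧ I.toBase.Winning D z := by
  classical
  have hm : selCount k c ≤ k := selCount_le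
  constructor
  · intro i _ hi
    rw [numPairs_toBase] at hi
    lift i to Fin k using hi
    rw [source_toBase, target_toBase]
    exact hD.lt_of_isPath (hP.1 i).1
  obtain ⟨S, P', hS, hP', hav⟩ := hρ.exists_small_family (d := k - c) k Finset.univ P (by simp)
    (fun i _ => hP.1 i) (fun v => by
      have h1 := hP.2 v
      have h2 := Finset.card_filter_add_card_filter_not (s := Finset.univ) (fun i => v ∈ P i)
      rw [Finset.card_univ, Fintype.card_fin] at h2
      unfold avoid
      omega)
  have hS' : S.card = selCount k c := by rw [hS]; unfold selCount; omega
  have e := Finset.equivFinOfCardEq hS'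
  set sel : Fin (selCount k c) → Fin k := fun j => (e.symm j).1 with hsel
  have hinj : Function.Injective sel := Subtype.val_injective.comp e.symm.injective
  have hselS : ∀ j, sel j ∈ S := fun j => (e.symm j).2
  obtain ⟨z, hz, hzd⟩ := I.exists_code
    (fun j => if h : j < selCount k c then (sel ⟨j, h⟩ : ℕ) else 0)
    (fun j hj => by rw [dif_pos hj]; omega)
  have hz' : ∀ j : Fin (selCount k c), I.toBase.digit z j = sel j := fun j => by
    rw [hzd j j.isLt, dif_pos j.isLt]
  refine ⟨z, hz, valid_of_sel hinj hz', ?_⟩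
  obtain ⟨r, hr, hR⟩ := pebble_induction (J := Fin (selCount k c)) hD hρ
    (s := fun j => I.source (sel j)) (t := fun j => I.target (sel j))
    (c := selCount k c - (k - c)) (P := fun j => P' (sel j)) (fun j => hP' _ (hselS j))
    (fun v => by
      have h1 := hav v
      have h2 := Finset.card_filter_add_card_filter_not (s := (Finset.univ : Finset
        (Fin (selCount k c)))) (fun j => v ∈ P' (sel j))
      have h3 : avoid S P' v = (Finset.univ.filter fun j => v ∉ P' (sel j)).card := by
        unfold avoid
        rw [← Finset.card_image_of_injective _ hinj]
        congr 1
        ext i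
        simp only [Finset.mem_filter, Finset.mem_image, Finset.mem_univ, true_and]
        constructor
        · rintro ⟨hi, hiv⟩
          have : sel (e ⟨i, hi⟩) = i := by simp [hsel]
          exact ⟨e ⟨i, hi⟩, by rwa [this], this⟩
        · rintro ⟨j, hj, rfl⟩
          exact ⟨hselS j, hj⟩
      rw [Finset.card_univ, Fintype.card_fin] at h2
      omega)
    -- The shift to `r + 1` is needed because `Marked` holds for no state in round `0`; final states
    -- enter in round `1`.
    (R := fun r a => ∀ p < I.toBase.bound, I.Codes p a → I.toBase.Marked D z (r + 1) p)
    (fun hl p hp hc => Or.inr ⟨hc.light_iff.2 hl, Or.inl ((hc.final_iff hz').2 rfl)⟩)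
    (fun r a b hl hb hmv p hp hc => by
      obtain ⟨q, hq, hqb⟩ := I.exists_codes b
      exact Or.inr ⟨hc.light_iff.2 hl, Or.inr ⟨q, hq, hb q hq hqb,
        (hc.move_iff hz').2 ⟨b, hqb, hmv⟩⟩⟩)
  obtain ⟨p, hp, hpc⟩ := I.exists_codes fun j => I.source (sel j)
  refine ⟨p, hp, (hR p hp hpc).mono ?_, (start_iff hz').2 hpc⟩
  -- Each path has at most `n` vertices, so the number of moves is at most `selCount k c * n`, and
  -- the rounds of the table suffice.
  have h1 : ∑ j, (P' (sel j)).length ≤ ∑ _j : Fin (selCount k c), n :=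
    Finset.sum_le_sum fun j _ => by simpa using ((hP' _ (hselS j)).1.nodup).length_le_card
  rw [Finset.sum_const, Finset.card_univ, Fintype.card_fin, smul_eq_mul] at h1
  have h2 : selCount k c * n ≤ (n + k + 1) * (n + k + 1) := Nat.mul_le_mul (by omega) (by omega)
  have h3 := I.sq_le_bound
  nlinarith

end Instance

/-! ### The output -/

section Output

variable {V : Type} [DecidableEq V]

theorem length_trace (a : ℕ → V) (L : ℕ) :
    (trace a L).length = 1 + ∑ r ∈ Finset.range L, if a (r + 1) ≠ a r then 1 else 0 := by
  induction L with
  | zero => simp [trace]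
  | succ L ih =>
    rw [Finset.sum_range_succ, trace, List.length_append, ih]
    by_cases h : a (L + 1) = a L <;> simp [h, add_assoc]

theorem Base.writePath_spec {n : ℕ} (b : Base) (s : Store) (z i : ℕ) {a : ℕ → Fin n}
    (h : ∀ r ≤ b.bound, b.position (s.arr 0) (s.arr 1) z i r = a r) :
    (b.writePath s z i).arr = s.arr ∧ (b.writePath s z i).out =
      s.out ++ ((trace a b.bound).length :: (trace a b.bound).map fun v => (v : ℕ)) := by
  have hsum : (1 + ∑ r ∈ Finset.range b.bound,
      if b.position (s.arr 0) (s.arr 1) z i (r + 1) ≠ b.position (s.arr 0) (s.arr 1) z i r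
        then 1 else 0) = (trace a b.bound).length := by
    rw [length_trace]
    congr 1
    refine Finset.sum_congr rfl fun r hr => ?_
    rw [Finset.mem_range] at hr
    rw [h r hr.le, h (r + 1) hr]
    simp [Fin.ext_iff]
  unfold Base.writePath
  rw [hsum, h 0 (Nat.zero_le _)]
  have := iter_induction (B := b.bound)
    (z := (s.write (trace a b.bound).length).write (a 0))
    (f := fun r s' => if b.position (s'.arr 0) (s'.arr 1) z i (r + 1) ≠
        b.position (s'.arr 0) (s'.arr 1) z i r
      then s'.write (b.position (s'.arr 0) (s'.arr 1) z i (r + 1)) else s')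
    (Inv := fun r (s' : Store) => s'.arr = s.arr ∧ s'.out = s.out ++
      ((trace a b.bound).length :: (trace a r).map fun v => (v : ℕ)))
    ⟨rfl, by simp [Store.write, trace]⟩ (by
      rintro r hr s' ⟨h1, h2⟩
      -- Writing does not touch the arrays, so the positions are the same throughout the output.
      rw [h1, h r hr.le, h (r + 1) hr]
      by_cases hc : a (r + 1) = a r
      · simp [hc, h1, h2, trace]
      · have : ((a (r + 1) : ℕ)) ≠ a r := fun he => hc (Fin.ext he)
        simp [hc, this, Store.write, h1, h2, trace])
  convert this using 2

theorem Base.writeSolution_spec {n k : ℕ} (b : Base) (s : Store) (z : ℕ) (hk : b.numPairs = k)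
    (hkb : k ≤ b.bound) {a : Fin k → ℕ → Fin n} (h : ∀ i : Fin k, ∀ r ≤ b.bound,
      b.position ((b.table s z).arr 0) ((b.table s z).arr 1) z i r = a i r) :
    (b.writeSolution s z).out = (b.table s z).out ++
      (1 :: encodePaths fun i => trace (a i) b.bound) := by
  set code : ℕ → List ℕ := fun i => if hi : i < k then (trace (a ⟨i, hi⟩) b.bound).length ::
    (trace (a ⟨i, hi⟩) b.bound).map fun v => (v : ℕ) else [] with hcode
  have hfin : (encodePaths fun i => trace (a i) b.bound) = (List.range k).flatMap code := by
    unfold encodePaths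
    rw [← List.map_coe_finRange_eq_range, List.flatMap_map]
    congr 1
    funext i
    simp [hcode]
  unfold Base.writeSolution
  have := iter_induction (B := b.bound) (z := (b.table s z).write 1)
    (f := fun i s' => if i < b.numPairs then b.writePath s' z i else s')
    (Inv := fun i (s' : Store) => s'.arr = (b.table s z).arr ∧ s'.out = (b.table s z).out ++
      (1 :: (List.range (min i k)).flatMap code))
    ⟨rfl, by simp [Store.write]⟩ (by
      rintro i hi s' ⟨h1, h2⟩
      rw [hk]
      split_ifs with hik
      · obtain ⟨h3, h4⟩ := b.writePath_spec s' z i (a := a ⟨i, hik⟩) fun r hr => by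
          rw [h1]; exact h ⟨i, hik⟩ r hr
        refine ⟨h3.trans h1, ?_⟩
        rw [h4, h2, min_eq_left hik.le, min_eq_left (by omega), List.range_succ]
        simp [hcode, hik]
      · refine ⟨h1, ?_⟩
        rw [h2, min_eq_right (by omega), min_eq_right (by omega)])
  rw [hfin]
  have h2 := this.2
  rw [min_eq_right hkb] at h2
  convert h2 using 2

end Output

/-- Feasibility together with a winning selection is necessary by `exists_winning` and sufficient by
`position_spec`. -/
theorem Instance.solve_spec {n k c : ℕ} (I : Instance n k c) (hI : I.graph.IsAcyclic) {s : Store}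
    (hs : s.arr 2 0 = 0) (ho : s.out = []) :
    ((∃ P, I.IsSolution P) →
      ∃ P, I.IsSolution P ∧ (I.toBase.solve s).out = 1 :: encodePaths P) ∧
    ((¬ ∃ P, I.IsSolution P) → (I.toBase.solve s).out = [0]) := by
  obtain ⟨ρ, hρ, hρn⟩ := exists_isRank hI
  obtain ⟨hD, ha, ho'⟩ := I.distances_spec hρ s
  unfold Base.solve
  set s₁ := I.toBase.distances s
  obtain ⟨h1, h2, h3⟩ := I.toBase.search_spec s₁ ((congrFun (ha 2 (by omega)) 0).trans hs)
  set s₂ := I.toBase.search s₁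
  rw [← h1] at hD h3
  have hout : s₂.out = [] := h2.trans (ho'.trans ho)
  by_cases hc : I.toBase.Feasible (s₂.arr 0) ∧ s₂.arr 2 0 ≠ 0
  · have h4 : (I.toBase.answer s₂) = I.toBase.writeSolution s₂ (s₂.arr 2 0 - 1) := if_pos hc
    obtain ⟨z, hz, hz1, hv, hw⟩ := h3.resolve_left fun h => hc.2 h.1
    rw [h4, hz1, Nat.add_sub_cancel]
    obtain ⟨t1, t2, t3⟩ := I.toBase.table_spec s₂ z
    obtain ⟨a, ha1, ha2⟩ := Instance.position_spec (T := (I.toBase.table s₂ z).arr 1) hρ hρn hD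
      hc.1 hv ((I.toBase.wins_table_iff s₂ z).2 hw) fun p hp => (t1 p hp).2
    have hsol := I.toBase.writeSolution_spec s₂ z I.numPairs_toBase
      (by have := I.radix_le_bound; omega) (a := a) (by rwa [t2 0 (by omega)])
    rw [t3, hout] at hsol
    exact ⟨fun _ => ⟨_, ha2, hsol⟩, fun h => absurd ⟨_, ha2⟩ h⟩
  · have h4 : (I.toBase.answer s₂) = s₂.write 0 := if_neg hc
    rw [h4]
    refine ⟨fun ⟨P, hP⟩ => absurd ?_ hc, fun _ => by simp [Store.write, hout]⟩
    obtain ⟨h5, z, hz, hv, hw⟩ := Instance.exists_winning hρ hD hP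
    refine ⟨h5, fun h0 => ?_⟩
    rcases h3 with h3 | ⟨z', -, h3, -⟩
    · exact h3.2 z hz hv hw
    · omega

end DSP

/-! ### The program and its running time -/

namespace DSP

theorem primrec_pow : Primrec₂ fun a b : ℕ => a ^ b := by
  have : Primrec₂ fun a b : ℕ => (Nat.rec 1 (fun _ y => y * a) b : ℕ) :=
    Primrec.nat_rec (f := fun _ => 1) (g := fun a (p : ℕ × ℕ) => p.2 * a) (Primrec.const 1)
      (Primrec.nat_mul.comp (Primrec.snd.comp Primrec.snd) Primrec.fst)
  refine this.of_eq fun a b => ?_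
  induction b with
  | zero => simp
  | succ b ih => rw [pow_succ, ← ih]

theorem computable_timeBound (A E : ℕ) :
    Computable fun k : ℕ => A * (2 * (k + 3) ^ (k + 2)) ^ E := by
  have h3 : Primrec fun k : ℕ => k + 3 := Primrec.nat_add.comp Primrec.id (Primrec.const 3)
  have h2 : Primrec fun k : ℕ => k + 2 := Primrec.nat_add.comp Primrec.id (Primrec.const 2)
  exact (Primrec.nat_mul.comp (Primrec.const A) (primrec_pow.comp
    (Primrec.nat_mul.comp (Primrec.const 2) (primrec_pow.comp h3 h2)) (Primrec.const E))).to_comp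

open Ctx

/-- The program computes the bound for all loops and then runs the algorithm. -/
theorem exists_program : ∃ (A : Program) (T : ℕ → ℕ), PolyBdd T ∧
    ∀ {n k c : ℕ} (I : Instance n k c), 0 < n →
      ∃ t, Computes A I.encode t
        (I.toBase.solve ⟨fun a i => I.encode.getD (I.toBase.bound + 4 * i + a) 0, []⟩).out ∧
        t ≤ T I.toBase.bound := by
  obtain ⟨p, T, ⟨a, e, hT⟩, hp⟩ := (CompE.numSel.add (CompE.const 2)).pow (α := Base)
  obtain ⟨q, U, hU, hq⟩ := CompC.solve (α := Base)
  -- The compiled programs find their loop bound in register `0`. A first stage with bound `n + k +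
  -- 2` computes the true bound as a power, which is then moved there for the main stage.
  refine ⟨.seq (.set 0 (.add (.add (.mem (.lit 0)) (.mem (.lit 1))) (.lit 2)))
    (.seq (p id 1) (.seq (.set 0 (.reg 1)) (q id 1))), fun B => 8 + (a * (B + 1) ^ e + (2 + U B)),
    (PolyBdd.const 8).add (PolyBdd.add ⟨a, e, fun _ => le_rfl⟩ ((PolyBdd.const 2).add hU)),
    fun {n k c} I hn => ?_⟩
  have hfit : Fits Base id 1 := ⟨Nat.one_pos, fun i hi => absurd hi (Nat.not_lt_zero i)⟩
  have h0 : I.encode.getD 0 0 = n := by simp [Instance.encode]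
  have h1 : I.encode.getD 1 0 = k := by simp [Instance.encode]
  have h2 : I.encode.getD 2 0 = c := by simp [Instance.encode]
  -- the first stage, with `n + k + 2` as bound for the loops
  set b : Base := ⟨n + k + 2, fun i => I.encode.getD i 0⟩ with hb
  -- The first stage needs only the cells of `n`, `k` and `c`; they lie below its bound because `n`
  -- is positive.
  have hread : ∀ i < 3, b.read i = I.encode.getD i 0 := fun i hi =>
    if_pos (show n + k + 2 - i ≠ 0 by omega)
  have hn' : b.numVert = n := (hread 0 (by omega)).trans h0
  have hk' : b.numPairs = k := (hread 1 (by omega)).trans h1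
  have hc' : b.capacity = c := (hread 2 (by omega)).trans h2
  have hrad : b.radix = n + k + 2 := by rw [Base.radix, hn', hk']
  have hsel : b.numSel = Instance.selCount k c := by
    rw [Base.numSel, Base.defect, hk', hc', Instance.selCount]
  have hsk : Instance.selCount k c ≤ k := Instance.selCount_le
  obtain ⟨t, τ, hE, ht, hv, hreg, hm, ho⟩ := hp id 1 hfit
    ⟨fun a i => I.encode.getD (n + k + 2 + 4 * i + a) 0, []⟩ b
    { initial I.encode with reg := Function.update (fun _ => 0) 0 (n + k + 2) }
    ⟨by simp [hb], fun i _ => rfl, fun a _ i => rfl, rfl⟩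
    fun i hi => absurd hi (Nat.not_lt_zero i)
  have hB : b.pow (b.numSel + 2) = I.toBase.bound := by
    rw [Base.pow_eq (by rw [hrad]) (by rw [hsel]; change _ ≤ n + k + 2; omega), hrad, hsel]
    rfl
  change τ.reg 1 = b.pow (b.numSel + 2) at hv
  rw [hB] at hv
  -- The first stage leaves the memory as it was, so the arrays of the main stage start with the
  -- initial contents of the cells beyond the bound.
  obtain ⟨u, ρ, hE', hu, hH, -⟩ := hq id 1 hfit
    ⟨fun a i => I.encode.getD (I.toBase.bound + 4 * i + a) 0, []⟩ I.toBase
    { τ with reg := Function.update τ.reg 0 (τ.reg 1) }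
    ⟨by simp [hv], fun i _ => by simp only [hm]; rfl, fun a _ i => by simp only [hm]; rfl, ho⟩
    fun i hi => absurd hi (Nat.not_lt_zero i)
  refine ⟨_, ⟨ρ, (Exec.set _ _ _).seq (Exec.seq (t := t) (τ := τ) ?_ ((Exec.set _ _ _).seq hE')), hH.out⟩,
    ?_⟩
  · convert hE using 3
    · rfl
    · change I.encode.getD 0 0 + I.encode.getD 1 0 + 2 = n + k + 2
      rw [h0, h1]
  · refine add_le_add (by simp [Expr.cost]) (add_le_add ?_ (add_le_add (by simp [Expr.cost]) hu))
    -- The function `T` need not be monotone; its polynomial bound is, which allows the passage from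
    -- the small bound to the large one.
    refine ht.trans ((hT _).trans (Nat.mul_le_mul_left _ (Nat.pow_le_pow_left ?_ e)))
    have := I.radix_le_bound
    change n + k + 2 + 1 ≤ _
    omega

/-- For positive `n` one has `n + k + 2 ≤ (k + 3) * n`. The number of selected pairs is at most `k`,
which bounds the exponent of `k + 3`, and at most `3 * (k - c)`, which gives the exponent `3 * (k -
c) + 2 ≤ 5 * max (k - c) 1` of `n`. The factor 2 absorbs the summand 1. -/
theorem Instance.bound_le {n k c : ℕ} (I : Instance n k c) (hn : 0 < n) :
    I.toBase.bound + 1 ≤ 2 * (k + 3) ^ (k + 2) * n ^ (5 * max (k - c) 1) := by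
  have hsk : selCount k c ≤ k := selCount_le
  have h1 : n + k + 2 ≤ (k + 3) * n := by nlinarith
  have h2 : I.toBase.bound ≤ (k + 3) ^ (k + 2) * n ^ (5 * max (k - c) 1) := by
    calc I.toBase.bound ≤ ((k + 3) * n) ^ (selCount k c + 2) := Nat.pow_le_pow_left h1 _
      _ = (k + 3) ^ (selCount k c + 2) * n ^ (selCount k c + 2) := mul_pow _ _ _
      _ ≤ _ := Nat.mul_le_mul (Nat.pow_le_pow_right (by omega) (by omega))
          (Nat.pow_le_pow_right hn (by unfold selCount; omega))
  have h3 : 0 < (k + 3) ^ (k + 2) * n ^ (5 * max (k - c) 1) := by positivity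
  rw [mul_assoc]
  omega

end DSP

theorem theorem1 :
    ∃ (A : DSP.Program) (f : ℕ → ℕ) (C : ℕ), Computable f ∧
      ∀ (n k c : ℕ) (I : DSP.Instance n k c), 0 < n → I.graph.IsAcyclic →
        ∃ (t : ℕ) (output : List ℕ),
          DSP.Computes A I.encode t output ∧
          t ≤ f k * n ^ (C * max (k - c) 1) ∧
          ((∃ P, I.IsSolution P) →
            ∃ P, I.IsSolution P ∧ output = 1 :: DSP.encodePaths P) ∧
          ((¬ ∃ P, I.IsSolution P) → output = [0]) := by
  obtain ⟨A, T, ⟨a, e, hT⟩, hA⟩ := DSP.exists_program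
  refine ⟨A, fun k => a * (2 * (k + 3) ^ (k + 2)) ^ e, 5 * e, DSP.computable_timeBound a e,
    fun n k c I hn hI => ?_⟩
  obtain ⟨t, ht, htT⟩ := hA I hn
  -- The cell for the selection lies beyond the input and is therefore blank, as the search
  -- requires.
  have hzero : I.encode.getD (I.toBase.bound + 4 * 0 + 2) 0 = 0 :=
    List.getD_eq_default _ _ (by have := I.length_encode_le; omega)
  obtain ⟨h1, h2⟩ := I.solve_spec hI
    (s := ⟨fun a i => I.encode.getD (I.toBase.bound + 4 * i + a) 0, []⟩) hzero rfl
  refine ⟨t, _, ht, htT.trans ((hT _).trans ?_), h1, h2⟩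
  calc a * (I.toBase.bound + 1) ^ e
      ≤ a * (2 * (k + 3) ^ (k + 2) * n ^ (5 * max (k - c) 1)) ^ e :=
        Nat.mul_le_mul_left _ (Nat.pow_le_pow_left (I.bound_le hn) e)
    _ = a * (2 * (k + 3) ^ (k + 2)) ^ e * n ^ (5 * e * max (k - c) 1) := by
        rw [mul_pow _ (n ^ _), ← pow_mul]; ring_nf
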